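/- For $c_1,c_2\ge 0$ let $\mathcal{L}(c_1,c_2)$ be the class of laws on $\mathbb{R}$ of random variables of the form $u(\xi)$, where $\xi$ is a standard Gaussian random variable and $u$ is a twice continuously differentiable function with $|u'(x)|\le c_1$ and $|u''(x)|\le c_2$ for all $x\in\mathbb{R}$. Let $d_{TV}(U,V)=\sup_B|\mathbb{P}(U\in B)-\mathbb{P}(V\in B)|$, the supremum being over all Borel sets $B\subseteq\mathbb{R}$. For an entire function $f(z)=\sum_{m\ge 0}b_mz^m$ put $$f_1(z)=\sum_{m\ge 1}m|b_m|z^{m-1},\qquad f_2(z)=\sum_{m\ge 2}m(m-1)|b_m|z^{m-2},$$ and $f(A)=\sum_{m\ge 0}b_mA^m$ for a square matrix $A$. Let $1\le n\le N$ be integers, let $X=(X_{ij})_{1\le i\le n,\,1\le j\le N}$ be a random real matrix, let $A=N^{-1}XX^t$, and let $\lambda$ be the largest eigenvalue of $A$. Let $f$ be any entire function and let $$a=\bigl(\mathbb{E}(f_1(\lambda)^4\lambda^2)\bigr)^{1/4},\qquad b=\bigl(\mathbb{E}(f_1(\lambda)+2n^{-1/2}f_2(\lambda)\lambda)^4\bigr)^{1/4},$$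 which are elements of $[0,\infty]$. Suppose that $W=\operatorname{Re}\operatorname{Tr}f(A)$ has finite fourth moment, let $\sigma^2=\mathrm{Var}(W)$, and let $Z$ be a normal random variable with the same mean and variance as $W$ (a constant if $\sigma^2=0$; in that case both bounds below are trivial, since the law of $Z$ is that of $W$). (i) If the entries $X_{ij}$ are independent and the law of each of them is in $\mathcal{L}(c_1,c_2)$, where $c_1,c_2\ge 0$ are finite, then $$d_{TV}(W,Z)\le\frac{8\sqrt5}{\sigma^2}\left(\frac{c_1c_2a^2\sqrt n}{N}+\frac{c_1^3\,ab\,n}{N^{3/2}}\right).$$ (ii) If instead the entries of $X$ are jointly Gaussian with mean $0$ and $nN\times nN$ covariance matrix $\Sigma$ (possibly singular), then, with $\|\Sigma\|$ the (Euclidean) operator norm of $\Sigma$, $$d_{TV}(W,Z)\le\frac{8\sqrt5\,\|\Sigma\|^{3/2}\,ab\,n}{\sigma^2N^{3/2}}.$$ -/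

import Mathlib

open MeasureTheory ProbabilityTheory Matrix
open scoped ENNReal NNReal

/-- `LawClass c₁ c₂` is the class `𝓛(c₁, c₂)` of laws on `ℝ` of the random variables `u(Z)`, where
`Z` is a standard Gaussian and `u` is a `C²` function with `|u'| ≤ c₁` and `|u''| ≤ c₂`. -/
def LawClass (c₁ c₂ : ℝ≥0) : Set (Measure ℝ) :=
  {μ | ∃ u : ℝ → ℝ, ContDiff ℝ 2 u ∧ (∀ x, |deriv u x| ≤ c₁) ∧ (∀ x, |deriv (deriv u) x| ≤ c₂) ∧
    μ = (gaussianReal 0 1).map u}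

/-- Total variation distance of two laws on `ℝ`: the supremum of `|μ(B) - ν(B)|` over all Borel
sets `B`. -/
noncomputable def tvDist (μ ν : Measure ℝ) : ℝ≥0∞ :=
  ⨆ (B : Set ℝ) (_ : MeasurableSet B), ENNReal.ofReal |μ.real B - ν.real B|

/-- The coefficient `b_m` in the power series `f(z) = ∑ b_m z^m` of an entire function. -/
noncomputable def entireCoeff (f : ℂ → ℂ) (m : ℕ) : ℂ :=
  iteratedDeriv m f 0 / (m.factorial : ℂ)

/-- `f₁(x) = ∑_{m ≥ 1} m |b_m| x^(m-1)`, with the summation index shifted by one. -/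
noncomputable def entireF₁ (f : ℂ → ℂ) (x : ℝ) : ℝ :=
  ∑' m : ℕ, ((m : ℝ) + 1) * ‖entireCoeff f (m + 1)‖ * x ^ m

/-- `f₂(x) = ∑_{m ≥ 2} m (m-1) |b_m| x^(m-2)`, with the summation index shifted by two. -/
noncomputable def entireF₂ (f : ℂ → ℂ) (x : ℝ) : ℝ :=
  ∑' m : ℕ, ((m : ℝ) + 2) * ((m : ℝ) + 1) * ‖entireCoeff f (m + 2)‖ * x ^ m

/-- The matrix `f(A) = ∑ b_m A^m` for an entire function `f`. -/
noncomputable def entireMatrix {n : ℕ} (f : ℂ → ℂ) (A : Matrix (Fin n) (Fin n) ℂ) :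
    Matrix (Fin n) (Fin n) ℂ :=
  ∑' m : ℕ, entireCoeff f m • A ^ m

/-- The Wishart (sample covariance) matrix `N⁻¹ X Xᵗ` of the data matrix `X`. -/
noncomputable def wishart {n N : ℕ} (X : Matrix (Fin n) (Fin N) ℝ) : Matrix (Fin n) (Fin n) ℝ :=
  (N : ℝ)⁻¹ • (X * Xᵀ)

/-- The largest (real) eigenvalue of a square matrix. -/
noncomputable def largestEigenvalue {n : ℕ} (A : Matrix (Fin n) (Fin n) ℝ) : ℝ :=
  sSup (spectrum ℝ A)

/-- The operator norm of a real square matrix, with respect to the Euclidean norm. -/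
noncomputable def matrixOpNorm {ι : Type*} [Fintype ι] [DecidableEq ι] (S : Matrix ι ι ℝ) : ℝ≥0∞ :=
  ‖Matrix.toEuclideanCLM (𝕜 := ℝ) S‖ₑ

/-- For an entire function, the coefficients `b_m` do give the power series of `f`. -/
theorem hasSum_entireCoeff {f : ℂ → ℂ} (hf : Differentiable ℂ f) (z : ℂ) :
    HasSum (fun m => entireCoeff f m * z ^ m) (f z) := by
  have h := Complex.hasSum_taylorSeries_of_entire hf 0 z
  simp only [sub_zero, smul_eq_mul] at h
  have e : (fun m => entireCoeff f m * z ^ m) =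
      fun m => ((m.factorial : ℂ)⁻¹) * (z ^ m * iteratedDeriv m f 0) := by
    funext m
    unfold entireCoeff
    ring
  rw [e]
  exact h

/-- For an entire function, the series that defines `f(A)` converges. -/
theorem hasSum_entireMatrix {n : ℕ} {f : ℂ → ℂ} (hf : Differentiable ℂ f)
    (A : Matrix (Fin n) (Fin n) ℂ) :
    HasSum (fun m => entireCoeff f m • A ^ m) (entireMatrix f A) := by
  refine Summable.hasSum ?_
  let _ : NormedRing (Matrix (Fin n) (Fin n) ℂ) := Matrix.linftyOpNormedRing
  let _ : NormedAlgebra ℂ (Matrix (Fin n) (Fin n) ℂ) := Matrix.linftyOpNormedAlgebra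
  have h := (hasSum_entireCoeff hf (‖A‖ : ℂ)).summable.norm
  refine Summable.of_norm_bounded_eventually_nat h ?_
  filter_upwards [Filter.eventually_gt_atTop 0] with m hm
  rw [norm_smul, norm_mul, norm_pow (‖A‖ : ℂ), Complex.norm_real, norm_norm]
  exact mul_le_mul_of_nonneg_left (norm_pow_le' A hm) (norm_nonneg _)

/-- The Wishart matrix has a largest eigenvalue, and it is `largestEigenvalue`. -/
theorem isGreatest_largestEigenvalue {n N : ℕ} (hn : 0 < n) (X : Matrix (Fin n) (Fin N) ℝ) :
    IsGreatest (spectrum ℝ (wishart X)) (largestEigenvalue (wishart X)) := by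
  have hA : (wishart X).IsHermitian := by
    ext i j
    simp [wishart, Matrix.mul_apply, mul_comm]
  have : Nonempty (Fin n) := ⟨⟨0, hn⟩⟩
  have hs := hA.spectrum_real_eq_range_eigenvalues
  have hfin : (spectrum ℝ (wishart X)).Finite := by
    rw [hs]
    exact Set.finite_range _
  have hne : (spectrum ℝ (wishart X)).Nonempty := by
    rw [hs]
    exact Set.range_nonempty _
  exact ⟨hne.csSup_mem hfin, fun x hx => le_csSup hfin.bddAbove hx⟩

open Filter Topology
open scoped InnerProductSpace

set_option linter.unusedSectionVars false

/-! ### The standard Gaussian law on the line -/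

section GaussianReal

/-! The law of the data matrix is the image under a map `U` of a standard Gaussian vector: `U` acts
coordinate by coordinate in case (i) and is the linear map `√Σ` in case (ii). So `W` has the law of
`G = spectralFun f ∘ U` at a Gaussian point, and a second order Poincaré inequality applies,
`tvDist_map_stdGaussian_le`: the distance to the normal law is at most `4K/σ²` as soon as `E‖H(x)ᵗ
∇G(x_θ)‖² ≤ K²` for every `θ`. Here `H` is the derivative of `∇G`, `x` and `y` are independent
standard Gaussian vectors, and `x_θ = cos θ • x + sin θ • y` is `rotate θ (x, y)`.

That inequality combines Stein's method with interpolation. Stein's equation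
(`exists_stein_solution`) reduces the matter to bounding `Cov(φ(G), G) - E φ'(G) · Var G` for `|φ'|
≤ 2/σ`. Differentiation in `θ` and Gaussian integration by parts (`hasDerivAt_integral_mul_rotate`)
represent the covariance as `∫ sin θ · E[φ'(G(x)) ⟪∇G(x), ∇G(x_θ)⟫] dθ` over `[0, π/2]`, and the
variance is the case `φ = id`. The difference therefore carries the factor `φ'(G(x)) - E φ'(G)`,
which has mean zero in `x` for each fixed `y`, so that only the fluctuation in `x` of `⟪∇G(x),
∇G(x_θ)⟫` counts. The ordinary Poincaré inequality, itself a case of the interpolation, bounds it by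
the gradient `H(x)ᵗ∇G(x_θ) + cos θ • H(x_θ)ᵗ∇G(x)`. All this is done for bounded functions
(`covariance_sub_le_of_bounded`) and extended to fourth moments by a smooth cutoff
(`covariance_sub_le`).

The rest is matrix calculus with `λ = ‖X‖²/N`. The gradient of `Tr A^(m+1)` is `(2(m+1)/N) A^m X`,
whose rows are controlled by an operator norm, and `A^m X` has a derivative of norm at most `(2m+1)
λ^m` (`norm_wishartPowDeriv_le`). Summing the power series bounds each row of the gradient of
`spectralFun f` by `(2/N) f₁(λ) ‖X‖` and its Hessian by `(2/N)(f₁(λ) + 2λ f₂(λ))`. `IsControlledMap`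
isolates what the chain rule must give for `U`, and both choices of `U` satisfy it. Hölder's
inequality with exponents 4, 4, 2 then produces `a` and `b`, with a constant `16 ≤ 8√5`. -/

theorem hasDerivAt_gaussianPDFReal_zero_one (s : ℝ) :
    HasDerivAt (gaussianPDFReal 0 1) (-(s * gaussianPDFReal 0 1 s)) s := by
  have h : HasDerivAt (fun s : ℝ => -(s - 0) ^ 2 / (2 * ((1 : ℝ≥0) : ℝ))) (-s) s := by
    have := ((((hasDerivAt_id s).sub_const 0).pow 2).neg).div_const (2 * ((1 : ℝ≥0) : ℝ))
    refine this.congr_deriv ?_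
    simp only [Nat.cast_ofNat, id_eq, NNReal.coe_one]
    ring
  have h2 := (h.exp).const_mul ((√(2 * Real.pi * ((1 : ℝ≥0) : ℝ)))⁻¹)
  rw [gaussianPDFReal_def]
  refine h2.congr_deriv ?_
  ring

theorem integrable_id_gaussianReal : Integrable (fun x : ℝ => x) (gaussianReal 0 1) :=
  IsGaussian.integrable_id

theorem integrable_mul_gaussianPDFReal {f : ℝ → ℝ} (hf : Integrable f (gaussianReal 0 1)) :
    Integrable (fun x => gaussianPDFReal 0 1 x * f x) := by
  rw [gaussianReal_of_var_ne_zero 0 one_ne_zero] at hf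
  rw [integrable_withDensity_iff_integrable_smul' (measurable_gaussianPDF 0 1)
    (ae_of_all _ fun x => gaussianPDF_lt_top)] at hf
  simpa [toReal_gaussianPDF] using hf

/-- Stein's identity for the standard Gaussian law on `ℝ`. -/
theorem integral_id_mul_gaussianReal {f f' : ℝ → ℝ} {C : ℝ} (hf : ∀ x, HasDerivAt f (f' x) x)
    (hf' : Continuous f') (hb : ∀ x, |f x| ≤ C) (hb' : ∀ x, |f' x| ≤ C) :
    ∫ x, x * f x ∂gaussianReal 0 1 = ∫ x, f' x ∂gaussianReal 0 1 := by
  have hfc : Continuous f := continuous_iff_continuousAt.2 fun x => (hf x).continuousAt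
  have i1 : Integrable f (gaussianReal 0 1) :=
    Integrable.of_bound hfc.aestronglyMeasurable C (ae_of_all _ hb)
  have i2 : Integrable f' (gaussianReal 0 1) :=
    Integrable.of_bound hf'.aestronglyMeasurable C (ae_of_all _ hb')
  have i3 : Integrable (fun x => x * f x) (gaussianReal 0 1) :=
    integrable_id_gaussianReal.mul_bdd hfc.aestronglyMeasurable (ae_of_all _ hb)
  -- Integration by parts against the density `p`, for which `p'(s) = -s p(s)`.
  have key := integral_mul_deriv_eq_deriv_mul_of_integrable (u := f) (u' := f')
    (v := gaussianPDFReal 0 1) (v' := fun s => -(s * gaussianPDFReal 0 1 s))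
    (fun x _ => hf x) (fun x _ => hasDerivAt_gaussianPDFReal_zero_one x)
    ((integrable_mul_gaussianPDFReal i3).neg.congr (ae_of_all _ fun x => by
      simp only [Pi.neg_apply, Pi.mul_apply]; ring))
    ((integrable_mul_gaussianPDFReal i2).congr (ae_of_all _ fun x => by
      simp only [Pi.mul_apply]; ring))
    ((integrable_mul_gaussianPDFReal i1).congr (ae_of_all _ fun x => by
      simp only [Pi.mul_apply]; ring))
  rw [integral_gaussianReal_eq_integral_smul one_ne_zero,
    integral_gaussianReal_eq_integral_smul one_ne_zero]
  simp only [smul_eq_mul]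
  have e1 : ∫ x, f x * -(x * gaussianPDFReal 0 1 x) =
      -∫ x, gaussianPDFReal 0 1 x * (x * f x) := by
    rw [← integral_neg]; congr with x; ring
  have e2 : ∫ x, f' x * gaussianPDFReal 0 1 x = ∫ x, gaussianPDFReal 0 1 x * f' x := by
    congr with x; ring
  rw [e1, e2] at key
  linarith

end GaussianReal

/-! ### Invariance of the standard Gaussian law, integration by parts -/

section StdGaussian

variable {E : Type*} [NormedAddCommGroup E] [InnerProductSpace ℝ E] [FiniteDimensional ℝ E]
  [MeasurableSpace E] [BorelSpace E] [SecondCountableTopology E]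

open Complex in
theorem charFunDual_stdGaussian_inner {L : StrongDual ℝ E} {u : E} (h : ∀ x, L x = ⟪u, x⟫_ℝ) :
    charFunDual (stdGaussian E) L = exp (-‖u‖ ^ 2 / 2) := by
  have : L = InnerProductSpace.toDual ℝ E u := by
    ext x; simp [h]
  rw [charFunDual_stdGaussian, this, LinearIsometryEquiv.norm_map]

theorem exists_inner_eq (L : StrongDual ℝ E) : ∃ u : E, ∀ x, L x = ⟪u, x⟫_ℝ :=
  ⟨(InnerProductSpace.toDual ℝ E).symm L, fun x => by simp⟩

/-- The product of two standard Gaussian laws is invariant under planar isometries. -/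
theorem map_prod_stdGaussian {a b c d : ℝ} (h1 : a ^ 2 + b ^ 2 = 1) (h2 : c ^ 2 + d ^ 2 = 1)
    (h3 : a * c + b * d = 0) :
    ((stdGaussian E).prod (stdGaussian E)).map
      (fun p => (a • p.1 + b • p.2, c • p.1 + d • p.2)) =
      (stdGaussian E).prod (stdGaussian E) := by
  let T : E × E →L[ℝ] E × E :=
    (a • ContinuousLinearMap.fst ℝ E E + b • ContinuousLinearMap.snd ℝ E E).prod
      (c • ContinuousLinearMap.fst ℝ E E + d • ContinuousLinearMap.snd ℝ E E)
  have hT : (fun p : E × E => (a • p.1 + b • p.2, c • p.1 + d • p.2)) = T := by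
    ext p <;> simp [T]
  rw [hT]
  have : IsProbabilityMeasure (((stdGaussian E).prod (stdGaussian E)).map T) :=
    Measure.isProbabilityMeasure_map T.continuous.aemeasurable
  refine Measure.ext_of_charFunDual ?_
  ext L
  obtain ⟨u, hu⟩ := exists_inner_eq (L.comp (.inl ℝ E E))
  obtain ⟨w, hw⟩ := exists_inner_eq (L.comp (.inr ℝ E E))
  have hL : ∀ x y, L (x, y) = ⟪u, x⟫_ℝ + ⟪w, y⟫_ℝ := fun x y => by
    rw [← hu, ← hw]
    simp only [ContinuousLinearMap.comp_apply, ContinuousLinearMap.inl_apply,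
      ContinuousLinearMap.inr_apply, ← map_add]
    simp
  rw [charFunDual_map, charFunDual_prod, charFunDual_prod, charFunDual_stdGaussian_inner hu,
    charFunDual_stdGaussian_inner hw,
    charFunDual_stdGaussian_inner (u := a • u + c • w) (fun x => by
      simp [T, hL, inner_add_left, inner_smul_left, inner_smul_right]),
    charFunDual_stdGaussian_inner (u := b • u + d • w) (fun x => by
      simp [T, hL, inner_add_left, inner_smul_left, inner_smul_right]),
    ← Complex.exp_add, ← Complex.exp_add]
  congr 1
  -- The characteristic functions depend only on squared norms, and the transposed orthogonal matrix
  -- preserves their sum.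
  have e : ‖a • u + c • w‖ ^ 2 + ‖b • u + d • w‖ ^ 2 = ‖u‖ ^ 2 + ‖w‖ ^ 2 := by
    rw [norm_add_sq_real, norm_add_sq_real]
    simp only [norm_smul, inner_smul_left, inner_smul_right, mul_pow, Real.norm_eq_abs, sq_abs]
    simp only [conj_trivial]
    linear_combination ‖u‖ ^ 2 * h1 + ‖w‖ ^ 2 * h2 + 2 * ⟪u, w⟫_ℝ * h3
  have e' : ((‖a • u + c • w‖ ^ 2 + ‖b • u + d • w‖ ^ 2 : ℝ) : ℂ) =
    ((‖u‖ ^ 2 + ‖w‖ ^ 2 : ℝ) : ℂ) := by rw [e]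
  push_cast at e'
  linear_combination (-1 / 2 : ℂ) * e'

/-- Resampling one coordinate of a standard Gaussian vector does not change its law. -/
theorem map_resample_stdGaussian {v : E} (hv : ‖v‖ = 1) :
    ((stdGaussian E).prod (gaussianReal 0 1)).map
      (fun p => p.1 - ⟪v, p.1⟫_ℝ • v + p.2 • v) = stdGaussian E := by
  let T : E × ℝ →L[ℝ] E :=
    (ContinuousLinearMap.id ℝ E - (innerSL ℝ v).smulRight v).comp (.fst ℝ E ℝ) +
      ((ContinuousLinearMap.id ℝ ℝ).smulRight v).comp (.snd ℝ E ℝ)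
  have hT : (fun p : E × ℝ => p.1 - ⟪v, p.1⟫_ℝ • v + p.2 • v) = T := by
    ext p; simp [T]
  rw [hT]
  have : IsProbabilityMeasure (((stdGaussian E).prod (gaussianReal 0 1)).map T) :=
    Measure.isProbabilityMeasure_map T.continuous.aemeasurable
  refine Measure.ext_of_charFunDual ?_
  ext L
  obtain ⟨u, hu⟩ := exists_inner_eq L
  have hv2 : ⟪v, v⟫_ℝ = 1 := by rw [real_inner_self_eq_norm_sq, hv]; norm_num
  rw [charFunDual_map, charFunDual_prod, charFunDual_stdGaussian_inner hu,
    charFunDual_stdGaussian_inner (u := u - ⟪u, v⟫_ℝ • v) (fun x => by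
      simp [T, hu, inner_sub_left, inner_smul_left, inner_smul_right]
      ring)]
  have e2 : charFunDual (gaussianReal 0 1) ((L.comp T).comp (.inr ℝ E ℝ)) =
      Complex.exp (-((⟪u, v⟫_ℝ : ℝ) : ℂ) ^ 2 / 2) := by
    have : charFunDual (gaussianReal 0 1) ((L.comp T).comp (.inr ℝ E ℝ)) =
        charFun (gaussianReal 0 1) ⟪u, v⟫_ℝ := by
      rw [charFunDual_apply, charFun_apply_real]
      congr with x
      simp [T, hu, inner_smul_right]
      ring_nf
    rw [this, charFun_gaussianReal]
    congr 1
    simp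
    ring
  rw [e2, ← Complex.exp_add]
  congr 1
  -- Pythagoras: the fresh coordinate supplies exactly the variance that the projection removes.
  have e : ‖u - ⟪u, v⟫_ℝ • v‖ ^ 2 + ⟪u, v⟫_ℝ ^ 2 = ‖u‖ ^ 2 := by
    rw [norm_sub_sq_real]
    simp only [norm_smul, inner_smul_right, mul_pow, Real.norm_eq_abs, sq_abs, hv]
    ring
  have e' : ((‖u - ⟪u, v⟫_ℝ • v‖ ^ 2 + ⟪u, v⟫_ℝ ^ 2 : ℝ) : ℂ) = ((‖u‖ ^ 2 : ℝ) : ℂ) := by rw [e]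
  push_cast at e'
  linear_combination (-1 / 2 : ℂ) * e'

/-- Gaussian integration by parts. -/
theorem integral_inner_mul_stdGaussian {F : E → ℝ} {F' : E → E} {C : ℝ}
    (hF : ∀ x, HasGradientAt F (F' x) x) (hF' : Continuous F') (hb : ∀ x, |F x| ≤ C)
    (hb' : ∀ x, ‖F' x‖ ≤ C) (v : E) :
    ∫ x, ⟪v, x⟫_ℝ * F x ∂stdGaussian E = ∫ x, ⟪F' x, v⟫_ℝ ∂stdGaussian E := by
  have hFc : Continuous F := continuous_iff_continuousAt.2 fun x => (hF x).continuousAt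
  suffices H : ∀ v : E, ‖v‖ = 1 →
      ∫ x, ⟪v, x⟫_ℝ * F x ∂stdGaussian E = ∫ x, ⟪F' x, v⟫_ℝ ∂stdGaussian E by
    rcases eq_or_ne v 0 with rfl | hv
    · simp
    · have h := H (‖v‖⁻¹ • v) (by rw [norm_smul, norm_inv, norm_norm, inv_mul_cancel₀ (by simpa)])
      simp only [inner_smul_left, inner_smul_right, conj_trivial, mul_assoc,
        integral_const_mul] at h
      exact mul_left_cancel₀ (by simpa using hv) h
  intro v hv
  have hC : 0 ≤ C := (abs_nonneg _).trans (hb 0)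
  set τ : E × ℝ → E := fun p => p.1 - ⟪v, p.1⟫_ℝ • v + p.2 • v with hτ
  have hτc : Continuous τ := by fun_prop
  have hmeas := map_resample_stdGaussian hv
  rw [← hmeas, integral_map hτc.aemeasurable
    (by rw [hmeas]; exact (by fun_prop : Continuous _).aestronglyMeasurable),
    integral_map hτc.aemeasurable
    (by rw [hmeas]; exact (by fun_prop : Continuous _).aestronglyMeasurable)]
  -- After resampling, the component along `v` is an independent real Gaussian, so Fubini leaves the
  -- one-dimensional Stein identity for each fixed `x`.
  have ein : ∀ p, ⟪v, τ p⟫_ℝ = p.2 := fun p => by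
    simp [hτ, inner_add_right, inner_sub_right, inner_smul_right, hv]
  simp only [ein]
  have i1 : Integrable (fun p : E × ℝ => p.2 * F (τ p))
      ((stdGaussian E).prod (gaussianReal 0 1)) :=
    (integrable_id_gaussianReal.comp_snd (stdGaussian E)).mul_bdd
      (c := C) (by fun_prop : Continuous _).aestronglyMeasurable (ae_of_all _ fun p => hb _)
  have i2 : Integrable (fun p : E × ℝ => ⟪F' (τ p), v⟫_ℝ)
      ((stdGaussian E).prod (gaussianReal 0 1)) :=
    Integrable.of_bound (by fun_prop : Continuous _).aestronglyMeasurable (C * ‖v‖)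
      (ae_of_all _ fun p => (norm_inner_le_norm _ _).trans
        (mul_le_mul_of_nonneg_right (hb' _) (norm_nonneg _)))
  rw [integral_prod _ i1, integral_prod _ i2]
  congr with x
  refine integral_id_mul_gaussianReal (C := C) (fun s => ?_) (by fun_prop) (fun s => hb _)
    (fun s => ?_)
  · have h1 : HasDerivAt (fun s : ℝ => τ (x, s)) v s := by
      have := ((hasDerivAt_id s).smul_const v).const_add (x - ⟪v, x⟫_ℝ • v)
      simpa [hτ] using this
    have h2 := (hF (τ (x, s))).hasFDerivAt.comp_hasDerivAt s h1
    exact h2.congr_deriv (by simp)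
  · refine (norm_inner_le_norm (𝕜 := ℝ) _ _).trans ?_
    rw [hv, mul_one]
    exact hb' _

end StdGaussian

/-! ### Gaussian interpolation and the Poincaré inequality -/

section Interpolation

variable {E : Type*} [NormedAddCommGroup E] [InnerProductSpace ℝ E] [FiniteDimensional ℝ E]
  [MeasurableSpace E] [BorelSpace E] [SecondCountableTopology E]

/-- The rotation that interpolates between the two coordinates of `E × E`. -/
noncomputable def rotate (θ : ℝ) (p : E × E) : E := Real.cos θ • p.1 + Real.sin θ • p.2

@[fun_prop]
theorem continuous_rotate (θ : ℝ) : Continuous (rotate θ : E × E → E) := by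
  unfold rotate; fun_prop

theorem map_rotate_stdGaussian (θ : ℝ) :
    ((stdGaussian E).prod (stdGaussian E)).map
      (fun p => (Real.cos θ • p.1 - Real.sin θ • p.2, Real.sin θ • p.1 + Real.cos θ • p.2)) =
      (stdGaussian E).prod (stdGaussian E) := by
  have := map_prod_stdGaussian (E := E) (a := Real.cos θ) (b := -Real.sin θ) (c := Real.sin θ)
    (d := Real.cos θ) (by rw [neg_sq]; exact Real.cos_sq_add_sin_sq θ)
    (Real.sin_sq_add_cos_sq θ) (by ring)
  simpa only [neg_smul, ← sub_eq_add_neg] using this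

/-- A reflection is taken instead of a rotation because it is an involution: it exchanges `p.1` and
`rotate θ p`, so these two vectors form an exchangeable pair. -/
theorem map_swap_rotate_stdGaussian (θ : ℝ) :
    ((stdGaussian E).prod (stdGaussian E)).map
      (fun p => (rotate θ p, Real.sin θ • p.1 - Real.cos θ • p.2)) =
      (stdGaussian E).prod (stdGaussian E) := by
  have := map_prod_stdGaussian (E := E) (a := Real.cos θ) (b := Real.sin θ) (c := Real.sin θ)
    (d := -Real.cos θ) (Real.cos_sq_add_sin_sq θ)
    (by rw [neg_sq]; exact Real.sin_sq_add_cos_sq θ) (by ring)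
  simpa only [rotate, neg_smul, ← sub_eq_add_neg] using this

theorem rotate_swap_rotate (θ : ℝ) (p : E × E) :
    rotate θ (rotate θ p, Real.sin θ • p.1 - Real.cos θ • p.2) = p.1 := by
  simp only [rotate, smul_add, smul_sub, smul_smul]
  have h := Real.cos_sq_add_sin_sq θ
  have e : p.1 = (Real.cos θ ^ 2 + Real.sin θ ^ 2) • p.1 := by rw [h, one_smul]
  nth_rw 3 [e]
  module

theorem map_rotate_eq_stdGaussian (θ : ℝ) :
    ((stdGaussian E).prod (stdGaussian E)).map (rotate θ) = stdGaussian E := by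
  have h := congrArg (Measure.map Prod.fst) (map_swap_rotate_stdGaussian (E := E) θ)
  rw [Measure.map_map measurable_fst (by fun_prop), ← Measure.fst, Measure.fst_prod] at h
  exact h

theorem integral_swap_rotate (θ : ℝ) {f : E → E → ℝ} (hf : Continuous fun p : E × E => f p.1 p.2) :
    ∫ p, f (rotate θ p) p.1 ∂((stdGaussian E).prod (stdGaussian E)) =
      ∫ p, f p.1 (rotate θ p) ∂((stdGaussian E).prod (stdGaussian E)) := by
  conv_rhs => rw [← map_swap_rotate_stdGaussian θ]
  rw [integral_map (by fun_prop)]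
  · simp only [rotate_swap_rotate]
  · exact (hf.comp (continuous_fst.prodMk (continuous_rotate θ))).aestronglyMeasurable

theorem hasDerivAt_rotate (θ : ℝ) (p : E × E) :
    HasDerivAt (fun t => rotate t p) (-Real.sin θ • p.1 + Real.cos θ • p.2) θ :=
  ((Real.hasDerivAt_cos θ).smul_const p.1).add ((Real.hasDerivAt_sin θ).smul_const p.2)

theorem integrable_norm_stdGaussian : Integrable (fun x : E => ‖x‖) (stdGaussian E) :=
  (IsGaussian.integrable_id (μ := stdGaussian E)).norm

/-- The velocity of `x_θ` is a standard Gaussian vector independent of `x_θ`. Integrating by parts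
in it puts a gradient on `φ`, and `x` depends on it with coefficient `-sin θ`. -/
theorem hasDerivAt_integral_mul_rotate {φ ψ : E → ℝ} {φ' ψ' : E → E} {C : ℝ}
    (hφ : ∀ x, HasGradientAt φ (φ' x) x) (hφc : Continuous φ')
    (hφb : ∀ x, |φ x| ≤ C) (hφb' : ∀ x, ‖φ' x‖ ≤ C)
    (hψ : ∀ x, HasGradientAt ψ (ψ' x) x) (hψc : Continuous ψ')
    (hψb : ∀ x, |ψ x| ≤ C) (hψb' : ∀ x, ‖ψ' x‖ ≤ C) (θ : ℝ) :
    HasDerivAt (fun t => ∫ p, φ p.1 * ψ (rotate t p) ∂((stdGaussian E).prod (stdGaussian E)))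
      (-Real.sin θ * ∫ p, ⟪φ' p.1, ψ' (rotate θ p)⟫_ℝ ∂((stdGaussian E).prod (stdGaussian E)))
      θ := by
  have hC : 0 ≤ C := (abs_nonneg _).trans (hφb 0)
  have cφ : Continuous φ := continuous_iff_continuousAt.2 fun x => (hφ x).continuousAt
  have cψ : Continuous ψ := continuous_iff_continuousAt.2 fun x => (hψ x).continuousAt
  have hbi : Integrable (fun p : E × E => C * (C * (‖p.1‖ + ‖p.2‖)))
      ((stdGaussian E).prod (stdGaussian E)) :=
    (((integrable_norm_stdGaussian.comp_fst (stdGaussian E)).add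
      (integrable_norm_stdGaussian.comp_snd (stdGaussian E))).const_mul C).const_mul C
  have key := hasDerivAt_integral_of_dominated_loc_of_deriv_le
    (μ := (stdGaussian E).prod (stdGaussian E)) (x₀ := θ) (s := Set.univ)
    (F := fun t p => φ p.1 * ψ (rotate t p))
    (F' := fun t p => φ p.1 * ⟪ψ' (rotate t p), -Real.sin t • p.1 + Real.cos t • p.2⟫_ℝ)
    (bound := fun p => C * (C * (‖p.1‖ + ‖p.2‖))) univ_mem
    (Eventually.of_forall fun t => (by fun_prop : Continuous _).aestronglyMeasurable)
    (Integrable.of_bound (by fun_prop : Continuous _).aestronglyMeasurable (C * C)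
      (ae_of_all _ fun p => by
        rw [Real.norm_eq_abs, abs_mul]
        exact mul_le_mul (hφb _) (hψb _) (abs_nonneg _) hC))
    (by fun_prop : Continuous _).aestronglyMeasurable
    (ae_of_all _ fun p t _ => by
      rw [norm_mul]
      refine mul_le_mul (hφb _) ((norm_inner_le_norm _ _).trans
        (mul_le_mul (hψb' _) ?_ (norm_nonneg _) hC)) (norm_nonneg _) hC
      refine (norm_add_le _ _).trans (add_le_add ?_ ?_)
      · rw [norm_smul, norm_neg]
        exact mul_le_of_le_one_left (norm_nonneg _) (Real.abs_sin_le_one t)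
      · rw [norm_smul]
        exact mul_le_of_le_one_left (norm_nonneg _) (Real.abs_cos_le_one t))
    hbi
    (ae_of_all _ fun p t _ => by
      have := (hψ (rotate t p)).hasFDerivAt.comp_hasDerivAt t (hasDerivAt_rotate t p)
      refine (this.const_mul (φ p.1)).congr_deriv ?_
      simp)
  refine key.2.congr_deriv ?_
  -- The coordinates `(x_θ, velocity)` are independent Gaussians; `T` recovers the original pair
  -- from them. Both integrals are pulled back along this measure-preserving map.
  set T : E × E → E × E :=
    fun p => (Real.cos θ • p.1 - Real.sin θ • p.2, Real.sin θ • p.1 + Real.cos θ • p.2) with hT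
  have hTc : Continuous T := by fun_prop
  have hTm : ((stdGaussian E).prod (stdGaussian E)).map T =
    (stdGaussian E).prod (stdGaussian E) := map_rotate_stdGaussian θ
  have hcs := Real.cos_sq_add_sin_sq θ
  have r1 : ∀ p, rotate θ (T p) = p.1 := fun p => by
    have e : p.1 = (Real.cos θ ^ 2 + Real.sin θ ^ 2) • p.1 := by rw [hcs, one_smul]
    rw [e]; simp only [rotate, hT]; module
  have r2 : ∀ p, -Real.sin θ • (T p).1 + Real.cos θ • (T p).2 = p.2 := fun p => by
    have e : p.2 = (Real.cos θ ^ 2 + Real.sin θ ^ 2) • p.2 := by rw [hcs, one_smul]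
    rw [e]; simp only [hT]; module
  have c1 : Continuous fun p : E × E => φ (T p).1 * ⟪ψ' p.1, p.2⟫_ℝ := by fun_prop
  have c2 : Continuous fun p : E × E => ⟪φ' (T p).1, ψ' p.1⟫_ℝ := by fun_prop
  rw [← hTm, integral_map hTc.aemeasurable
      (by rw [hTm]; exact (by fun_prop : Continuous _).aestronglyMeasurable),
    integral_map hTc.aemeasurable
      (by rw [hTm]; exact (by fun_prop : Continuous _).aestronglyMeasurable)]
  simp only [r1, r2]
  have i1 : Integrable (fun p : E × E => φ (T p).1 * ⟪ψ' p.1, p.2⟫_ℝ)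
      ((stdGaussian E).prod (stdGaussian E)) := by
    refine hbi.mono' c1.aestronglyMeasurable (ae_of_all _ fun p => ?_)
    rw [norm_mul]
    refine mul_le_mul (hφb _) ((norm_inner_le_norm _ _).trans
        (mul_le_mul (hψb' _) ?_ (norm_nonneg _) hC)) (norm_nonneg _) hC
    exact le_add_of_nonneg_left (norm_nonneg _)
  have i2 : Integrable (fun p : E × E => ⟪φ' (T p).1, ψ' p.1⟫_ℝ)
      ((stdGaussian E).prod (stdGaussian E)) :=
    Integrable.of_bound c2.aestronglyMeasurable (C * C) (ae_of_all _ fun p =>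
      (norm_inner_le_norm _ _).trans (mul_le_mul (hφb' _) (hψb' _) (norm_nonneg _) hC))
  rw [integral_prod _ i1, integral_prod _ i2, ← integral_const_mul]
  congr with x
  have hg : ∀ y, HasGradientAt (fun y => φ (Real.cos θ • x - Real.sin θ • y))
      (-Real.sin θ • φ' (Real.cos θ • x - Real.sin θ • y)) y := fun y => by
    have h1 : HasFDerivAt (fun y : E => Real.cos θ • x - Real.sin θ • y)
        (-(Real.sin θ • ContinuousLinearMap.id ℝ E)) y :=
      ((hasFDerivAt_id y).const_smul (Real.sin θ)).const_sub _
    have h2 := (hφ (Real.cos θ • x - Real.sin θ • y)).hasFDerivAt.comp y h1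
    rw [hasGradientAt_iff_hasFDerivAt]
    refine h2.congr_fderiv ?_
    ext v
    simp
  have := integral_inner_mul_stdGaussian (C := C) hg (by fun_prop) (fun y => hφb _)
    (fun y => by
      rw [norm_smul, norm_neg]
      exact (mul_le_of_le_one_left (norm_nonneg _) (Real.abs_sin_le_one θ)).trans (hφb' _)) (ψ' x)
  simp only [inner_smul_left, conj_trivial, integral_const_mul] at this
  rw [← this]
  congr with y
  simp only [hT]
  ring

theorem integral_fst_mul_rotate_pi_div_two {φ ψ : E → ℝ} :
    ∫ p, φ p.1 * ψ (rotate (Real.pi / 2) p) ∂((stdGaussian E).prod (stdGaussian E)) =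
      (∫ x, φ x ∂stdGaussian E) * ∫ x, ψ x ∂stdGaussian E := by
  simp only [rotate, Real.cos_pi_div_two, Real.sin_pi_div_two, zero_smul, one_smul, zero_add]
  exact integral_prod_mul φ ψ

theorem integral_fst_mul_rotate_zero {φ ψ : E → ℝ} :
    ∫ p, φ p.1 * ψ (rotate 0 p) ∂((stdGaussian E).prod (stdGaussian E)) =
      ∫ x, φ x * ψ x ∂stdGaussian E := by
  simp only [rotate, Real.cos_zero, Real.sin_zero, zero_smul, one_smul, add_zero]
  rw [integral_fun_fst (f := fun x => φ x * ψ x)]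
  simp

/-- A function on `[0, π / 2]` with derivative at most `C sin θ` in absolute value varies by at
most `C`. -/
theorem abs_sub_le_of_abs_deriv_le_sin {D D' : ℝ → ℝ} {C : ℝ}
    (hD : ∀ θ, HasDerivAt D (-Real.sin θ * D' θ) θ) (hb : ∀ θ, D' θ ≤ C) :
    D 0 - D (Real.pi / 2) ≤ C := by
  -- This derivative equals `sin θ (C - D' θ)`, which is nonnegative on the interval, and `cos`
  -- falls from 1 to 0 there.
  have hd : ∀ θ, HasDerivAt (fun θ => D θ - C * Real.cos θ)
      (-Real.sin θ * D' θ - C * -Real.sin θ) θ :=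
    fun θ => (hD θ).sub ((Real.hasDerivAt_cos θ).const_mul C)
  have hm : MonotoneOn (fun θ => D θ - C * Real.cos θ) (Set.Icc 0 (Real.pi / 2)) := by
    refine monotoneOn_of_deriv_nonneg (convex_Icc _ _)
      (fun θ _ => (hd θ).continuousAt.continuousWithinAt)
      (fun θ _ => (hd θ).differentiableAt.differentiableWithinAt) fun θ hθ => ?_
    rw [interior_Icc] at hθ
    rw [(hd θ).deriv]
    have := Real.sin_nonneg_of_nonneg_of_le_pi hθ.1.le (by linarith [hθ.2, Real.pi_pos])
    nlinarith [hb θ]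
  have h := hm (Set.left_mem_Icc.2 (by positivity)) (Set.right_mem_Icc.2 (by positivity))
    (by positivity)
  simp only [Real.cos_zero, Real.cos_pi_div_two] at h
  linarith

/-- The Gaussian Poincaré inequality. -/
theorem variance_stdGaussian_le {F : E → ℝ} {F' : E → E} {C : ℝ}
    (hF : ∀ x, HasGradientAt F (F' x) x) (hF' : Continuous F')
    (hb : ∀ x, |F x| ≤ C) (hb' : ∀ x, ‖F' x‖ ≤ C) :
    ∫ x, F x * F x ∂stdGaussian E - (∫ x, F x ∂stdGaussian E) * ∫ x, F x ∂stdGaussian E ≤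
      ∫ x, ‖F' x‖ ^ 2 ∂stdGaussian E := by
  have hC : 0 ≤ C := (abs_nonneg _).trans (hb 0)
  -- The variance is the drop of `E F(x)F(x_θ)` between `θ = 0`, where `x_θ = x`, and `θ = π/2`,
  -- where `x_θ = y` is independent of `x`.
  rw [← integral_fst_mul_rotate_zero, ← integral_fst_mul_rotate_pi_div_two]
  refine abs_sub_le_of_abs_deriv_le_sin
    (D := fun t => ∫ p, F p.1 * F (rotate t p) ∂((stdGaussian E).prod (stdGaussian E)))
    (fun θ => hasDerivAt_integral_mul_rotate hF hF' hb hb' hF hF' hb hb' θ) fun θ => ?_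
  have hi : Integrable (fun x => ‖F' x‖ ^ 2) (stdGaussian E) :=
    Integrable.of_bound (by fun_prop : Continuous _).aestronglyMeasurable (C ^ 2)
      (ae_of_all _ fun x => by
        rw [norm_pow, norm_norm]
        exact pow_le_pow_left₀ (norm_nonneg _) (hb' x) 2)
  have e1 : ∫ p : E × E, ‖F' p.1‖ ^ 2 ∂((stdGaussian E).prod (stdGaussian E)) =
      ∫ x, ‖F' x‖ ^ 2 ∂stdGaussian E := by
    rw [integral_fun_fst (f := fun x => ‖F' x‖ ^ 2)]; simp
  have e2 : ∫ p : E × E, ‖F' (rotate θ p)‖ ^ 2 ∂((stdGaussian E).prod (stdGaussian E)) =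
      ∫ x, ‖F' x‖ ^ 2 ∂stdGaussian E := by
    rw [integral_swap_rotate θ (f := fun x _ => ‖F' x‖ ^ 2) (by fun_prop), e1]
  have i1 : Integrable (fun p : E × E => ‖F' p.1‖ ^ 2) ((stdGaussian E).prod (stdGaussian E)) :=
    hi.comp_fst _
  have i2 : Integrable (fun p : E × E => ‖F' (rotate θ p)‖ ^ 2)
      ((stdGaussian E).prod (stdGaussian E)) :=
    Integrable.of_bound (by fun_prop : Continuous _).aestronglyMeasurable (C ^ 2)
      (ae_of_all _ fun x => by
        rw [norm_pow, norm_norm]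
        exact pow_le_pow_left₀ (norm_nonneg _) (hb' _) 2)
  calc ∫ p, ⟪F' p.1, F' (rotate θ p)⟫_ℝ ∂((stdGaussian E).prod (stdGaussian E))
      ≤ ∫ p, (1 / 2 * ‖F' p.1‖ ^ 2 + 1 / 2 * ‖F' (rotate θ p)‖ ^ 2)
          ∂((stdGaussian E).prod (stdGaussian E)) := by
        refine integral_mono ?_ ((i1.const_mul _).add (i2.const_mul _)) fun p => ?_
        · exact Integrable.of_bound (by fun_prop : Continuous _).aestronglyMeasurable (C * C)
            (ae_of_all _ fun p => (norm_inner_le_norm _ _).trans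
              (mul_le_mul (hb' _) (hb' _) (norm_nonneg _) hC))
        · have := real_inner_le_norm (F' p.1) (F' (rotate θ p))
          nlinarith [sq_nonneg (‖F' p.1‖ - ‖F' (rotate θ p)‖)]
    _ = ∫ x, ‖F' x‖ ^ 2 ∂stdGaussian E := by
        rw [integral_add (i1.const_mul _) (i2.const_mul _), integral_const_mul, integral_const_mul,
          e1, e2]
        ring

end Interpolation

/-! ### The second order inequality for bounded functions -/

section SecondOrder

variable {E : Type*} [NormedAddCommGroup E] [InnerProductSpace ℝ E] [FiniteDimensional ℝ E]
  [MeasurableSpace E] [BorelSpace E] [SecondCountableTopology E]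

theorem abs_le_of_abs_deriv_le {φ φ' : ℝ → ℝ} {M : ℝ} (hφ : ∀ t, HasDerivAt φ (φ' t) t)
    (hM : ∀ t, |φ' t| ≤ M) (t : ℝ) : |φ t| ≤ |φ 0| + M * |t| := by
  have h := Convex.norm_image_sub_le_of_norm_hasDerivWithin_le (s := Set.univ) (x := 0) (y := t)
    (fun x _ => (hφ x).hasDerivWithinAt) (fun x _ => hM x) convex_univ trivial trivial
  rw [sub_zero, Real.norm_eq_abs, Real.norm_eq_abs] at h
  have := abs_add_le (φ 0) (φ t - φ 0)
  rw [add_sub_cancel] at this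
  linarith

theorem continuous_adjoint_apply {α : Type*} [TopologicalSpace α] {H : α → E →L[ℝ] E} {w : α → E}
    (hH : Continuous H) (hw : Continuous w) :
    Continuous fun x => ContinuousLinearMap.adjoint (H x) (w x) :=
  ((ContinuousLinearMap.adjoint (𝕜 := ℝ) (E := E) (F := E)).continuous.comp hH).clm_apply hw

/-- Since `w` has mean zero, `F` may be centred; then `(εw - (F - m))² ≥ 0` is integrated. Keeping
`ε` free instead of taking square roots gives a bound linear in the variance, which can be
integrated over a further variable. -/
theorem integral_mul_le_of_integral_eq_zero {α : Type*} [MeasurableSpace α] {μ : Measure α}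
    [IsProbabilityMeasure μ] {w F : α → ℝ} {A B ε : ℝ} (hε : 0 < ε)
    (hw : Integrable w μ) (hF : Integrable F μ)
    (hw2 : Integrable (fun x => w x * w x) μ) (hF2 : Integrable (fun x => F x * F x) μ)
    (hwF : Integrable (fun x => w x * F x) μ)
    (h0 : ∫ x, w x ∂μ = 0) (hA : ∫ x, w x * w x ∂μ ≤ A)
    (hB : ∫ x, F x * F x ∂μ - (∫ x, F x ∂μ) * ∫ x, F x ∂μ ≤ B) :
    ∫ x, w x * F x ∂μ ≤ ε / 2 * A + 1 / (2 * ε) * B := by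
  set m := ∫ x, F x ∂μ
  have e1 : ∫ x, (w x * F x - m * w x) ∂μ = ∫ x, w x * F x ∂μ := by
    rw [integral_sub hwF (hw.const_mul m), integral_const_mul, h0, mul_zero, sub_zero]
  have e2 : ∫ x, (ε / 2 * (w x * w x) +
      1 / (2 * ε) * (F x * F x - 2 * m * F x + m * m)) ∂μ =
      ε / 2 * ∫ x, w x * w x ∂μ + 1 / (2 * ε) * (∫ x, F x * F x ∂μ - m * m) := by
    have j1 : Integrable (fun x => F x * F x - 2 * m * F x) μ := hF2.sub (hF.const_mul _)
    have j2 : Integrable (fun x => F x * F x - 2 * m * F x + m * m) μ :=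
      j1.add (integrable_const _)
    rw [integral_add (hw2.const_mul _) (j2.const_mul _),
      integral_const_mul, integral_const_mul, integral_add j1 (integrable_const _),
      integral_sub hF2 (hF.const_mul _), integral_const_mul]
    simp only [integral_const, probReal_univ, one_smul]
    ring
  have h : ∫ x, (w x * F x - m * w x) ∂μ ≤ ∫ x, (ε / 2 * (w x * w x) +
      1 / (2 * ε) * (F x * F x - 2 * m * F x + m * m)) ∂μ := by
    refine integral_mono (hwF.sub (hw.const_mul m)) ((hw2.const_mul _).add
      (((hF2.sub (hF.const_mul _)).add (integrable_const _)).const_mul _)) fun x => ?_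
    have h1 : 0 ≤ 1 / (2 * ε) * (ε * w x - (F x - m)) ^ 2 := by positivity
    have h2 : 1 / (2 * ε) * (ε * w x - (F x - m)) ^ 2 = ε / 2 * (w x * w x) -
        w x * (F x - m) + 1 / (2 * ε) * (F x - m) ^ 2 := by
      field_simp; ring
    have h3 : F x * F x - 2 * m * F x + m * m = (F x - m) ^ 2 := by ring
    change w x * F x - m * w x ≤ _
    rw [h3]
    linarith
  rw [e1, e2] at h
  have : (0:ℝ) < 1 / (2 * ε) := by positivity
  nlinarith [mul_le_mul_of_nonneg_left hA (half_pos hε).le, mul_le_mul_of_nonneg_left hB this.le]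

/-- The bilinear form that controls the gradient of `x ↦ ⟪G' x, G' (rotate θ (x, y))⟫`. -/
theorem hasGradientAt_inner_rotate {G' : E → E} {H : E → E →L[ℝ] E}
    (hG' : ∀ x, HasFDerivAt G' (H x) x) (θ : ℝ) (y x : E) :
    HasGradientAt (fun x => ⟪G' x, G' (rotate θ (x, y))⟫_ℝ)
      (ContinuousLinearMap.adjoint (H x) (G' (rotate θ (x, y))) +
        Real.cos θ • ContinuousLinearMap.adjoint (H (rotate θ (x, y))) (G' x)) x := by
  have h1 : HasFDerivAt (fun x : E => rotate θ (x, y))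
      (Real.cos θ • ContinuousLinearMap.id ℝ E) x :=
    ((hasFDerivAt_id x).const_smul (Real.cos θ)).add_const (Real.sin θ • y)
  have h2 := (hG' x).inner ℝ ((hG' (rotate θ (x, y))).comp x h1)
  rw [hasGradientAt_iff_hasFDerivAt]
  refine h2.congr_fderiv ?_
  ext v
  simp only [fderivInnerCLM_apply, ContinuousLinearMap.comp_apply, ContinuousLinearMap.prod_apply,
    InnerProductSpace.toDual_apply_apply, inner_add_left, inner_smul_left, conj_trivial,
    ContinuousLinearMap.adjoint_inner_left, _root_.smul_apply,
    ContinuousLinearMap.id_apply, map_smul, inner_smul_right]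
  rw [real_inner_comm (H x v), add_comm]
  rfl

/-- The left side is the drop over `[0, π/2]` of the interpolation of `φ ∘ G` with `G`, minus `c = E
φ'(G)` times that of `G` with itself. Its derivative is `-sin θ` times `E[(φ'(G(x)) - c)⟪∇G(x),
∇G(x_θ)⟫]`; the first factor has mean zero and variance at most `M²`, and the second has gradient of
`L²` norm at most `2K`. The adjoint of `H` is used throughout, so that its symmetry is not needed.
-/
theorem covariance_sub_le_of_bounded {G : E → ℝ} {G' : E → E} {H : E → E →L[ℝ] E} {C K M : ℝ}
    {φ φ' : ℝ → ℝ} (hG : ∀ x, HasGradientAt G (G' x) x) (hG' : ∀ x, HasFDerivAt G' (H x) x)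
    (hH : Continuous H) (hGb : ∀ x, |G x| ≤ C) (hGb' : ∀ x, ‖G' x‖ ≤ C) (hHb : ∀ x, ‖H x‖ ≤ C)
    (hφ : ∀ t, HasDerivAt φ (φ' t) t) (hφ' : Continuous φ') (hM : ∀ t, |φ' t| ≤ M)
    (hM0 : 0 < M) (hK0 : 0 < K)
    (hK : ∀ θ, ∫ p, ‖ContinuousLinearMap.adjoint (H p.1) (G' (rotate θ p))‖ ^ 2
      ∂((stdGaussian E).prod (stdGaussian E)) ≤ K ^ 2) :
    (∫ x, φ (G x) * G x ∂stdGaussian E - (∫ x, φ (G x) ∂stdGaussian E) * ∫ x, G x ∂stdGaussian E) -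
      (∫ x, φ' (G x) ∂stdGaussian E) *
        (∫ x, G x * G x ∂stdGaussian E - (∫ x, G x ∂stdGaussian E) * ∫ x, G x ∂stdGaussian E) ≤
      2 * M * K := by
  have hC : 0 ≤ C := (abs_nonneg _).trans (hGb 0)
  have cG : Continuous G := continuous_iff_continuousAt.2 fun x => (hG x).continuousAt
  have cG' : Continuous G' := continuous_iff_continuousAt.2 fun x => (hG' x).continuousAt
  have cφ : Continuous φ := continuous_iff_continuousAt.2 fun x => (hφ x).continuousAt
  set c := ∫ x, φ' (G x) ∂stdGaussian E with hc
  set γ₂ := (stdGaussian E).prod (stdGaussian E) with hγ₂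
  have bdd : ∀ {α : Type _} [TopologicalSpace α] [MeasurableSpace α] [OpensMeasurableSpace α]
      [SecondCountableTopology α] {μ : Measure α} [IsFiniteMeasure μ] {f : α → ℝ} (B : ℝ),
      Continuous f → (∀ x, |f x| ≤ B) → Integrable f μ := fun B hf hb =>
    Integrable.of_bound hf.aestronglyMeasurable B (ae_of_all _ hb)
  -- the composition `φ ∘ G`
  set C' := max C (max (|φ 0| + M * C) (M * C)) with hC'
  have c0 : C ≤ C' := le_max_left _ _
  have c1 : |φ 0| + M * C ≤ C' := (le_max_left _ _).trans (le_max_right _ _)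
  have c2 : M * C ≤ C' := (le_max_right _ _).trans (le_max_right _ _)
  have hφG : ∀ x, HasGradientAt (fun x => φ (G x)) (φ' (G x) • G' x) x := fun x => by
    rw [hasGradientAt_iff_hasFDerivAt]
    refine ((hφ (G x)).comp_hasFDerivAt x (hG x).hasFDerivAt).congr_fderiv ?_
    ext v; simp
  have hφGb : ∀ x, |φ (G x)| ≤ C' := fun x =>
    ((abs_le_of_abs_deriv_le hφ hM _).trans (by nlinarith [hGb x])).trans c1
  have hφGb' : ∀ x, ‖φ' (G x) • G' x‖ ≤ C' := fun x => by
    rw [norm_smul]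
    exact (mul_le_mul (hM _) (hGb' x) (norm_nonneg _) hM0.le).trans c2
  have hGb2 : ∀ x, |G x| ≤ C' := fun x => (hGb x).trans c0
  have hGb2' : ∀ x, ‖G' x‖ ≤ C' := fun x => (hGb' x).trans c0
  have cφG' : Continuous fun x => φ' (G x) • G' x := by fun_prop
  -- the interpolation
  have hD : ∀ θ, HasDerivAt (fun t => ∫ p, φ (G p.1) * G (rotate t p) ∂γ₂ -
      c * ∫ p, G p.1 * G (rotate t p) ∂γ₂)
      (-Real.sin θ * (∫ p, ⟪φ' (G p.1) • G' p.1, G' (rotate θ p)⟫_ℝ ∂γ₂ -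
        c * ∫ p, ⟪G' p.1, G' (rotate θ p)⟫_ℝ ∂γ₂)) θ := fun θ => by
    refine ((hasDerivAt_integral_mul_rotate hφG cφG' hφGb hφGb' hG cG' hGb2 hGb2' θ).sub
      ((hasDerivAt_integral_mul_rotate hG cG' hGb2 hGb2' hG cG' hGb2 hGb2' θ).const_mul
        c)).congr_deriv ?_
    ring
  have main := abs_sub_le_of_abs_deriv_le_sin hD (C := 2 * M * K) ?_
  · simp only [hγ₂] at main
    rw [integral_fst_mul_rotate_pi_div_two (φ := fun x => φ (G x)),
      integral_fst_mul_rotate_pi_div_two,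
      integral_fst_mul_rotate_zero (φ := fun x => φ (G x)), integral_fst_mul_rotate_zero] at main
    linarith
  intro θ
  have bin : ∀ p : E × E, |⟪G' p.1, G' (rotate θ p)⟫_ℝ| ≤ C * C := fun p =>
    (abs_real_inner_le_norm _ _).trans (mul_le_mul (hGb' _) (hGb' _) (norm_nonneg _) hC)
  have hcM : |c| ≤ M := by
    have := norm_integral_le_of_norm_le_const (μ := stdGaussian E)
      (f := fun x => φ' (G x)) (ae_of_all _ fun x => hM (G x))
    simpa using this
  have bw : ∀ x, |φ' (G x) - c| ≤ M + M := fun x =>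
    (abs_sub _ _).trans (add_le_add (hM _) hcM)
  have iφ' : Integrable (fun x => φ' (G x)) (stdGaussian E) := bdd M (by fun_prop) fun x => hM _
  have w0 : ∫ x, (φ' (G x) - c) ∂stdGaussian E = 0 := by
    rw [integral_sub iφ' (integrable_const _)]; simp [hc]
  have iφ2 : Integrable (fun x => φ' (G x) * φ' (G x)) (stdGaussian E) :=
    bdd (M * M) (by fun_prop) fun x => by
      rw [abs_mul]; exact mul_le_mul (hM _) (hM _) (abs_nonneg _) hM0.le
  have wA : ∫ x, (φ' (G x) - c) * (φ' (G x) - c) ∂stdGaussian E ≤ M ^ 2 := by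
    have e : ∀ x, (φ' (G x) - c) * (φ' (G x) - c) =
        φ' (G x) * φ' (G x) - 2 * c * φ' (G x) + c * c := fun x => by ring
    simp only [e]
    have j1 : Integrable (fun x => φ' (G x) * φ' (G x) - 2 * c * φ' (G x)) (stdGaussian E) :=
      iφ2.sub (iφ'.const_mul _)
    rw [integral_add j1 (integrable_const _), integral_sub iφ2 (iφ'.const_mul _), integral_const_mul, ← hc]
    have : ∫ x, φ' (G x) * φ' (G x) ∂stdGaussian E ≤ ∫ _, M ^ 2 ∂stdGaussian E :=
      integral_mono iφ2 (integrable_const _) fun x => by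
        have := sq_le_sq' (abs_le.1 (hM (G x))).1 (abs_le.1 (hM (G x))).2
        change φ' (G x) * φ' (G x) ≤ M ^ 2
        nlinarith
    simp only [integral_const, probReal_univ, one_smul] at this ⊢
    nlinarith [mul_self_nonneg c]
  have e1 : ∫ p, ⟪φ' (G p.1) • G' p.1, G' (rotate θ p)⟫_ℝ ∂γ₂ -
        c * ∫ p, ⟪G' p.1, G' (rotate θ p)⟫_ℝ ∂γ₂ =
      ∫ p, (φ' (G p.1) - c) * ⟪G' p.1, G' (rotate θ p)⟫_ℝ ∂γ₂ := by
    rw [← integral_const_mul, ← integral_sub]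
    · congr with p
      rw [inner_smul_left, conj_trivial]; ring
    · exact bdd (C' * C') (by fun_prop) fun p => (abs_real_inner_le_norm _ _).trans
        (mul_le_mul (hφGb' _) (hGb2' _) (norm_nonneg _) (hC.trans c0))
    · exact (bdd (C * C) (by fun_prop) bin).const_mul c
  rw [e1]
  have iwF : Integrable (fun p : E × E => (φ' (G p.1) - c) * ⟪G' p.1, G' (rotate θ p)⟫_ℝ) γ₂ :=
    bdd ((M + M) * (C * C)) (by fun_prop) fun p => by
      rw [abs_mul]
      exact mul_le_mul (bw _) (bin _) (abs_nonneg _) (by positivity)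
  have cA : Continuous fun p : E × E => ContinuousLinearMap.adjoint (H p.1) (G' (rotate θ p)) :=
    continuous_adjoint_apply (hH.comp continuous_fst) (by fun_prop)
  have cB : Continuous fun p : E × E => ContinuousLinearMap.adjoint (H (rotate θ p)) (G' p.1) :=
    continuous_adjoint_apply (hH.comp (continuous_rotate θ)) (by fun_prop)
  have bad : ∀ x y, ‖ContinuousLinearMap.adjoint (H x) (G' y)‖ ≤ C * C := fun x y => by
    refine (ContinuousLinearMap.le_opNorm _ _).trans ?_
    rw [LinearIsometryEquiv.norm_map]
    exact mul_le_mul (hHb _) (hGb' _) (norm_nonneg _) hC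
  have bgr : ∀ p : E × E, ‖ContinuousLinearMap.adjoint (H p.1) (G' (rotate θ p)) +
      Real.cos θ • ContinuousLinearMap.adjoint (H (rotate θ p)) (G' p.1)‖ ≤ C * C + C * C :=
    fun p => (norm_add_le _ _).trans (add_le_add (bad _ _) (by
      rw [norm_smul]
      exact (mul_le_of_le_one_left (norm_nonneg _) (Real.abs_cos_le_one θ)).trans (bad _ _)))
  have igr : Integrable (fun p : E × E =>
      ‖ContinuousLinearMap.adjoint (H p.1) (G' (rotate θ p)) +
      Real.cos θ • ContinuousLinearMap.adjoint (H (rotate θ p)) (G' p.1)‖ ^ 2) γ₂ :=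
    bdd ((C * C + C * C) ^ 2) (by fun_prop) fun p => by
      rw [abs_pow, abs_norm]; exact pow_le_pow_left₀ (norm_nonneg _) (bgr p) 2
  have hgr : ∫ p, ‖ContinuousLinearMap.adjoint (H p.1) (G' (rotate θ p)) +
      Real.cos θ • ContinuousLinearMap.adjoint (H (rotate θ p)) (G' p.1)‖ ^ 2 ∂γ₂ ≤ 4 * K ^ 2 := by
    have i1 : Integrable (fun p : E × E =>
        ‖ContinuousLinearMap.adjoint (H p.1) (G' (rotate θ p))‖ ^ 2) γ₂ :=
      bdd ((C * C) ^ 2) (by fun_prop) fun p => by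
        rw [abs_pow, abs_norm]; exact pow_le_pow_left₀ (norm_nonneg _) (bad _ _) 2
    have i2 : Integrable (fun p : E × E =>
        ‖ContinuousLinearMap.adjoint (H (rotate θ p)) (G' p.1)‖ ^ 2) γ₂ :=
      bdd ((C * C) ^ 2) (by fun_prop) fun p => by
        rw [abs_pow, abs_norm]; exact pow_le_pow_left₀ (norm_nonneg _) (bad _ _) 2
    have h1 := hK θ
    -- Exchangeability of `x` and `x_θ` turns the second summand of the gradient into the first.
    have h2 : ∫ p, ‖ContinuousLinearMap.adjoint (H (rotate θ p)) (G' p.1)‖ ^ 2 ∂γ₂ ≤ K ^ 2 := by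
      rw [hγ₂, integral_swap_rotate θ
        (f := fun x y => ‖ContinuousLinearMap.adjoint (H x) (G' y)‖ ^ 2)
        ((continuous_adjoint_apply (hH.comp continuous_fst)
          (cG'.comp continuous_snd)).norm.pow 2)]
      exact hK θ
    have h3 := integral_mono igr ((i1.const_mul 2).add (i2.const_mul 2)) fun p => by
      simp only [Pi.add_apply]
      set u := ContinuousLinearMap.adjoint (H p.1) (G' (rotate θ p))
      set v := ContinuousLinearMap.adjoint (H (rotate θ p)) (G' p.1)
      have n1 : ‖u + Real.cos θ • v‖ ≤ ‖u‖ + ‖v‖ := (norm_add_le _ _).trans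
        (add_le_add le_rfl (by
          rw [norm_smul]
          exact mul_le_of_le_one_left (norm_nonneg _) (Real.abs_cos_le_one θ)))
      have n2 := pow_le_pow_left₀ (norm_nonneg _) n1 2
      nlinarith [sq_nonneg (‖u‖ - ‖v‖)]
    rw [integral_add' (i1.const_mul 2) (i2.const_mul 2), integral_const_mul,
      integral_const_mul] at h3
    linarith
  -- Poincaré in `x` alone, with `y` frozen. The choice `ε = 2K/M` balances `ε M²/2` against
  -- `4K²/(2ε)`: each equals `MK` after integration over `y`.
  have step : ∀ y, ∫ x, (φ' (G x) - c) * ⟪G' x, G' (rotate θ (x, y))⟫_ℝ ∂stdGaussian E ≤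
      (2 * K / M) / 2 * M ^ 2 + 1 / (2 * (2 * K / M)) *
      ∫ x, ‖ContinuousLinearMap.adjoint (H x) (G' (rotate θ (x, y))) +
        Real.cos θ • ContinuousLinearMap.adjoint (H (rotate θ (x, y))) (G' x)‖ ^ 2
        ∂stdGaussian E := fun y => by
    have cF : Continuous fun x => ⟪G' x, G' (rotate θ (x, y))⟫_ℝ := by fun_prop
    refine integral_mul_le_of_integral_eq_zero (by positivity) (iφ'.sub (integrable_const _))
      (bdd (C * C) cF fun x => bin (x, y))
      (bdd ((M + M) * (M + M)) (by fun_prop) fun x => by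
        rw [abs_mul]; exact mul_le_mul (bw _) (bw _) (abs_nonneg _) (by positivity))
      (bdd ((C * C) * (C * C)) (cF.mul cF) fun x => by
        rw [abs_mul]
        exact mul_le_mul (bin (x, y)) (bin (x, y)) (abs_nonneg _) (by positivity))
      (bdd ((M + M) * (C * C)) (by fun_prop) fun x => by
        rw [abs_mul]
        exact mul_le_mul (bw _) (bin (x, y)) (abs_nonneg _) (by positivity)) w0 wA ?_
    have cpair : Continuous fun x : E => (x, y) := by fun_prop
    exact variance_stdGaussian_le (C := C * C + C * C)
      (fun x => hasGradientAt_inner_rotate hG' θ y x)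
      ((cA.comp cpair).add ((cB.comp cpair).const_smul _))
      (fun x => (bin (x, y)).trans (by nlinarith [mul_self_nonneg C])) fun x => bgr (x, y)
  rw [hγ₂, integral_prod_symm _ iwF]
  have iint := igr.integral_prod_right
  have h4 := integral_mono iwF.integral_prod_right
    ((integrable_const (2 * K / M / 2 * M ^ 2)).add (iint.const_mul (1 / (2 * (2 * K / M)))))
    step
  refine h4.trans ?_
  have e2 := integral_prod_symm _ igr
  rw [integral_add' (integrable_const _) (iint.const_mul _), integral_const_mul]
  rw [integral_const_mul, ← e2]
  simp only [integral_const, probReal_univ, one_smul]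
  have h5 := mul_le_mul_of_nonneg_left hgr (by positivity : 0 ≤ 1 / (2 * (2 * K / M)))
  refine (add_le_add le_rfl h5).trans (le_of_eq ?_)
  field_simp
  ring

end SecondOrder

/-! ### Smooth cutoff: derivatives and error terms -/

section Cutoff

variable {E : Type*} [NormedAddCommGroup E] [InnerProductSpace ℝ E] [FiniteDimensional ℝ E]
  [MeasurableSpace E] [BorelSpace E] [SecondCountableTopology E]

theorem exists_smooth_cutoff (E : Type*) [NormedAddCommGroup E] [InnerProductSpace ℝ E]
    [FiniteDimensional ℝ E] : ∃ (χ : E → ℝ) (χ' : E → E) (χ'' : E → E →L[ℝ] E) (C : ℝ),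
    (∀ x, HasGradientAt χ (χ' x) x) ∧ (∀ x, HasFDerivAt χ' (χ'' x) x) ∧ Continuous χ'' ∧
    (∀ x, |χ x| ≤ 1) ∧ (∀ x, ‖χ' x‖ ≤ C) ∧ (∀ x, ‖χ'' x‖ ≤ C) ∧ χ 0 = 1 ∧
    HasCompactSupport χ ∧ HasCompactSupport χ' ∧ HasCompactSupport χ'' := by
  let b : ContDiffBump (0 : E) := ⟨1, 2, one_pos, one_lt_two⟩
  have hb : ContDiff ℝ 2 b := b.contDiff
  have hs : HasCompactSupport b := b.hasCompactSupport
  let D := (InnerProductSpace.toDual ℝ E).symm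
  have hd : ContDiff ℝ 1 (fderiv ℝ b) := hb.fderiv_right (by norm_num)
  have hd' : ContDiff ℝ 1 (fun x => D (fderiv ℝ b x)) :=
    (D.toContinuousLinearEquiv.toContinuousLinearMap.contDiff).comp hd
  have s1 : HasCompactSupport (fun x => D (fderiv ℝ b x)) :=
    (hs.fderiv ℝ).comp_left (g := D) (map_zero D)
  have s2 : HasCompactSupport (fderiv ℝ (fun x => D (fderiv ℝ b x))) := s1.fderiv ℝ
  have c2 : Continuous (fderiv ℝ (fun x => D (fderiv ℝ b x))) := hd'.continuous_fderiv one_ne_zero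
  obtain ⟨C₁, h₁⟩ := s1.exists_bound_of_continuous hd'.continuous
  obtain ⟨C₂, h₂⟩ := s2.exists_bound_of_continuous c2
  refine ⟨b, fun x => D (fderiv ℝ b x), fderiv ℝ (fun x => D (fderiv ℝ b x)), max C₁ C₂,
    fun x => ?_, fun x => (hd'.differentiable one_ne_zero x).hasFDerivAt, c2, fun x => ?_,
    fun x => (h₁ x).trans (le_max_left _ _), fun x => (h₂ x).trans (le_max_right _ _),
    b.one_of_mem_closedBall (by simp [b]), hs, s1, s2⟩
  · rw [hasGradientAt_iff_hasFDerivAt]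
    simpa [D] using (hb.differentiable two_ne_zero x).hasFDerivAt
  · rw [abs_of_nonneg b.nonneg]; exact b.le_one

variable {G : E → ℝ} {G' : E → E} {H : E → E →L[ℝ] E} {χ : E → ℝ} {χ' : E → E}
  {χ'' : E → E →L[ℝ] E}

/-- The gradient of `x ↦ χ (δ x) G x`. -/
noncomputable def cutoffGradient (G : E → ℝ) (G' : E → E) (χ : E → ℝ) (χ' : E → E) (δ : ℝ)
    (x : E) : E :=
  χ (δ • x) • G' x + (δ * G x) • χ' (δ • x)

/-- The part of the Hessian of `x ↦ χ (δ x) G x` that contains derivatives of `χ`. -/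
noncomputable def cutoffHessianRest (G : E → ℝ) (G' : E → E) (χ' : E → E)
    (χ'' : E → E →L[ℝ] E) (δ : ℝ) (x : E) : E →L[ℝ] E :=
  (δ • innerSL ℝ (χ' (δ • x))).smulRight (G' x) + (δ • innerSL ℝ (G' x)).smulRight (χ' (δ • x)) +
    (δ * G x * δ) • χ'' (δ • x)

/-- The Hessian of `x ↦ χ (δ x) G x`. -/
noncomputable def cutoffHessian (G : E → ℝ) (G' : E → E) (H : E → E →L[ℝ] E) (χ : E → ℝ)
    (χ' : E → E) (χ'' : E → E →L[ℝ] E) (δ : ℝ) (x : E) : E →L[ℝ] E :=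
  χ (δ • x) • H x + cutoffHessianRest G G' χ' χ'' δ x

theorem hasFDerivAt_const_smul_id (δ : ℝ) (x : E) :
    HasFDerivAt (fun x : E => δ • x) (δ • ContinuousLinearMap.id ℝ E) x :=
  (hasFDerivAt_id x).const_smul δ

theorem hasGradientAt_cutoff (hG : ∀ x, HasGradientAt G (G' x) x)
    (hχ : ∀ x, HasGradientAt χ (χ' x) x) (δ : ℝ) (x : E) :
    HasGradientAt (fun x => χ (δ • x) * G x) (cutoffGradient G G' χ χ' δ x) x := by
  have h1 := (hχ (δ • x)).hasFDerivAt.comp x (hasFDerivAt_const_smul_id δ x)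
  have h2 := h1.mul (hG x).hasFDerivAt
  rw [hasGradientAt_iff_hasFDerivAt]
  refine h2.congr_fderiv ?_
  ext v
  simp [cutoffGradient]
  ring

theorem hasFDerivAt_cutoffGradient (hG : ∀ x, HasGradientAt G (G' x) x)
    (hG' : ∀ x, HasFDerivAt G' (H x) x) (hχ : ∀ x, HasGradientAt χ (χ' x) x)
    (hχ' : ∀ x, HasFDerivAt χ' (χ'' x) x) (δ : ℝ) (x : E) :
    HasFDerivAt (cutoffGradient G G' χ χ' δ) (cutoffHessian G G' H χ χ' χ'' δ x) x := by
  have h1 := (hχ (δ • x)).hasFDerivAt.comp x (hasFDerivAt_const_smul_id δ x)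
  have h2 := (hχ' (δ • x)).comp x (hasFDerivAt_const_smul_id δ x)
  have h3 := (h1.smul (hG' x)).add (((hG x).hasFDerivAt.const_mul δ).smul h2)
  refine h3.congr_fderiv ?_
  ext v
  simp [cutoffHessian, cutoffHessianRest, smul_smul]
  abel

theorem continuous_cutoffHessian (hG : Continuous G) (hG' : Continuous G') (hH : Continuous H)
    (hχ : Continuous χ) (hχ' : Continuous χ') (hχ'' : Continuous χ'') (δ : ℝ) :
    Continuous (cutoffHessian G G' H χ χ' χ'' δ) := by
  have sR : ∀ {f : E → StrongDual ℝ E} {w : E → E}, Continuous f → Continuous w →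
      Continuous fun x => (f x).smulRight (w x) := fun {f w} hf hw =>
    ((ContinuousLinearMap.smulRightL ℝ E E).continuous.comp hf).clm_apply hw
  unfold cutoffHessian cutoffHessianRest
  have i1 : Continuous fun x : E => δ • innerSL ℝ (χ' (δ • x)) :=
    ((innerSL ℝ (E := E)).continuous.comp (by fun_prop)).const_smul δ
  have i2 : Continuous fun x : E => δ • innerSL ℝ (G' x) :=
    ((innerSL ℝ (E := E)).continuous.comp (by fun_prop)).const_smul δ
  have j1 := sR i1 hG'
  have j2 := sR i2 (w := fun x => χ' (δ • x)) (by fun_prop)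
  fun_prop

/-- Every derivative of `χ (δ x)` brings a factor `δ`, and `δ ≤ 1` absorbs the second power. The
term `‖H x‖` on the right only serves to have one dominating function for all errors. -/
theorem norm_cutoffHessianRest_le {C δ : ℝ} (hδ : 0 ≤ δ) (hδ1 : δ ≤ 1) (hb' : ∀ x, ‖χ' x‖ ≤ C)
    (hb'' : ∀ x, ‖χ'' x‖ ≤ C) (x : E) :
    ‖cutoffHessianRest G G' χ' χ'' δ x‖ ≤ δ * (2 * C) * (|G x| + ‖G' x‖ + ‖H x‖) := by
  have hC : 0 ≤ C := (norm_nonneg _).trans (hb' 0)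
  have n1 : ‖(δ • innerSL ℝ (χ' (δ • x))).smulRight (G' x)‖ ≤ δ * C * ‖G' x‖ := by
    rw [ContinuousLinearMap.norm_smulRight_apply, norm_smul, innerSL_apply_norm,
      Real.norm_of_nonneg hδ]
    gcongr; exact hb' _
  have n2 : ‖(δ • innerSL ℝ (G' x)).smulRight (χ' (δ • x))‖ ≤ δ * C * ‖G' x‖ := by
    rw [ContinuousLinearMap.norm_smulRight_apply, norm_smul, innerSL_apply_norm,
      Real.norm_of_nonneg hδ, mul_right_comm]
    gcongr; exact hb' _
  have n3 : ‖(δ * G x * δ) • χ'' (δ • x)‖ ≤ δ * C * |G x| := by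
    rw [norm_smul, norm_mul, norm_mul, Real.norm_of_nonneg hδ, Real.norm_eq_abs]
    calc δ * |G x| * δ * ‖χ'' (δ • x)‖ ≤ δ * |G x| * 1 * C := by
          gcongr; exact hb'' _
      _ = _ := by ring
  have h := (norm_add₃_le (a := (δ • innerSL ℝ (χ' (δ • x))).smulRight (G' x))
    (b := (δ • innerSL ℝ (G' x)).smulRight (χ' (δ • x))) (c := (δ * G x * δ) • χ'' (δ • x)))
  have p1 : 0 ≤ δ * C * |G x| := by positivity
  have p2 : 0 ≤ δ * C * ‖H x‖ := by positivity
  unfold cutoffHessianRest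
  linarith

theorem norm_cutoffGradient_rest_le {C δ : ℝ} (hδ : 0 ≤ δ) (hb' : ∀ x, ‖χ' x‖ ≤ C) (x : E) :
    ‖(δ * G x) • χ' (δ • x)‖ ≤ δ * C * (|G x| + ‖G' x‖ + ‖H x‖) := by
  have hC : 0 ≤ C := (norm_nonneg _).trans (hb' 0)
  rw [norm_smul, norm_mul, Real.norm_of_nonneg hδ, Real.norm_eq_abs]
  calc δ * |G x| * ‖χ' (δ • x)‖ ≤ δ * |G x| * C := by gcongr; exact hb' _
    _ = δ * C * (|G x| + 0 + 0) := by ring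
    _ ≤ _ := by gcongr <;> positivity

/-- Multiplying out, the only product free of derivatives of `χ` is the original one with two cutoff
factors of size at most 1. The others are of order `δ`. -/
theorem norm_adjoint_cutoffHessian_le {C δ : ℝ} (hδ : 0 ≤ δ) (hδ1 : δ ≤ 1) (hb : ∀ x, |χ x| ≤ 1)
    (hb' : ∀ x, ‖χ' x‖ ≤ C) (hb'' : ∀ x, ‖χ'' x‖ ≤ C) (x y : E) :
    ‖ContinuousLinearMap.adjoint (cutoffHessian G G' H χ χ' χ'' δ x)
        (cutoffGradient G G' χ χ' δ y)‖ ≤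
      ‖ContinuousLinearMap.adjoint (H x) (G' y)‖ + δ * ((C + 2 * C * (1 + C)) *
        ((|G x| + ‖G' x‖ + ‖H x‖) * (|G y| + ‖G' y‖ + ‖H y‖))) := by
  have hC : 0 ≤ C := (norm_nonneg _).trans (hb' 0)
  set e := (δ * G y) • χ' (δ • y)
  set Q := cutoffHessianRest G G' χ' χ'' δ x
  have he : ‖e‖ ≤ δ * C * (|G y| + ‖G' y‖ + ‖H y‖) := norm_cutoffGradient_rest_le hδ hb' y
  have hQ : ‖Q‖ ≤ δ * (2 * C) * (|G x| + ‖G' x‖ + ‖H x‖) :=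
    norm_cutoffHessianRest_le hδ hδ1 hb' hb'' x
  have hg : ‖cutoffGradient G G' χ χ' δ y‖ ≤ (1 + C) * (|G y| + ‖G' y‖ + ‖H y‖) := by
    refine (norm_add_le _ _).trans ?_
    rw [norm_smul]
    have h1 : ‖χ (δ • y)‖ * ‖G' y‖ ≤ ‖G' y‖ := mul_le_of_le_one_left (norm_nonneg _) (hb _)
    have h2 : δ * C * (|G y| + ‖G' y‖ + ‖H y‖) ≤ 1 * C * (|G y| + ‖G' y‖ + ‖H y‖) := by gcongr
    nlinarith [abs_nonneg (G y), norm_nonneg (H y)]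
  set rx := |G x| + ‖G' x‖ + ‖H x‖ with hrx
  set ry := |G y| + ‖G' y‖ + ‖H y‖ with hry
  have rx0 : 0 ≤ rx := by positivity
  have ry0 : 0 ≤ ry := by positivity
  have hHx : ‖H x‖ ≤ rx := by
    have := norm_nonneg (G' x); have := abs_nonneg (G x); linarith
  have e1 : ContinuousLinearMap.adjoint (cutoffHessian G G' H χ χ' χ'' δ x)
        (cutoffGradient G G' χ χ' δ y) =
      (χ (δ • x) * χ (δ • y)) • ContinuousLinearMap.adjoint (H x) (G' y) +
      χ (δ • x) • ContinuousLinearMap.adjoint (H x) e +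
      ContinuousLinearMap.adjoint Q (cutoffGradient G G' χ χ' δ y) := by
    simp only [cutoffHessian, map_add, _root_.add_apply]
    congr 1
    simp [cutoffGradient, smul_smul, e]
  rw [e1]
  refine norm_add₃_le.trans ?_
  have t1 : ‖(χ (δ • x) * χ (δ • y)) • ContinuousLinearMap.adjoint (H x) (G' y)‖ ≤
      ‖ContinuousLinearMap.adjoint (H x) (G' y)‖ := by
    rw [norm_smul, norm_mul]
    exact mul_le_of_le_one_left (norm_nonneg _) (mul_le_one₀ (hb _) (norm_nonneg _) (hb _))
  have t2 : ‖χ (δ • x) • ContinuousLinearMap.adjoint (H x) e‖ ≤ rx * (δ * C * ry) := by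
    rw [norm_smul]
    refine (mul_le_of_le_one_left (norm_nonneg _) (hb _)).trans
      ((ContinuousLinearMap.le_opNorm _ _).trans ?_)
    rw [LinearIsometryEquiv.norm_map]
    gcongr
  have t3 : ‖ContinuousLinearMap.adjoint Q (cutoffGradient G G' χ χ' δ y)‖ ≤
      δ * (2 * C) * rx * ((1 + C) * ry) := by
    refine (ContinuousLinearMap.le_opNorm _ _).trans ?_
    rw [LinearIsometryEquiv.norm_map]
    gcongr
  calc _ ≤ ‖ContinuousLinearMap.adjoint (H x) (G' y)‖ + rx * (δ * C * ry) +
        δ * (2 * C) * rx * ((1 + C) * ry) := by gcongr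
    _ = _ := by ring

end Cutoff

/-! ### Removal of the cutoff -/

section Limit

variable {E : Type*} [NormedAddCommGroup E] [InnerProductSpace ℝ E] [FiniteDimensional ℝ E]
  [MeasurableSpace E] [BorelSpace E] [SecondCountableTopology E]

theorem integrable_pow_four_of_memLp {α : Type*} [MeasurableSpace α] {μ : Measure α} {f : α → ℝ}
    (hf : MemLp f 4 μ) : Integrable (fun x => f x ^ 4) μ := by
  have := hf.integrable_norm_pow (by norm_num)
  refine this.congr (ae_of_all _ fun x => ?_)
  simp only [Real.norm_eq_abs]
  exact (by decide : Even 4).pow_abs _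

/-- By `2s²t² ≤ s⁴ + t⁴`, and because `x` and `x_θ` have the same law. -/
theorem integrable_mul_rotate {R : E → ℝ} (hR : MemLp R 4 (stdGaussian E)) (hc : Continuous R)
    (θ : ℝ) :
    Integrable (fun p : E × E => (R p.1 * R (rotate θ p)) ^ 2)
      ((stdGaussian E).prod (stdGaussian E)) ∧
    ∫ p, (R p.1 * R (rotate θ p)) ^ 2 ∂((stdGaussian E).prod (stdGaussian E)) ≤
      ∫ x, R x ^ 4 ∂stdGaussian E := by
  have h4 := integrable_pow_four_of_memLp hR
  have i1 : Integrable (fun p : E × E => R p.1 ^ 4) ((stdGaussian E).prod (stdGaussian E)) :=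
    h4.comp_fst _
  have hmr := map_rotate_eq_stdGaussian (E := E) θ
  have i2 : Integrable (fun p : E × E => R (rotate θ p) ^ 4)
      ((stdGaussian E).prod (stdGaussian E)) := by
    rw [← hmr] at h4
    exact h4.comp_aemeasurable (continuous_rotate θ).aemeasurable
  have e1 : ∫ p : E × E, R p.1 ^ 4 ∂((stdGaussian E).prod (stdGaussian E)) =
      ∫ x, R x ^ 4 ∂stdGaussian E := by
    rw [integral_fun_fst (f := fun x => R x ^ 4)]; simp
  have e2 : ∫ p : E × E, R (rotate θ p) ^ 4 ∂((stdGaussian E).prod (stdGaussian E)) =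
      ∫ x, R x ^ 4 ∂stdGaussian E := by
    rw [integral_swap_rotate θ (f := fun x _ => R x ^ 4) (by fun_prop), e1]
  have hle : ∀ p : E × E, (R p.1 * R (rotate θ p)) ^ 2 ≤
      1 / 2 * R p.1 ^ 4 + 1 / 2 * R (rotate θ p) ^ 4 := fun p => by
    nlinarith [sq_nonneg (R p.1 ^ 2 - R (rotate θ p) ^ 2)]
  have ii := (i1.const_mul (1 / 2)).add (i2.const_mul (1 / 2))
  have hI : Integrable (fun p : E × E => (R p.1 * R (rotate θ p)) ^ 2)
      ((stdGaussian E).prod (stdGaussian E)) := by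
    refine ii.mono' (by fun_prop : Continuous _).aestronglyMeasurable (ae_of_all _ fun p => ?_)
    rw [Real.norm_of_nonneg (sq_nonneg _)]
    exact hle p
  refine ⟨hI, (integral_mono hI ii hle).trans (le_of_eq ?_)⟩
  rw [integral_add' (i1.const_mul _) (i2.const_mul _), integral_const_mul, integral_const_mul,
    e1, e2]
  ring

/-- Compact support supplies the bounds of the bounded case. The last `δ` under the root only makes
the new constant strictly positive, as that case demands. -/
theorem covariance_cutoff_sub_le {G : E → ℝ} {G' : E → E} {H : E → E →L[ℝ] E} {K M C : ℝ}
    {φ φ' : ℝ → ℝ} {χ : E → ℝ} {χ' : E → E} {χ'' : E → E →L[ℝ] E}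
    (hG : ∀ x, HasGradientAt G (G' x) x) (hG' : ∀ x, HasFDerivAt G' (H x) x)
    (hH : Continuous H)
    (hR4 : MemLp (fun x => |G x| + ‖G' x‖ + ‖H x‖) 4 (stdGaussian E))
    (hφ : ∀ t, HasDerivAt φ (φ' t) t) (hφ' : Continuous φ') (hM : ∀ t, |φ' t| ≤ M)
    (hM0 : 0 < M)
    (hK : ∀ θ, ∫ p, ‖ContinuousLinearMap.adjoint (H p.1) (G' (rotate θ p))‖ ^ 2
      ∂((stdGaussian E).prod (stdGaussian E)) ≤ K ^ 2)
    (hχ : ∀ x, HasGradientAt χ (χ' x) x) (hχ' : ∀ x, HasFDerivAt χ' (χ'' x) x)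
    (cχ'' : Continuous χ'') (bχ : ∀ x, |χ x| ≤ 1) (bχ' : ∀ x, ‖χ' x‖ ≤ C)
    (bχ'' : ∀ x, ‖χ'' x‖ ≤ C) (sχ : HasCompactSupport χ) (sχ' : HasCompactSupport χ')
    {δ : ℝ} (δ0 : 0 < δ) (δ1 : δ ≤ 1) :
    (∫ x, φ (χ (δ • x) * G x) * (χ (δ • x) * G x) ∂stdGaussian E -
        (∫ x, φ (χ (δ • x) * G x) ∂stdGaussian E) * ∫ x, χ (δ • x) * G x ∂stdGaussian E) -
      (∫ x, φ' (χ (δ • x) * G x) ∂stdGaussian E) *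
        (∫ x, (χ (δ • x) * G x) * (χ (δ • x) * G x) ∂stdGaussian E -
          (∫ x, χ (δ • x) * G x ∂stdGaussian E) * ∫ x, χ (δ • x) * G x ∂stdGaussian E) ≤
      2 * M * √((1 + δ) * K ^ 2 + (δ + δ ^ 2) * ((C + 2 * C * (1 + C)) ^ 2 *
        ∫ x, (|G x| + ‖G' x‖ + ‖H x‖) ^ 4 ∂stdGaussian E) + δ) := by
  have cG : Continuous G := continuous_iff_continuousAt.2 fun x => (hG x).continuousAt
  have cG' : Continuous G' := continuous_iff_continuousAt.2 fun x => (hG' x).continuousAt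
  have cχ : Continuous χ := continuous_iff_continuousAt.2 fun x => (hχ x).continuousAt
  have cχ' : Continuous χ' := continuous_iff_continuousAt.2 fun x => (hχ' x).continuousAt
  set R : E → ℝ := fun x => |G x| + ‖G' x‖ + ‖H x‖ with hR
  have cR : Continuous R := by fun_prop
  set Q := ∫ x, (|G x| + ‖G' x‖ + ‖H x‖) ^ 4 ∂stdGaussian E with hQ
  have hQ0 : 0 ≤ Q := integral_nonneg fun x => by positivity
  set B := C + 2 * C * (1 + C) with hB
  have s0 : HasCompactSupport fun x => χ (δ • x) := sχ.comp_smul δ0.ne'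
  have s1 : HasCompactSupport fun x => χ' (δ • x) := sχ'.comp_smul δ0.ne'
  have t0 : HasCompactSupport fun x => χ (δ • x) * G x := s0.mul_right
  have u1 : HasCompactSupport fun x => χ (δ • x) • G' x := s0.smul_right
  have u2 : HasCompactSupport fun x => (δ * G x) • χ' (δ • x) :=
    HasCompactSupport.smul_left (f := fun x => δ * G x) s1
  have t1 : HasCompactSupport (cutoffGradient G G' χ χ' δ) := u1.add u2
  have cH := continuous_cutoffHessian (χ := χ) (χ' := χ') (χ'' := χ'') (δ := δ)
    cG cG' hH cχ cχ' cχ''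
  have hd := hasFDerivAt_cutoffGradient hG hG' hχ hχ' δ
  have t2 : HasCompactSupport (cutoffHessian G G' H χ χ' χ'' δ) := by
    have : cutoffHessian G G' H χ χ' χ'' δ = fderiv ℝ (cutoffGradient G G' χ χ' δ) := by
      ext1 x; exact (hd x).fderiv.symm
    rw [this]
    exact t1.fderiv ℝ
  have cg : Continuous (cutoffGradient G G' χ χ' δ) :=
    continuous_iff_continuousAt.2 fun x => (hd x).continuousAt
  have cχG : Continuous fun x => χ (δ • x) * G x := by fun_prop
  obtain ⟨B₀, b₀⟩ := t0.exists_bound_of_continuous cχG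
  obtain ⟨B₁, b₁⟩ := t1.exists_bound_of_continuous cg
  obtain ⟨B₂, b₂⟩ := t2.exists_bound_of_continuous cH
  refine covariance_sub_le_of_bounded (C := max B₀ (max B₁ B₂)) (G := fun x => χ (δ • x) * G x)
    (hasGradientAt_cutoff hG hχ δ) hd cH
    (fun x => (b₀ x).trans (le_max_left _ _))
    (fun x => (b₁ x).trans ((le_max_left _ _).trans (le_max_right _ _)))
    (fun x => (b₂ x).trans ((le_max_right _ _).trans (le_max_right _ _))) hφ hφ' hM hM0
    (Real.sqrt_pos.2 (by positivity)) fun θ => ?_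
  rw [Real.sq_sqrt (by positivity)]
  obtain ⟨iRR, hRR⟩ := integrable_mul_rotate hR4 cR θ
  have cA : Continuous fun p : E × E => ContinuousLinearMap.adjoint (H p.1) (G' (rotate θ p)) :=
    continuous_adjoint_apply (hH.comp continuous_fst) (by fun_prop)
  have iA : Integrable (fun p : E × E =>
      ‖ContinuousLinearMap.adjoint (H p.1) (G' (rotate θ p))‖ ^ 2)
      ((stdGaussian E).prod (stdGaussian E)) := by
    refine iRR.mono' (by fun_prop : Continuous _).aestronglyMeasurable (ae_of_all _ fun p => ?_)
    rw [norm_pow, norm_norm]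
    refine pow_le_pow_left₀ (norm_nonneg _) ((ContinuousLinearMap.le_opNorm _ _).trans ?_) 2
    rw [LinearIsometryEquiv.norm_map]
    refine mul_le_mul ?_ ?_ (norm_nonneg _) (by positivity)
    · exact le_add_of_nonneg_left (by positivity)
    · simp only [hR]
      linarith [abs_nonneg (G (rotate θ p)), norm_nonneg (H (rotate θ p))]
  have ii := (iA.const_mul (1 + δ)).add (iRR.const_mul ((δ + δ ^ 2) * B ^ 2))
  refine (integral_mono_of_nonneg (ae_of_all _ fun p => sq_nonneg _) ii
    (ae_of_all _ fun p => ?_)).trans ?_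
  · simp only [Pi.add_apply]
    have hle := norm_adjoint_cutoffHessian_le (H := H) (G := G) (G' := G') δ0.le δ1 bχ bχ' bχ''
      p.1 (rotate θ p)
    rw [← hB] at hle
    have h2 := pow_le_pow_left₀ (norm_nonneg _) hle 2
    refine h2.trans ?_
    set A := ‖ContinuousLinearMap.adjoint (H p.1) (G' (rotate θ p))‖
    change (A + δ * (B * (R p.1 * R (rotate θ p)))) ^ 2 ≤ _
    set S := R p.1 * R (rotate θ p)
    -- Exactly the difference between `(1 + δ)A² + (δ + δ²)B²S²` and `(A + δBS)²`.
    have := mul_nonneg δ0.le (sq_nonneg (A - B * S))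
    linarith
  · rw [integral_add' (iA.const_mul _) (iRR.const_mul _), integral_const_mul, integral_const_mul]
    have h1 := mul_le_mul_of_nonneg_left (hK θ) (by positivity : 0 ≤ 1 + δ)
    have h2 := mul_le_mul_of_nonneg_left hRR (by positivity : 0 ≤ (δ + δ ^ 2) * B ^ 2)
    have h3 : (δ + δ ^ 2) * B ^ 2 * Q = (δ + δ ^ 2) * (B ^ 2 * Q) := by ring
    rw [← h3]
    linarith

/-- Dominated convergence along `δ = 1/(k+1)`: the cut-off function is at most `|G|` in absolute
value, and `φ` grows at most linearly. -/
theorem covariance_sub_le {G : E → ℝ} {G' : E → E} {H : E → E →L[ℝ] E} {K M : ℝ}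
    {φ φ' : ℝ → ℝ} (hG : ∀ x, HasGradientAt G (G' x) x) (hG' : ∀ x, HasFDerivAt G' (H x) x)
    (hH : Continuous H) (hG4 : MemLp G 4 (stdGaussian E)) (hG4' : MemLp G' 4 (stdGaussian E))
    (hH4 : MemLp H 4 (stdGaussian E))
    (hφ : ∀ t, HasDerivAt φ (φ' t) t) (hφ' : Continuous φ') (hM : ∀ t, |φ' t| ≤ M)
    (hM0 : 0 < M) (hK0 : 0 ≤ K)
    (hK : ∀ θ, ∫ p, ‖ContinuousLinearMap.adjoint (H p.1) (G' (rotate θ p))‖ ^ 2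
      ∂((stdGaussian E).prod (stdGaussian E)) ≤ K ^ 2) :
    (∫ x, φ (G x) * G x ∂stdGaussian E - (∫ x, φ (G x) ∂stdGaussian E) * ∫ x, G x ∂stdGaussian E) -
      (∫ x, φ' (G x) ∂stdGaussian E) *
        (∫ x, G x * G x ∂stdGaussian E - (∫ x, G x ∂stdGaussian E) * ∫ x, G x ∂stdGaussian E) ≤
      2 * M * K := by
  have cG : Continuous G := continuous_iff_continuousAt.2 fun x => (hG x).continuousAt
  have cG' : Continuous G' := continuous_iff_continuousAt.2 fun x => (hG' x).continuousAt
  have cφ : Continuous φ := continuous_iff_continuousAt.2 fun x => (hφ x).continuousAt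
  obtain ⟨χ, χ', χ'', C, hχ, hχ', cχ'', bχ, bχ', bχ'', χ0, sχ, sχ', sχ''⟩ := exists_smooth_cutoff E
  have cχ : Continuous χ := continuous_iff_continuousAt.2 fun x => (hχ x).continuousAt
  have cχ' : Continuous χ' := continuous_iff_continuousAt.2 fun x => (hχ' x).continuousAt
  set R : E → ℝ := fun x => |G x| + ‖G' x‖ + ‖H x‖ with hR
  have hR4 : MemLp R 4 (stdGaussian E) := (hG4.norm.add hG4'.norm).add hH4.norm
  set Q := ∫ x, R x ^ 4 ∂stdGaussian E with hQ
  have hQ0 : 0 ≤ Q := integral_nonneg fun x => by positivity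
  set B := C + 2 * C * (1 + C) with hB
  have iG : Integrable G (stdGaussian E) := hG4.integrable (by norm_num)
  have iG2 : Integrable (fun x => G x * G x) (stdGaussian E) :=
    (hG4.mono_exponent (by norm_num : (2 : ℝ≥0∞) ≤ 4)).integrable_sq.congr
      (ae_of_all _ fun x => sq (G x))
  -- passage to the limit
  have l0 : Tendsto (fun k : ℕ => (1 : ℝ) / ((k : ℝ) + 1)) atTop (𝓝 0) :=
    tendsto_one_div_add_atTop_nhds_zero_nat
  have lG : ∀ x, Tendsto (fun k : ℕ => χ (((1 : ℝ) / ((k : ℝ) + 1)) • x) * G x) atTop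
      (𝓝 (G x)) := fun x => by
    have h := ((cχ.tendsto _).comp (l0.smul_const x)).mul_const (G x)
    rwa [zero_smul, χ0, one_mul] at h
  have bG : ∀ (δ : ℝ) x, |χ (δ • x) * G x| ≤ |G x| := fun δ x => by
    rw [abs_mul]; exact mul_le_of_le_one_left (abs_nonneg _) (bχ _)
  have L1 : Tendsto (fun k : ℕ => ∫ x, χ (((1 : ℝ) / ((k : ℝ) + 1)) • x) * G x ∂stdGaussian E)
      atTop (𝓝 (∫ x, G x ∂stdGaussian E)) :=
    tendsto_integral_of_dominated_convergence (fun x => |G x|)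
      (fun k => (by fun_prop : Continuous _).aestronglyMeasurable) iG.abs
      (fun k => ae_of_all _ fun x => bG _ x) (ae_of_all _ lG)
  have L2 : Tendsto (fun k : ℕ => ∫ x, (χ (((1 : ℝ) / ((k : ℝ) + 1)) • x) * G x) *
      (χ (((1 : ℝ) / ((k : ℝ) + 1)) • x) * G x) ∂stdGaussian E)
      atTop (𝓝 (∫ x, G x * G x ∂stdGaussian E)) :=
    tendsto_integral_of_dominated_convergence (fun x => |G x * G x|)
      (fun k => (by fun_prop : Continuous _).aestronglyMeasurable) iG2.abs
      (fun k => ae_of_all _ fun x => by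
        rw [norm_mul, abs_mul]
        exact mul_le_mul (bG _ x) (bG _ x) (abs_nonneg _) (abs_nonneg _))
      (ae_of_all _ fun x => (lG x).mul (lG x))
  have bφ : ∀ (δ : ℝ) x, |φ (χ (δ • x) * G x)| ≤ |φ 0| + M * |G x| := fun δ x =>
    (abs_le_of_abs_deriv_le hφ hM _).trans
      (add_le_add le_rfl (mul_le_mul_of_nonneg_left (bG _ _) hM0.le))
  have L3 : Tendsto (fun k : ℕ => ∫ x, φ (χ (((1 : ℝ) / ((k : ℝ) + 1)) • x) * G x) ∂stdGaussian E)
      atTop (𝓝 (∫ x, φ (G x) ∂stdGaussian E)) :=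
    tendsto_integral_of_dominated_convergence (fun x => |φ 0| + M * |G x|)
      (fun k => (by fun_prop : Continuous _).aestronglyMeasurable)
      ((integrable_const _).add (iG.abs.const_mul M))
      (fun k => ae_of_all _ fun x => bφ _ x)
      (ae_of_all _ fun x => (cφ.tendsto _).comp (lG x))
  have L4 : Tendsto (fun k : ℕ => ∫ x, φ' (χ (((1 : ℝ) / ((k : ℝ) + 1)) • x) * G x) ∂stdGaussian E)
      atTop (𝓝 (∫ x, φ' (G x) ∂stdGaussian E)) :=
    tendsto_integral_of_dominated_convergence (fun _ => M)
      (fun k => (by fun_prop : Continuous _).aestronglyMeasurable) (integrable_const _)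
      (fun k => ae_of_all _ fun x => hM _)
      (ae_of_all _ fun x => (hφ'.tendsto _).comp (lG x))
  have L5 : Tendsto (fun k : ℕ => ∫ x, φ (χ (((1 : ℝ) / ((k : ℝ) + 1)) • x) * G x) *
      (χ (((1 : ℝ) / ((k : ℝ) + 1)) • x) * G x) ∂stdGaussian E)
      atTop (𝓝 (∫ x, φ (G x) * G x ∂stdGaussian E)) :=
    tendsto_integral_of_dominated_convergence (fun x => |φ 0| * |G x| + M * |G x * G x|)
      (fun k => (by fun_prop : Continuous _).aestronglyMeasurable)
      ((iG.abs.const_mul _).add (iG2.abs.const_mul M))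
      (fun k => ae_of_all _ fun x => by
        rw [norm_mul]
        refine (mul_le_mul (bφ _ x) (bG _ x) (abs_nonneg _) (by positivity)).trans (le_of_eq ?_)
        rw [abs_mul]; ring)
      (ae_of_all _ fun x => ((cφ.tendsto _).comp (lG x)).mul (lG x))
  have L6 : Tendsto (fun k : ℕ => 2 * M * √((1 + (1 : ℝ) / ((k : ℝ) + 1)) * K ^ 2 +
      ((1 : ℝ) / ((k : ℝ) + 1) + ((1 : ℝ) / ((k : ℝ) + 1)) ^ 2) * (B ^ 2 * Q) +
      (1 : ℝ) / ((k : ℝ) + 1))) atTop (𝓝 (2 * M * K)) := by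
    have h : Continuous fun δ : ℝ =>
      2 * M * √((1 + δ) * K ^ 2 + (δ + δ ^ 2) * (B ^ 2 * Q) + δ) := by fun_prop
    have h0 : 2 * M * √((1 + 0) * K ^ 2 + (0 + 0 ^ 2) * (B ^ 2 * Q) + 0) = 2 * M * K := by
      simp [Real.sqrt_sq hK0]
    rw [← h0]
    exact (h.tendsto 0).comp l0
  refine le_of_tendsto_of_tendsto' ((L5.sub (L3.mul L1)).sub (L4.mul (L2.sub (L1.mul L1)))) L6
    fun k => covariance_cutoff_sub_le hG hG' hH hR4 hφ hφ' hM hM0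
      hK hχ hχ' cχ'' bχ bχ' bχ'' sχ sχ' (by positivity) ?_
  rw [div_le_one (by positivity)]
  linarith [(Nat.cast_nonneg k : (0 : ℝ) ≤ k)]

end Limit

/-! ### Stein's equation -/

section Stein

theorem integrable_gaussianPDFReal_mul_id :
    Integrable fun x : ℝ => x * gaussianPDFReal 0 1 x :=
  (integrable_mul_gaussianPDFReal integrable_id_gaussianReal).congr
    (ae_of_all _ fun _ => mul_comm _ _)

/-- The density is minus an antiderivative of the integrand and vanishes at infinity. This is the
tail estimate behind the bound on Stein's solution. -/
theorem integral_Ioi_id_mul_gaussianPDFReal (x : ℝ) :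
    ∫ y in Set.Ioi x, y * gaussianPDFReal 0 1 y = gaussianPDFReal 0 1 x := by
  have h0 : Tendsto (gaussianPDFReal 0 1) atTop (𝓝 0) :=
    tendsto_zero_of_hasDerivAt_of_integrableOn_Ioi (a := x)
      (fun y _ => hasDerivAt_gaussianPDFReal_zero_one y)
      integrable_gaussianPDFReal_mul_id.neg.integrableOn
      (integrable_gaussianPDFReal 0 1).integrableOn
  have h := integral_Ioi_of_hasDerivAt_of_tendsto' (a := x)
    (fun y _ => (hasDerivAt_gaussianPDFReal_zero_one y).neg)
    (by simpa using integrable_gaussianPDFReal_mul_id.integrableOn) h0.neg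
  simpa using h

theorem integral_Iic_neg_mul_gaussianPDFReal (x : ℝ) :
    ∫ y in Set.Iic x, -y * gaussianPDFReal 0 1 y = gaussianPDFReal 0 1 x := by
  have hd : ∀ y, HasDerivAt (gaussianPDFReal 0 1) (-y * gaussianPDFReal 0 1 y) y := fun y =>
    (hasDerivAt_gaussianPDFReal_zero_one y).congr_deriv (by ring)
  have hi : Integrable fun y : ℝ => -y * gaussianPDFReal 0 1 y :=
    integrable_gaussianPDFReal_mul_id.neg.congr (ae_of_all _ fun y => by
      simp only [Pi.neg_apply]; ring)
  have h0 : Tendsto (gaussianPDFReal 0 1) atBot (𝓝 0) :=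
    tendsto_zero_of_hasDerivAt_of_integrableOn_Iic (a := x) (fun y _ => hd y)
      hi.integrableOn (integrable_gaussianPDFReal 0 1).integrableOn
  have h := integral_Iic_of_hasDerivAt_of_tendsto' (a := x) (fun y _ => hd y)
    hi.integrableOn h0
  simpa using h

/-- Stein's equation `φ' x - x φ x = h x - ∫ h` for a continuous test function `h` with values
in `[0, 1]`. -/
theorem exists_stein_solution {h : ℝ → ℝ} (hc : Continuous h) (h0 : ∀ x, 0 ≤ h x)
    (h1 : ∀ x, h x ≤ 1) : ∃ φ φ' : ℝ → ℝ, (∀ x, HasDerivAt φ (φ' x) x) ∧ Continuous φ' ∧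
      (∀ x, |φ' x| ≤ 2) ∧ ∀ x, φ' x - x * φ x = h x - ∫ y, h y ∂gaussianReal 0 1 := by
  set p := gaussianPDFReal 0 1 with hp
  have p0 : ∀ x, 0 < p x := fun x => gaussianPDFReal_pos 0 1 x one_ne_zero
  have pd : ∀ x, HasDerivAt p (-(x * p x)) x := hasDerivAt_gaussianPDFReal_zero_one
  have pc : Continuous p := continuous_iff_continuousAt.2 fun x => (pd x).continuousAt
  set m := ∫ y, h y ∂gaussianReal 0 1 with hm
  have ih : Integrable h (gaussianReal 0 1) :=
    Integrable.of_bound hc.aestronglyMeasurable 1 (ae_of_all _ fun x => by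
      rw [Real.norm_of_nonneg (h0 x)]; exact h1 x)
  have m0 : 0 ≤ m := integral_nonneg h0
  have m1 : m ≤ 1 := by
    have := integral_mono ih (integrable_const 1) h1
    simpa using this
  have hb : ∀ x, |h x - m| ≤ 1 := fun x => abs_le.2 ⟨by linarith [h0 x], by linarith [h1 x]⟩
  set q : ℝ → ℝ := fun y => p y * (h y - m) with hq
  have qc : Continuous q := by fun_prop
  have qi : Integrable q := integrable_mul_gaussianPDFReal (ih.sub (integrable_const m))
  have q0 : ∫ y, q y = 0 := by
    have : ∫ y, (h y - m) ∂gaussianReal 0 1 = 0 := by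
      rw [integral_sub ih (integrable_const m)]; simp [hm]
    rwa [integral_gaussianReal_eq_integral_smul one_ne_zero] at this
  have qb : ∀ y, ‖q y‖ ≤ p y := fun y => by
    rw [norm_mul, Real.norm_of_nonneg (p0 y).le]
    exact mul_le_of_le_one_right (p0 y).le (hb y)
  -- With `p` as integrating factor, `Φ / p` solves the equation.
  set Φ : ℝ → ℝ := fun x => ∫ y in Set.Iic x, q y with hΦ
  have Φd : ∀ x, HasDerivAt Φ (q x) x := fun x => by
    have e : Φ = fun x => Φ 0 + ∫ y in (0 : ℝ)..x, q y := by
      ext x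
      rw [← intervalIntegral.integral_Iic_sub_Iic qi.integrableOn qi.integrableOn]
      simp [hΦ]
    rw [e]
    exact (intervalIntegral.integral_hasDerivAt_right (qc.intervalIntegrable _ _)
      qc.stronglyMeasurable.stronglyMeasurableAtFilter qc.continuousAt).const_add _
  -- In the tail beyond `x`, `|x| ≤ |y|`, and `|y| p(y)` integrates there to `p(x)`. For `x ≥ 0` the
  -- upper tail may be used because `q` has total integral zero. Hence `|x φ x| ≤ 1`, and `|φ'| ≤ 2`
  -- by the equation.
  have Φb : ∀ x, |x * Φ x| ≤ p x := fun x => by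
    rcases le_total x 0 with hx | hx
    · have i1 : IntegrableOn (fun y => -y * p y) (Set.Iic x) :=
        (integrable_gaussianPDFReal_mul_id.neg.congr (ae_of_all _ fun y => by
          simp only [Pi.neg_apply]; ring)).integrableOn
      have : |Φ x| ≤ ∫ y in Set.Iic x, p y :=
        norm_integral_le_of_norm_le (integrable_gaussianPDFReal 0 1).integrableOn
          (ae_of_all _ qb)
      have key := integral_Iic_neg_mul_gaussianPDFReal x
      rw [← hp] at key
      rw [abs_mul, abs_of_nonpos hx, ← key]
      refine (mul_le_mul_of_nonneg_left this (by linarith)).trans ?_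
      rw [← integral_const_mul]
      refine setIntegral_mono_on ((integrable_gaussianPDFReal 0 1).const_mul _).integrableOn
        i1 measurableSet_Iic fun y hy => ?_
      exact mul_le_mul_of_nonneg_right (neg_le_neg hy) (p0 y).le
    · have i1 : IntegrableOn (fun y => y * p y) (Set.Ioi x) :=
        integrable_gaussianPDFReal_mul_id.integrableOn
      have e : Φ x = -∫ y in Set.Ioi x, q y := by
        have := intervalIntegral.integral_Iic_add_Ioi (f := q) (b := x) qi.integrableOn
          qi.integrableOn
        rw [q0] at this
        simp only [hΦ]
        linarith
      have : |Φ x| ≤ ∫ y in Set.Ioi x, p y := by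
        rw [e, abs_neg]
        exact norm_integral_le_of_norm_le (integrable_gaussianPDFReal 0 1).integrableOn
          (ae_of_all _ qb)
      have key := integral_Ioi_id_mul_gaussianPDFReal x
      rw [← hp] at key
      rw [abs_mul, abs_of_nonneg hx, ← key]
      refine (mul_le_mul_of_nonneg_left this hx).trans ?_
      rw [← integral_const_mul]
      refine setIntegral_mono_on ((integrable_gaussianPDFReal 0 1).const_mul _).integrableOn
        i1 measurableSet_Ioi fun y hy => ?_
      exact mul_le_mul_of_nonneg_right (le_of_lt hy) (p0 y).le
  have Φc : Continuous Φ := continuous_iff_continuousAt.2 fun x => (Φd x).continuousAt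
  refine ⟨fun x => Φ x / p x, fun x => (h x - m) + x * Φ x / p x, fun x => ?_,
    (hc.sub continuous_const).add ((continuous_id.mul Φc).div pc fun x => (p0 x).ne'),
    fun x => ?_, fun x => by ring⟩
  · refine ((Φd x).div (pd x) (p0 x).ne').congr_deriv ?_
    have := (p0 x).ne'
    simp only [hq]
    field_simp
    ring
  · refine (abs_add_le _ _).trans ?_
    have : |x * Φ x / p x| ≤ 1 := by
      rw [abs_div, abs_of_pos (p0 x), div_le_one (p0 x)]
      exact Φb x
    linarith [hb x]

end Stein

/-! ### From Stein's equation to total variation -/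

section TotalVariation

/-- Continuous functions are dense in `L¹(μ + ν)`, so an indicator is approximated for both laws at
once. -/
theorem tvDist_le_of_forall_continuous {μ ν : Measure ℝ} [IsProbabilityMeasure μ]
    [IsProbabilityMeasure ν] {C : ℝ}
    (H : ∀ h : ℝ → ℝ, Continuous h → (∀ x, 0 ≤ h x) → (∀ x, h x ≤ 1) →
      |∫ x, h x ∂μ - ∫ x, h x ∂ν| ≤ C) :
    tvDist μ ν ≤ ENNReal.ofReal C := by
  refine iSup₂_le fun B hB => ENNReal.ofReal_le_ofReal (le_of_forall_pos_le_add fun ε hε => ?_)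
  set f : ℝ → ℝ := B.indicator fun _ => 1 with hf
  have fi : ∀ ρ : Measure ℝ, IsFiniteMeasure ρ → Integrable f ρ := fun ρ _ =>
    (integrable_const 1).indicator hB
  obtain ⟨g, hg, gi⟩ := (fi (μ + ν) inferInstance).exists_boundedContinuous_integral_sub_le hε
  -- Clamping to `[0, 1]` brings `g` no further from an indicator, since clamping is a contraction
  -- that fixes 0 and 1.
  set k : ℝ → ℝ := fun x => max 0 (min (g x) 1) with hk
  have kc : Continuous k := by fun_prop
  have k0 : ∀ x, 0 ≤ k x := fun x => le_max_left _ _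
  have k1 : ∀ x, k x ≤ 1 := fun x => max_le zero_le_one (min_le_right _ _)
  have ki : ∀ ρ : Measure ℝ, IsFiniteMeasure ρ → Integrable k ρ := fun ρ _ =>
    Integrable.of_bound kc.aestronglyMeasurable 1 (ae_of_all _ fun x => by
      rw [Real.norm_of_nonneg (k0 x)]; exact k1 x)
  have hle : ∀ x, |f x - k x| ≤ ‖f x - g x‖ := fun x => by
    rw [Real.norm_eq_abs]
    have hfx : f x = max 0 (min (f x) 1) := by
      simp only [hf, Set.indicator]
      split_ifs <;> norm_num
    have a1 := abs_max_sub_max_le_abs (min (f x) 1) (min (g x) 1) 0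
    have a2 := abs_min_sub_min_le_max (f x) 1 (g x) 1
    rw [sub_self, abs_zero, max_eq_left (abs_nonneg _)] at a2
    rw [max_comm (min (f x) 1), max_comm (min (g x) 1), ← hfx] at a1
    exact a1.trans a2
  have fe : ∀ ρ : Measure ℝ, IsFiniteMeasure ρ → ρ.real B = ∫ x, f x ∂ρ := fun ρ _ => by
    rw [hf, integral_indicator_const _ hB]; simp
  have d : ∀ ρ : Measure ℝ, IsFiniteMeasure ρ →
      |∫ x, f x ∂ρ - ∫ x, k x ∂ρ| ≤ ∫ x, |f x - k x| ∂ρ := fun ρ hρ => by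
    rw [← integral_sub (fi ρ hρ) (ki ρ hρ)]
    exact abs_integral_le_integral_abs
  have i1 : Integrable (fun x => |f x - k x|) μ := ((fi μ inferInstance).sub (ki μ inferInstance)).abs
  have i2 : Integrable (fun x => |f x - k x|) ν := ((fi ν inferInstance).sub (ki ν inferInstance)).abs
  have e : ∫ x, |f x - k x| ∂μ + ∫ x, |f x - k x| ∂ν ≤ ε := by
    rw [← integral_add_measure i1 i2]
    exact (integral_mono (i1.add_measure i2) ((fi (μ + ν) inferInstance).sub gi).norm hle).trans hg
  rw [fe μ inferInstance, fe ν inferInstance]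
  have a1 := abs_le.1 (d μ inferInstance)
  have a2 := abs_le.1 (d ν inferInstance)
  have a3 := abs_le.1 (H k kc k0 k1)
  rw [abs_le]
  constructor <;> linarith

theorem tvDist_self (μ : Measure ℝ) : tvDist μ μ = 0 := by
  simp [tvDist]

variable {E : Type*} [NormedAddCommGroup E] [InnerProductSpace ℝ E] [FiniteDimensional ℝ E]
  [MeasurableSpace E] [BorelSpace E] [SecondCountableTopology E]

/-- The second order Poincaré inequality for functions of a standard Gaussian vector. -/
theorem tvDist_map_stdGaussian_le {G : E → ℝ} {G' : E → E} {H : E → E →L[ℝ] E} {K : ℝ}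
    (hG : ∀ x, HasGradientAt G (G' x) x) (hG' : ∀ x, HasFDerivAt G' (H x) x)
    (hH : Continuous H) (hG4 : MemLp G 4 (stdGaussian E)) (hG4' : MemLp G' 4 (stdGaussian E))
    (hH4 : MemLp H 4 (stdGaussian E)) (hK0 : 0 ≤ K)
    (hK : ∀ θ, ∫ p, ‖ContinuousLinearMap.adjoint (H p.1) (G' (rotate θ p))‖ ^ 2
      ∂((stdGaussian E).prod (stdGaussian E)) ≤ K ^ 2)
    (hv : 0 < Var[G; stdGaussian E]) :
    tvDist ((stdGaussian E).map G)
      (gaussianReal (∫ x, G x ∂stdGaussian E) (Var[G; stdGaussian E]).toNNReal) ≤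
      ENNReal.ofReal (4 * K / Var[G; stdGaussian E]) := by
  have cG : Continuous G := continuous_iff_continuousAt.2 fun x => (hG x).continuousAt
  have hG2 : MemLp G 2 (stdGaussian E) := hG4.mono_exponent (by norm_num)
  have iG : Integrable G (stdGaussian E) := hG2.integrable (by norm_num)
  have : IsProbabilityMeasure ((stdGaussian E).map G) :=
    Measure.isProbabilityMeasure_map cG.aemeasurable
  set v := Var[G; stdGaussian E] with hvdef
  set m := ∫ x, G x ∂stdGaussian E with hm
  have hvar : v = ∫ x, G x * G x ∂stdGaussian E - m * m := by
    rw [hvdef, variance_eq_sub hG2]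
    simp [sq, hm]
  set σ := √v with hσ
  have σ0 : 0 < σ := Real.sqrt_pos.2 hv
  have σ2 : σ * σ = v := Real.mul_self_sqrt hv.le
  refine tvDist_le_of_forall_continuous fun h hc h0 h1 => ?_
  obtain ⟨φ, φ', hφ, hφ', hb, heq⟩ := exists_stein_solution (h := fun z => h (m + σ * z))
    (by fun_prop) (fun z => h0 _) (fun z => h1 _)
  have cφ : Continuous φ := continuous_iff_continuousAt.2 fun x => (hφ x).continuousAt
  have hN : ∫ z, h (m + σ * z) ∂gaussianReal 0 1 = ∫ x, h x ∂gaussianReal m v.toNNReal := by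
    have hmap : (gaussianReal 0 1).map (fun z => m + σ * z) = gaussianReal m v.toNNReal := by
      have h1 := gaussianReal_map_const_mul (μ := 0) (v := 1) σ
      have h2 := gaussianReal_map_const_add (μ := σ * 0) (v := NNReal.mk (σ ^ 2) (sq_nonneg _) * 1) m
      rw [← h1, Measure.map_map (by fun_prop) (by fun_prop)] at h2
      rw [show (fun z => m + σ * z) = (fun x => m + x) ∘ fun x => σ * x from rfl, h2]
      congr 1
      · ring
      · ext
        simp [Real.coe_toNNReal _ hv.le, sq, σ2]
    rw [← hmap, integral_map (by fun_prop) hc.aestronglyMeasurable]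
  have hμ : ∫ x, h x ∂(stdGaussian E).map G = ∫ x, h (G x) ∂stdGaussian E :=
    integral_map cG.aemeasurable hc.aestronglyMeasurable
  rw [hμ, ← hN]
  -- Standardisation turns the derivative bound 2 into `2/σ`; the equation itself brings a further
  -- `1/σ`, whence `4K/σ²`.
  set ψ : ℝ → ℝ := fun w => φ ((w - m) / σ) with hψ
  set ψ' : ℝ → ℝ := fun w => φ' ((w - m) / σ) / σ with hψ'
  have ψd : ∀ w, HasDerivAt ψ (ψ' w) w := fun w => by
    have h1 : HasDerivAt (fun w : ℝ => (w - m) / σ) (1 / σ) w :=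
      ((hasDerivAt_id w).sub_const m).div_const σ
    exact ((hφ ((w - m) / σ)).comp w h1).congr_deriv (by simp only [hψ']; ring)
  have ψc : Continuous ψ' := by fun_prop
  have cψ : Continuous ψ := by fun_prop
  have ψb : ∀ w, |ψ' w| ≤ 2 / σ := fun w => by
    rw [abs_div, abs_of_pos σ0]
    exact div_le_div_of_nonneg_right (hb _) σ0.le
  have hpos := covariance_sub_le hG hG' hH hG4 hG4' hH4 ψd ψc ψb (by positivity) hK0 hK
  -- The covariance bound is one-sided; the case of `-ψ` gives the absolute value.
  have hneg := covariance_sub_le hG hG' hH hG4 hG4' hH4 (φ := fun w => -ψ w)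
    (φ' := fun w => -ψ' w) (fun w => (ψd w).neg) ψc.neg (fun w => by rw [abs_neg]; exact ψb w)
    (by positivity) hK0 hK
  simp only [neg_mul, integral_neg] at hneg
  rw [← hm, ← hvar] at hpos hneg
  have ψG : ∀ x, |ψ (G x)| ≤ |ψ 0| + 2 / σ * |G x| := fun x => abs_le_of_abs_deriv_le ψd ψb _
  have iψ : Integrable (fun x => ψ (G x)) (stdGaussian E) :=
    ((integrable_const |ψ 0|).add (iG.abs.const_mul (2 / σ))).mono'
      (by fun_prop : Continuous _).aestronglyMeasurable (ae_of_all _ ψG)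
  have iψG : Integrable (fun x => ψ (G x) * G x) (stdGaussian E) :=
    ((iG.abs.const_mul |ψ 0|).add (hG2.integrable_sq.const_mul (2 / σ))).mono'
      (by fun_prop : Continuous _).aestronglyMeasurable (ae_of_all _ fun x => by
        rw [norm_mul]
        refine (mul_le_mul_of_nonneg_right (ψG x) (abs_nonneg _)).trans (le_of_eq ?_)
        simp only [Pi.add_apply]
        rw [← sq_abs (G x)]
        ring)
  have iψ' : Integrable (fun x => ψ' (G x)) (stdGaussian E) :=
    Integrable.of_bound (by fun_prop : Continuous _).aestronglyMeasurable (2 / σ)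
      (ae_of_all _ fun x => ψb _)
  have hpt : ∀ x, h (G x) - ∫ z, h (m + σ * z) ∂gaussianReal 0 1 =
      σ * ψ' (G x) - σ⁻¹ * (ψ (G x) * G x - m * ψ (G x)) := fun x => by
    have := heq ((G x - m) / σ)
    rw [show m + σ * ((G x - m) / σ) = G x by field_simp; ring] at this
    rw [← this]
    simp only [hψ, hψ']
    field_simp
  have ih : Integrable (fun x => h (G x)) (stdGaussian E) :=
    Integrable.of_bound (by fun_prop : Continuous _).aestronglyMeasurable 1
      (ae_of_all _ fun x => by rw [Real.norm_of_nonneg (h0 _)]; exact h1 _)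
  have hint : ∫ x, h (G x) ∂stdGaussian E - ∫ z, h (m + σ * z) ∂gaussianReal 0 1 =
      σ * ∫ x, ψ' (G x) ∂stdGaussian E - σ⁻¹ * (∫ x, ψ (G x) * G x ∂stdGaussian E -
        m * ∫ x, ψ (G x) ∂stdGaussian E) := by
    have e1 : ∫ x, (h (G x) - ∫ z, h (m + σ * z) ∂gaussianReal 0 1) ∂stdGaussian E =
        ∫ x, h (G x) ∂stdGaussian E - ∫ z, h (m + σ * z) ∂gaussianReal 0 1 := by
      rw [integral_sub ih (integrable_const _)]; simp
    have j1 : Integrable (fun x => ψ (G x) * G x - m * ψ (G x)) (stdGaussian E) :=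
      iψG.sub (iψ.const_mul m)
    rw [← e1]
    simp only [hpt]
    rw [integral_sub (iψ'.const_mul σ) (j1.const_mul σ⁻¹), integral_const_mul,
      integral_const_mul, integral_sub iψG (iψ.const_mul m), integral_const_mul]
  rw [hint]
  set A := ∫ x, ψ' (G x) ∂stdGaussian E
  set B := ∫ x, ψ (G x) * G x ∂stdGaussian E
  set D := ∫ x, ψ (G x) ∂stdGaussian E
  have e2 : σ * A - σ⁻¹ * (B - m * D) = -(σ⁻¹ * ((B - D * m) - A * v)) := by
    rw [← σ2]; field_simp; ring
  have e3 : 4 * K / v = σ⁻¹ * (2 * (2 / σ) * K) := by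
    rw [← σ2]; field_simp; ring
  rw [e2, e3, abs_neg, abs_mul, abs_of_pos (inv_pos.2 σ0)]
  refine mul_le_mul_of_nonneg_left ?_ (inv_pos.2 σ0).le
  rw [abs_le]
  constructor <;> linarith

end TotalVariation

/-! ### Operator and Hilbert-Schmidt norms -/

section MatrixNorms

open scoped Matrix.Norms.L2Operator

variable {m k l : Type*} [Fintype m] [Fintype k] [Fintype l] [DecidableEq m] [DecidableEq k]
  [DecidableEq l]

/-- A vector indexed by pairs, seen as a matrix. -/
def toMat : EuclideanSpace ℝ (m × k) →ₗ[ℝ] Matrix m k ℝ where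
  toFun x := Matrix.of fun i j => x (i, j)
  map_add' _ _ := rfl
  map_smul' _ _ := rfl

/-- A matrix, seen as a vector indexed by pairs; its norm is the Hilbert-Schmidt norm. -/
def ofMat : Matrix m k ℝ →ₗ[ℝ] EuclideanSpace ℝ (m × k) where
  toFun M := WithLp.toLp 2 fun p => M p.1 p.2
  map_add' _ _ := rfl
  map_smul' _ _ := rfl

@[simp]
theorem toMat_apply (x : EuclideanSpace ℝ (m × k)) (i : m) (j : k) : toMat x i j = x (i, j) := rfl

@[simp]
theorem ofMat_apply (M : Matrix m k ℝ) (p : m × k) : ofMat M p = M p.1 p.2 := rfl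

@[simp]
theorem ofMat_toMat (x : EuclideanSpace ℝ (m × k)) : ofMat (toMat x) = x := by
  ext p; simp

@[simp]
theorem toMat_ofMat (M : Matrix m k ℝ) : toMat (ofMat M) = M := rfl

theorem inner_ofMat (M M' : Matrix m k ℝ) : ⟪ofMat M, ofMat M'⟫_ℝ = (M * M'ᵀ).trace := by
  rw [PiLp.inner_apply, Fintype.sum_prod_type]
  simp [Matrix.trace, Matrix.mul_apply, mul_comm]

theorem norm_ofMat_sq (M : Matrix m k ℝ) : ‖ofMat M‖ ^ 2 = ∑ i, ∑ j, M i j ^ 2 := by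
  rw [EuclideanSpace.norm_sq_eq, Fintype.sum_prod_type]
  simp

theorem norm_ofMat_transpose (M : Matrix m k ℝ) : ‖ofMat Mᵀ‖ = ‖ofMat M‖ := by
  rw [← sq_eq_sq₀ (norm_nonneg _) (norm_nonneg _), norm_ofMat_sq, norm_ofMat_sq, Finset.sum_comm]
  rfl

theorem norm_transpose_l2 (M : Matrix m k ℝ) : ‖Mᵀ‖ = ‖M‖ := by
  rw [← conjTranspose_eq_transpose_of_trivial, l2_opNorm_conjTranspose]

theorem sum_sq_mulVec_le (B : Matrix m k ℝ) (x : k → ℝ) :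
    ∑ i, (B *ᵥ x) i ^ 2 ≤ ‖B‖ ^ 2 * ∑ j, x j ^ 2 := by
  have h := l2_opNorm_mulVec B (WithLp.toLp 2 x)
  have h2 := pow_le_pow_left₀ (norm_nonneg _) h 2
  rw [mul_pow, EuclideanSpace.norm_sq_eq, EuclideanSpace.norm_sq_eq] at h2
  simpa using h2

/-- The squared Hilbert-Schmidt norm is a sum over columns, and `B` acts on each column separately.
-/
theorem norm_ofMat_mul_le (B : Matrix m k ℝ) (V : Matrix k l ℝ) :
    ‖ofMat (B * V)‖ ≤ ‖B‖ * ‖ofMat V‖ := by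
  rw [← sq_le_sq₀ (norm_nonneg _) (by positivity), mul_pow, norm_ofMat_sq, norm_ofMat_sq,
    Finset.sum_comm, Finset.sum_comm (f := fun i j => V i j ^ 2), Finset.mul_sum]
  exact Finset.sum_le_sum fun j _ => sum_sq_mulVec_le B fun i => V i j

theorem norm_ofMat_mul_le' (V : Matrix m k ℝ) (C : Matrix k l ℝ) :
    ‖ofMat (V * C)‖ ≤ ‖ofMat V‖ * ‖C‖ := by
  rw [← norm_ofMat_transpose, Matrix.transpose_mul, mul_comm ‖ofMat V‖,
    ← norm_ofMat_transpose V, ← norm_transpose_l2 C]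
  exact norm_ofMat_mul_le _ _

/-- A row is the image of a unit vector under the transpose. This is what keeps single rows of the
gradient free of dimensional factors. -/
theorem sum_sq_row_le (M : Matrix m k ℝ) (i : m) : ∑ j, M i j ^ 2 ≤ ‖M‖ ^ 2 := by
  have h := sum_sq_mulVec_le Mᵀ (Pi.single i 1)
  rw [norm_transpose_l2] at h
  simpa [Pi.single_apply, Finset.sum_ite_eq] using h

theorem norm_le_norm_ofMat (M : Matrix m k ℝ) : ‖M‖ ≤ ‖ofMat M‖ := by
  rw [l2_opNorm_def]
  refine ContinuousLinearMap.opNorm_le_bound _ (norm_nonneg _) fun x => ?_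
  rw [← sq_le_sq₀ (norm_nonneg _) (by positivity), mul_pow, norm_ofMat_sq,
    EuclideanSpace.norm_sq_eq, EuclideanSpace.norm_sq_eq, Finset.sum_mul]
  refine Finset.sum_le_sum fun i _ => ?_
  simp only [Real.norm_eq_abs, sq_abs]
  exact Finset.sum_mul_sq_le_sq_mul_sq _ _ _

theorem isBoundedBilinearMap_ofMat_mul : IsBoundedBilinearMap ℝ
    fun p : EuclideanSpace ℝ (m × k) × EuclideanSpace ℝ (k × l) =>
      ofMat (toMat p.1 * toMat p.2) where
  add_left _ _ _ := by simp [Matrix.add_mul]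
  smul_left _ _ _ := by simp
  add_right _ _ _ := by simp [Matrix.mul_add]
  smul_right _ _ _ := by simp
  bound := ⟨1, one_pos, fun x y => by
    rw [one_mul]
    refine (norm_ofMat_mul_le _ _).trans ?_
    rw [ofMat_toMat]
    refine mul_le_mul_of_nonneg_right ((norm_le_norm_ofMat _).trans ?_) (norm_nonneg _)
    rw [ofMat_toMat]⟩

/-- Transposition as a continuous linear map. -/
noncomputable def transposeL : EuclideanSpace ℝ (m × k) →L[ℝ] EuclideanSpace ℝ (k × m) :=
  LinearMap.toContinuousLinearMap
    (ofMat ∘ₗ (Matrix.transposeLinearEquiv m k ℝ ℝ).toLinearMap ∘ₗ toMat)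

@[simp]
theorem transposeL_apply (x : EuclideanSpace ℝ (m × k)) : transposeL x = ofMat (toMat x)ᵀ := rfl

theorem HasFDerivAt.ofMat_mul {F : Type*} [NormedAddCommGroup F] [NormedSpace ℝ F]
    {f : F → EuclideanSpace ℝ (m × k)} {g : F → EuclideanSpace ℝ (k × l)}
    {f' : F →L[ℝ] EuclideanSpace ℝ (m × k)} {g' : F →L[ℝ] EuclideanSpace ℝ (k × l)} {x : F}
    (hf : HasFDerivAt f f' x) (hg : HasFDerivAt g g' x) :
    ∃ L : F →L[ℝ] EuclideanSpace ℝ (m × l),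
      HasFDerivAt (fun y => ofMat (toMat (f y) * toMat (g y))) L x ∧
      ∀ v, L v = ofMat (toMat (f x) * toMat (g' v) + toMat (f' v) * toMat (g x)) := by
  have h := ((isBoundedBilinearMap_ofMat_mul (m := m) (k := k) (l := l)).hasFDerivAt
    (f x, g x)).comp x (hf.prodMk hg)
  exact ⟨_, h, fun _ => by rw [map_add]; rfl⟩

end MatrixNorms

/-! ### Traces of powers of the Wishart matrix -/

section Wishart

open scoped Matrix.Norms.L2Operator

variable {n N : ℕ}

theorem wishart_transpose (X : Matrix (Fin n) (Fin N) ℝ) : (wishart X)ᵀ = wishart X := by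
  simp [wishart, Matrix.transpose_smul, Matrix.transpose_mul]

theorem norm_wishart (X : Matrix (Fin n) (Fin N) ℝ) : ‖wishart X‖ = ‖X‖ ^ 2 / N := by
  have h := l2_opNorm_conjTranspose_mul_self Xᵀ
  rw [conjTranspose_eq_transpose_of_trivial, Matrix.transpose_transpose, norm_transpose_l2] at h
  rw [wishart, norm_smul, h, norm_inv, Real.norm_natCast]
  ring

theorem posSemidef_wishart (X : Matrix (Fin n) (Fin N) ℝ) : (wishart X).PosSemidef := by
  have h := Matrix.posSemidef_self_mul_conjTranspose X
  rw [conjTranspose_eq_transpose_of_trivial] at h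
  exact h.smul (by positivity : (0 : ℝ) ≤ (N : ℝ)⁻¹)

/-- A positive semidefinite matrix is unitarily diagonal with nonnegative entries, so its norm is
its top eigenvalue. -/
theorem largestEigenvalue_wishart (hn : 0 < n) (X : Matrix (Fin n) (Fin N) ℝ) :
    largestEigenvalue (wishart X) = ‖X‖ ^ 2 / N := by
  rw [← norm_wishart]
  have hp := posSemidef_wishart X
  have hA := hp.isHermitian
  have hg := isGreatest_largestEigenvalue hn X
  have hnorm : ‖wishart X‖ = ‖hA.eigenvalues‖ := by
    conv_lhs => rw [hA.spectral_theorem]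
    rw [Unitary.conjStarAlgAut_apply, ← Unitary.coe_star, CStarRing.norm_mul_coe_unitary,
      CStarRing.norm_coe_unitary_mul, l2_opNorm_diagonal]
    rfl
  rw [hnorm]
  refine le_antisymm ?_ ?_
  · have h := hg.1
    rw [hA.spectrum_real_eq_range_eigenvalues] at h
    obtain ⟨i, hi⟩ := h
    rw [← hi]
    exact (le_abs_self _).trans (norm_le_pi_norm hA.eigenvalues i)
  · have h0 : ∀ i, hA.eigenvalues i ≤ largestEigenvalue (wishart X) := fun i =>
      hg.2 (hA.eigenvalues_mem_spectrum_real i)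
    have hpos : 0 ≤ largestEigenvalue (wishart X) :=
      (hp.eigenvalues_nonneg ⟨0, hn⟩).trans (h0 _)
    rw [pi_norm_le_iff_of_nonneg hpos]
    intro i
    rw [Real.norm_of_nonneg (hp.eigenvalues_nonneg i)]
    exact h0 i

/-- The matrix polynomial `A ^ m X`, where `A` is the Wishart matrix of `X`. -/
noncomputable def wishartPow (m : ℕ) (X : Matrix (Fin n) (Fin N) ℝ) : Matrix (Fin n) (Fin N) ℝ :=
  wishart X ^ m * X

theorem wishartPow_zero (X : Matrix (Fin n) (Fin N) ℝ) : wishartPow 0 X = X := by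
  simp [wishartPow]

theorem wishartPow_succ (m : ℕ) (X : Matrix (Fin n) (Fin N) ℝ) :
    wishartPow (m + 1) X = (N : ℝ)⁻¹ • (X * (Xᵀ * wishartPow m X)) := by
  rw [wishartPow, pow_succ', Matrix.mul_assoc]
  change wishart X * wishartPow m X = _
  rw [wishart, Matrix.smul_mul, Matrix.mul_assoc]

theorem norm_wishartPow_le (m : ℕ) (X : Matrix (Fin n) (Fin N) ℝ) :
    ‖wishartPow m X‖ ≤ (‖X‖ ^ 2 / N) ^ m * ‖X‖ := by
  induction m with
  | zero => simp [wishartPow_zero]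
  | succ m ih =>
    have e : wishartPow (m + 1) X = wishart X * wishartPow m X := by
      rw [wishartPow, pow_succ', Matrix.mul_assoc]; rfl
    rw [e, pow_succ', mul_assoc, ← norm_wishart]
    rw [← norm_wishart] at ih
    exact (l2_opNorm_mul _ _).trans (mul_le_mul_of_nonneg_left ih (norm_nonneg _))

theorem norm_ofMat_wishartPow_le (m : ℕ) (X : Matrix (Fin n) (Fin N) ℝ) :
    ‖ofMat (wishartPow m X)‖ ≤ (‖X‖ ^ 2 / N) ^ m * ‖ofMat X‖ := by
  induction m with
  | zero => simp [wishartPow_zero]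
  | succ m ih =>
    have e : wishartPow (m + 1) X = wishart X * wishartPow m X := by
      rw [wishartPow, pow_succ', Matrix.mul_assoc]; rfl
    rw [e, pow_succ', mul_assoc, ← norm_wishart]
    rw [← norm_wishart] at ih
    exact (norm_ofMat_mul_le _ _).trans (mul_le_mul_of_nonneg_left ih (norm_nonneg _))

theorem contDiff_wishartPow (m : ℕ) : ContDiff ℝ 1
    fun x : EuclideanSpace ℝ (Fin n × Fin N) => ofMat (wishartPow m (toMat x)) := by
  induction m with
  | zero => simpa only [wishartPow_zero, ofMat_toMat] using! contDiff_id
  | succ m ih =>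
    have h1 : ContDiff ℝ 1 fun x : EuclideanSpace ℝ (Fin n × Fin N) =>
        ofMat ((toMat x)ᵀ * wishartPow m (toMat x)) := by
      have := (isBoundedBilinearMap_ofMat_mul (m := Fin N) (k := Fin n) (l := Fin N)).contDiff.comp
        ((transposeL.contDiff (n := 1)).prodMk ih)
      exact this
    have h2 : ContDiff ℝ 1 fun x : EuclideanSpace ℝ (Fin n × Fin N) =>
        ofMat (toMat x * ((toMat x)ᵀ * wishartPow m (toMat x))) := by
      have := (isBoundedBilinearMap_ofMat_mul (m := Fin n) (k := Fin N) (l := Fin N)).contDiff.comp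
        (contDiff_id.prodMk h1)
      exact this
    simp only [wishartPow_succ, map_smul]
    exact h2.const_smul _

/-- The derivative of `A ^ m X` as a function of `X`. -/
noncomputable def wishartPowDeriv (m : ℕ) (x : EuclideanSpace ℝ (Fin n × Fin N)) :
    EuclideanSpace ℝ (Fin n × Fin N) →L[ℝ] EuclideanSpace ℝ (Fin n × Fin N) :=
  fderiv ℝ (fun x => ofMat (wishartPow m (toMat x))) x

theorem hasFDerivAt_wishartPow (m : ℕ) (x : EuclideanSpace ℝ (Fin n × Fin N)) :
    HasFDerivAt (fun x => ofMat (wishartPow m (toMat x))) (wishartPowDeriv m x) x :=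
  ((contDiff_wishartPow m).differentiable one_ne_zero x).hasFDerivAt

theorem continuous_wishartPowDeriv (m : ℕ) :
    Continuous (wishartPowDeriv m (n := n) (N := N)) :=
  (contDiff_wishartPow m).continuous_fderiv one_ne_zero

theorem wishartPowDeriv_zero (x v : EuclideanSpace ℝ (Fin n × Fin N)) :
    wishartPowDeriv 0 x v = v := by
  have h : HasFDerivAt
      (fun x : EuclideanSpace ℝ (Fin n × Fin N) => ofMat (wishartPow 0 (toMat x)))
      (ContinuousLinearMap.id ℝ _) x := by
    simpa only [wishartPow_zero, ofMat_toMat] using! hasFDerivAt_id x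
  rw [(hasFDerivAt_wishartPow 0 x).unique h]
  rfl

theorem wishartPowDeriv_succ (m : ℕ) (x v : EuclideanSpace ℝ (Fin n × Fin N)) :
    wishartPowDeriv (m + 1) x v = (N : ℝ)⁻¹ •
      (ofMat (toMat x * ((toMat x)ᵀ * toMat (wishartPowDeriv m x v))) +
        ofMat (toMat x * ((toMat v)ᵀ * wishartPow m (toMat x))) +
        ofMat (toMat v * ((toMat x)ᵀ * wishartPow m (toMat x)))) := by
  obtain ⟨L₁, h₁, e₁⟩ := HasFDerivAt.ofMat_mul
    ((transposeL (m := Fin n) (k := Fin N)).hasFDerivAt (x := x)) (hasFDerivAt_wishartPow m x)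
  obtain ⟨L₂, h₂, e₂⟩ := HasFDerivAt.ofMat_mul (hasFDerivAt_id x) h₁
  have h : HasFDerivAt
      (fun x : EuclideanSpace ℝ (Fin n × Fin N) => ofMat (wishartPow (m + 1) (toMat x)))
      ((N : ℝ)⁻¹ • L₂) x := by
    simp only [wishartPow_succ, map_smul]
    exact h₂.const_smul (N : ℝ)⁻¹
  rw [(hasFDerivAt_wishartPow (m + 1) x).unique h]
  simp [e₂, e₁, Matrix.mul_add]

/-- `A^m X` is `N^(-m)` times a word of `2m+1` letters `X` or `Xᵗ`. Differentiation replaces one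
letter by `v` or its transpose, measured in Hilbert-Schmidt norm, while the `2m` remaining letters
are measured in operator norm. -/
theorem norm_wishartPowDeriv_le (m : ℕ) (x v : EuclideanSpace ℝ (Fin n × Fin N)) :
    ‖wishartPowDeriv m x v‖ ≤ (2 * m + 1) * (‖toMat x‖ ^ 2 / N) ^ m * ‖v‖ := by
  induction m with
  | zero => simp [wishartPowDeriv_zero]
  | succ m ih =>
    rw [wishartPowDeriv_succ, norm_smul, norm_inv, Real.norm_natCast]
    set X := toMat x
    set ρ := ‖X‖ ^ 2 / N with hρ
    have hP := norm_wishartPow_le m X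
    have hT := norm_transpose_l2 X
    have hv : ‖ofMat (toMat v)‖ = ‖v‖ := by rw [ofMat_toMat]
    have t1 : ‖ofMat (X * (Xᵀ * toMat (wishartPowDeriv m x v)))‖ ≤
        ‖X‖ * (‖X‖ * ((2 * m + 1) * ρ ^ m * ‖v‖)) := by
      refine (norm_ofMat_mul_le _ _).trans (mul_le_mul_of_nonneg_left ?_ (norm_nonneg _))
      refine (norm_ofMat_mul_le _ _).trans ?_
      rw [hT, ofMat_toMat]
      exact mul_le_mul_of_nonneg_left ih (norm_nonneg _)
    have t2 : ‖ofMat (X * ((toMat v)ᵀ * wishartPow m X))‖ ≤ ‖X‖ * (‖v‖ * (ρ ^ m * ‖X‖)) := by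
      refine (norm_ofMat_mul_le _ _).trans (mul_le_mul_of_nonneg_left ?_ (norm_nonneg _))
      refine (norm_ofMat_mul_le' _ _).trans ?_
      rw [norm_ofMat_transpose, hv]
      exact mul_le_mul_of_nonneg_left hP (norm_nonneg _)
    have t3 : ‖ofMat (toMat v * (Xᵀ * wishartPow m X))‖ ≤ ‖v‖ * (‖X‖ * (ρ ^ m * ‖X‖)) := by
      refine (norm_ofMat_mul_le' _ _).trans ?_
      rw [hv]
      refine mul_le_mul_of_nonneg_left ((l2_opNorm_mul _ _).trans ?_) (norm_nonneg _)
      rw [hT]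
      exact mul_le_mul_of_nonneg_left hP (norm_nonneg _)
    have hN : (0 : ℝ) ≤ (N : ℝ)⁻¹ := by positivity
    refine (mul_le_mul_of_nonneg_left ((norm_add₃_le).trans
      (add_le_add (add_le_add t1 t2) t3)) hN).trans (le_of_eq ?_)
    have e : (N : ℝ)⁻¹ * ‖X‖ ^ 2 = ρ := by rw [hρ]; ring
    rw [pow_succ]
    push_cast
    linear_combination (2 * m + 3) * ρ ^ m * ‖v‖ * e

/-- By cyclicity and transposition of the trace, all `2m+1` letters contribute equally. Only `l = 0`
is used; general `l` is needed for the induction, since moving a factor `A` across the inner product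
raises `l`. -/
theorem inner_wishartPowDeriv (m l : ℕ) (x v : EuclideanSpace ℝ (Fin n × Fin N)) :
    ⟪wishartPowDeriv m x v, ofMat (wishartPow l (toMat x))⟫_ℝ =
      (2 * m + 1) * ⟪ofMat (wishartPow (m + l) (toMat x)), v⟫_ℝ := by
  set X := toMat x with hX
  set A := wishart X with hA
  have hAt : ∀ j, (A ^ j)ᵀ = A ^ j := fun j => by rw [Matrix.transpose_pow, wishart_transpose]
  have hv : v = ofMat (toMat v) := (ofMat_toMat v).symm
  have key : ∀ j, ⟪ofMat (wishartPow j X), v⟫_ℝ = (toMat v * Xᵀ * A ^ j).trace := fun j => by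
    conv_lhs => rw [hv]
    rw [inner_ofMat, ← Matrix.trace_transpose, Matrix.transpose_mul, Matrix.transpose_transpose,
      wishartPow, Matrix.transpose_mul, hAt, Matrix.mul_assoc]
  have hXX : (N : ℝ)⁻¹ • (X * Xᵀ) = A := rfl
  induction m generalizing l with
  | zero =>
    rw [wishartPowDeriv_zero, real_inner_comm]
    simp
  | succ m ih =>
    rw [wishartPowDeriv_succ, inner_smul_left, inner_add_left, inner_add_left, conj_trivial,
      mul_add, mul_add]
    have t1 : (N : ℝ)⁻¹ * ⟪ofMat (X * (Xᵀ * toMat (wishartPowDeriv m x v))),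
        ofMat (wishartPow l X)⟫_ℝ =
        (2 * m + 1) * ⟪ofMat (wishartPow (m + 1 + l) X), v⟫_ℝ := by
      rw [add_assoc, add_comm 1 l, ← ih (l + 1)]
      conv_rhs => rw [← ofMat_toMat (wishartPowDeriv m x v)]
      rw [inner_ofMat, inner_ofMat, ← Matrix.mul_assoc, ← smul_eq_mul, ← Matrix.trace_smul,
        ← Matrix.smul_mul, ← Matrix.smul_mul, hXX, Matrix.mul_assoc, Matrix.trace_mul_comm,
        Matrix.mul_assoc]
      congr 2
      rw [wishartPow, wishartPow, pow_succ', Matrix.mul_assoc A, Matrix.transpose_mul A,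
        wishart_transpose]
    have t2 : (N : ℝ)⁻¹ * ⟪ofMat (X * ((toMat v)ᵀ * wishartPow m X)),
        ofMat (wishartPow l X)⟫_ℝ = ⟪ofMat (wishartPow (m + 1 + l) X), v⟫_ℝ := by
      rw [key, inner_ofMat, wishartPow, wishartPow, Matrix.transpose_mul, hAt]
      have e1 : X * ((toMat v)ᵀ * (A ^ m * X)) * (Xᵀ * A ^ l) =
          X * (toMat v)ᵀ * (A ^ m * (X * Xᵀ) * A ^ l) := by simp only [Matrix.mul_assoc]
      rw [e1, ← smul_eq_mul, ← Matrix.trace_smul, ← Matrix.mul_smul, ← Matrix.smul_mul,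
        ← Matrix.mul_smul, hXX, ← pow_succ, ← pow_add, ← Matrix.trace_transpose,
        Matrix.transpose_mul, Matrix.transpose_mul, Matrix.transpose_transpose, hAt,
        Matrix.trace_mul_comm]
    have t3 : (N : ℝ)⁻¹ * ⟪ofMat (toMat v * (Xᵀ * wishartPow m X)),
        ofMat (wishartPow l X)⟫_ℝ = ⟪ofMat (wishartPow (m + 1 + l) X), v⟫_ℝ := by
      rw [key, inner_ofMat, wishartPow, wishartPow, Matrix.transpose_mul, hAt]
      have e1 : toMat v * (Xᵀ * (A ^ m * X)) * (Xᵀ * A ^ l) =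
          toMat v * Xᵀ * (A ^ m * (X * Xᵀ) * A ^ l) := by simp only [Matrix.mul_assoc]
      rw [e1, ← smul_eq_mul, ← Matrix.trace_smul, ← Matrix.mul_smul, ← Matrix.smul_mul,
        ← Matrix.mul_smul, hXX, ← pow_succ, ← pow_add]
    rw [t1, t2, t3]
    push_cast
    ring

theorem trace_wishart_pow_succ (m : ℕ) (x : EuclideanSpace ℝ (Fin n × Fin N)) :
    (wishart (toMat x) ^ (m + 1)).trace =
      (N : ℝ)⁻¹ * ⟪ofMat (wishartPow m (toMat x)), x⟫_ℝ := by
  conv_rhs => rw [← ofMat_toMat x, toMat_ofMat]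
  rw [inner_ofMat, wishartPow, Matrix.mul_assoc, ← smul_eq_mul, ← Matrix.trace_smul,
    ← Matrix.mul_smul, pow_succ]
  rfl

theorem hasGradientAt_trace_wishart_pow (m : ℕ) (x : EuclideanSpace ℝ (Fin n × Fin N)) :
    HasGradientAt (fun x : EuclideanSpace ℝ (Fin n × Fin N) =>
      (wishart (toMat x) ^ (m + 1)).trace)
      ((2 * ((m : ℝ) + 1) / N) • ofMat (wishartPow m (toMat x))) x := by
  simp only [trace_wishart_pow_succ]
  rw [hasGradientAt_iff_hasFDerivAt]
  refine (((hasFDerivAt_wishartPow m x).inner ℝ (hasFDerivAt_id x)).const_mul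
    (N : ℝ)⁻¹).congr_fderiv ?_
  ext v
  have h := inner_wishartPowDeriv m 0 x v
  rw [wishartPow_zero, ofMat_toMat, add_zero] at h
  simp [h]
  ring

end Wishart

/-! ### The series of `f₁` and `f₂` -/

section EntireSeries

variable {f : ℂ → ℂ}

theorem summable_norm_entireCoeff (hf : Differentiable ℂ f) {r : ℝ} (hr : 0 ≤ r) :
    Summable fun m => ‖entireCoeff f m‖ * r ^ m := by
  have h := (hasSum_entireCoeff hf (r : ℂ)).summable.norm
  simpa [norm_mul, norm_pow, Complex.norm_real, Real.norm_of_nonneg hr] using h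

theorem hasSum_entireF₁ (hf : Differentiable ℂ f) {r : ℝ} (hr : 0 ≤ r) :
    HasSum (fun m : ℕ => ((m : ℝ) + 1) * ‖entireCoeff f (m + 1)‖ * r ^ m) (entireF₁ f r) := by
  refine Summable.hasSum ?_
  -- The series converges absolutely at every radius; the radius `2(r+1)` absorbs the factor `m+1 ≤
  -- 2^(m+1)`.
  have h := (summable_nat_add_iff 1).2
    (summable_norm_entireCoeff hf (by positivity : 0 ≤ 2 * (r + 1)))
  refine h.of_nonneg_of_le (fun m => by positivity) fun m => ?_
  have h1 : ((m : ℝ) + 1) ≤ 2 ^ (m + 1) := by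
    exact_mod_cast (Nat.lt_two_pow_self (n := m + 1)).le
  have h2 : r ^ m ≤ (r + 1) ^ (m + 1) :=
    (pow_le_pow_left₀ hr (by linarith) m).trans (pow_le_pow_right₀ (by linarith) (by omega))
  rw [mul_pow]
  calc ((m : ℝ) + 1) * ‖entireCoeff f (m + 1)‖ * r ^ m
      ≤ 2 ^ (m + 1) * ‖entireCoeff f (m + 1)‖ * (r + 1) ^ (m + 1) := by gcongr
    _ = _ := by ring

theorem hasSum_entireF₂ (hf : Differentiable ℂ f) {r : ℝ} (hr : 0 ≤ r) :
    HasSum (fun m : ℕ => ((m : ℝ) + 2) * ((m : ℝ) + 1) * ‖entireCoeff f (m + 2)‖ * r ^ m)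
      (entireF₂ f r) := by
  refine Summable.hasSum ?_
  have h := (summable_nat_add_iff 2).2
    (summable_norm_entireCoeff hf (by positivity : 0 ≤ 2 * 2 * (r + 1)))
  refine h.of_nonneg_of_le (fun m => by positivity) fun m => ?_
  have h1 : ((m : ℝ) + 2) ≤ 2 ^ (m + 2) := by
    exact_mod_cast (Nat.lt_two_pow_self (n := m + 2)).le
  have h2 : r ^ m ≤ (r + 1) ^ (m + 2) :=
    (pow_le_pow_left₀ hr (by linarith) m).trans (pow_le_pow_right₀ (by linarith) (by omega))
  rw [mul_pow, mul_pow]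
  calc ((m : ℝ) + 2) * ((m : ℝ) + 1) * ‖entireCoeff f (m + 2)‖ * r ^ m
      ≤ 2 ^ (m + 2) * 2 ^ (m + 2) * ‖entireCoeff f (m + 2)‖ * (r + 1) ^ (m + 2) := by
        gcongr; linarith
    _ = _ := by ring

theorem entireF₁_nonneg (f : ℂ → ℂ) {r : ℝ} (hr : 0 ≤ r) : 0 ≤ entireF₁ f r :=
  tsum_nonneg fun m => by positivity

theorem entireF₂_nonneg (f : ℂ → ℂ) {r : ℝ} (hr : 0 ≤ r) : 0 ≤ entireF₂ f r :=
  tsum_nonneg fun m => by positivity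

/-- A shift of index: the term `m = 0` vanishes. It lines up the series of `r f₂` with that of `f₁`.
-/
theorem hasSum_mul_entireF₂ (hf : Differentiable ℂ f) {r : ℝ} (hr : 0 ≤ r) :
    HasSum (fun m : ℕ => ((m : ℝ) + 1) * m * ‖entireCoeff f (m + 1)‖ * r ^ m)
      (r * entireF₂ f r) := by
  rw [← hasSum_nat_add_iff' 1]
  simp only [Finset.range_one, Finset.sum_singleton, Nat.cast_zero, mul_zero, zero_mul, sub_zero]
  refine ((hasSum_entireF₂ hf hr).mul_left r).congr_fun fun m => ?_
  push_cast
  ring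

/-- From `(m+1)(2m+1) = (m+1) + 2(m+1)m`; this is where the combination of `f₁` and `f₂` in `b`
originates. -/
theorem hasSum_hessian_bound (hf : Differentiable ℂ f) {r : ℝ} (hr : 0 ≤ r) (c : ℝ) :
    HasSum (fun m : ℕ => c * ((m : ℝ) + 1) * ‖entireCoeff f (m + 1)‖ * ((2 * m + 1) * r ^ m))
      (c * (entireF₁ f r + 2 * (r * entireF₂ f r))) := by
  refine (((hasSum_entireF₁ hf hr).add
    ((hasSum_mul_entireF₂ hf hr).mul_left 2)).mul_left c).congr_fun fun m => ?_
  ring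

theorem measurable_comp_tsum {α : Type*} [MeasurableSpace α] {ρ : α → ℝ} (hρ : Measurable ρ)
    {c : ℕ → ℝ} {F : ℝ → ℝ} (h : ∀ x, HasSum (fun m => c m * ρ x ^ m) (F (ρ x))) :
    Measurable fun x => F (ρ x) :=
  measurable_of_tendsto_metrizable
    (f := fun (k : ℕ) x => ∑ m ∈ Finset.range k, c m * ρ x ^ m) (fun k => by fun_prop)
    (tendsto_pi_nhds.2 fun x => (h x).tendsto_sum_nat)

end EntireSeries

/-! ### The statistic, its gradient and its Hessian -/

section SpectralFunction

open scoped Matrix.Norms.L2Operator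

variable {n N : ℕ} {f : ℂ → ℂ}

/-- The statistic `Re Tr f(A)` as a function of the data matrix. -/
noncomputable def spectralFun (f : ℂ → ℂ) (x : EuclideanSpace ℝ (Fin n × Fin N)) : ℝ :=
  (entireMatrix f ((wishart (toMat x)).map Complex.ofReal)).trace.re

/-- The coefficients in the series of the gradient of `spectralFun`. -/
noncomputable def gradientCoeff (f : ℂ → ℂ) (N m : ℕ) : ℝ :=
  (entireCoeff f (m + 1)).re * (2 * ((m : ℝ) + 1) / N)

/-- The gradient of `spectralFun`. -/
noncomputable def spectralGradient (f : ℂ → ℂ) (x : EuclideanSpace ℝ (Fin n × Fin N)) :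
    EuclideanSpace ℝ (Fin n × Fin N) :=
  ∑' m, gradientCoeff f N m • ofMat (wishartPow m (toMat x))

/-- The Hessian of `spectralFun`. -/
noncomputable def spectralHessian (f : ℂ → ℂ) (x : EuclideanSpace ℝ (Fin n × Fin N)) :
    EuclideanSpace ℝ (Fin n × Fin N) →L[ℝ] EuclideanSpace ℝ (Fin n × Fin N) :=
  ∑' m, gradientCoeff f N m • wishartPowDeriv m x

/-- The matrix is real, so the traces of its powers are real and only the real parts of the
coefficients survive. -/
theorem hasSum_spectralFun (hf : Differentiable ℂ f) (x : EuclideanSpace ℝ (Fin n × Fin N)) :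
    HasSum (fun m => (entireCoeff f m).re * (wishart (toMat x) ^ m).trace) (spectralFun f x) := by
  have h := hasSum_entireMatrix hf ((wishart (toMat x)).map Complex.ofReal)
  let T : Matrix (Fin n) (Fin n) ℂ →+ ℝ :=
    Complex.reAddGroupHom.comp (Matrix.traceAddMonoidHom (Fin n) ℂ)
  have hT : Continuous T := Complex.continuous_re.comp continuous_id.matrix_trace
  refine (h.map T hT).congr_fun fun m => ?_
  change _ = (Matrix.trace (entireCoeff f m • (wishart (toMat x)).map Complex.ofReal ^ m)).re
  have e : (wishart (toMat x)).map Complex.ofReal ^ m =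
      (wishart (toMat x) ^ m).map Complex.ofReal :=
    (map_pow (Complex.ofRealHom.mapMatrix (m := Fin n)) (wishart (toMat x)) m).symm
  have e2 : ((wishart (toMat x) ^ m).map Complex.ofReal).trace =
      (((wishart (toMat x) ^ m).trace : ℝ) : ℂ) :=
    (AddMonoidHom.map_trace Complex.ofRealHom _).symm
  rw [e, Matrix.trace_smul, e2, smul_eq_mul, Complex.re_mul_ofReal]

theorem abs_gradientCoeff_le (f : ℂ → ℂ) (N m : ℕ) :
    |gradientCoeff f N m| ≤ 2 / N * ((m : ℝ) + 1) * ‖entireCoeff f (m + 1)‖ := by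
  rw [gradientCoeff, abs_mul, abs_of_nonneg (by positivity : 0 ≤ 2 * ((m : ℝ) + 1) / N)]
  refine (mul_le_mul_of_nonneg_right (Complex.abs_re_le_norm _) (by positivity)).trans
    (le_of_eq ?_)
  ring

theorem norm_toMat_le (x : EuclideanSpace ℝ (Fin n × Fin N)) : ‖toMat x‖ ≤ ‖x‖ := by
  simpa using norm_le_norm_ofMat (toMat x)

theorem norm_gradientCoeff_smul_le (f : ℂ → ℂ) (m : ℕ) (x : EuclideanSpace ℝ (Fin n × Fin N)) :
    ‖gradientCoeff f N m • ofMat (wishartPow m (toMat x))‖ ≤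
      2 / N * (((m : ℝ) + 1) * ‖entireCoeff f (m + 1)‖ * (‖toMat x‖ ^ 2 / N) ^ m) * ‖x‖ := by
  rw [norm_smul]
  have h := norm_ofMat_wishartPow_le m (toMat x)
  rw [ofMat_toMat] at h
  calc ‖gradientCoeff f N m‖ * ‖ofMat (wishartPow m (toMat x))‖
      ≤ (2 / N * ((m : ℝ) + 1) * ‖entireCoeff f (m + 1)‖) *
        ((‖toMat x‖ ^ 2 / N) ^ m * ‖x‖) :=
        mul_le_mul (abs_gradientCoeff_le f N m) h (norm_nonneg _) (by positivity)
    _ = _ := by ring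

theorem norm_gradientCoeff_smul_deriv_le (f : ℂ → ℂ) (m : ℕ)
    (x : EuclideanSpace ℝ (Fin n × Fin N)) :
    ‖gradientCoeff f N m • wishartPowDeriv m x‖ ≤
      2 / N * ((m : ℝ) + 1) * ‖entireCoeff f (m + 1)‖ *
        ((2 * m + 1) * (‖toMat x‖ ^ 2 / N) ^ m) := by
  rw [norm_smul]
  have h : ‖wishartPowDeriv m x‖ ≤ (2 * m + 1) * (‖toMat x‖ ^ 2 / N) ^ m :=
    ContinuousLinearMap.opNorm_le_bound _ (by positivity) fun v => norm_wishartPowDeriv_le m x v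
  exact mul_le_mul (abs_gradientCoeff_le f N m) h (norm_nonneg _) (by positivity)

theorem ratio_le_of_mem_ball {x : EuclideanSpace ℝ (Fin n × Fin N)} {R : ℝ}
    (hx : x ∈ Metric.ball 0 R) : ‖toMat x‖ ^ 2 / N ≤ R ^ 2 / N := by
  rw [mem_ball_zero_iff] at hx
  have := (norm_toMat_le x).trans hx.le
  gcongr

theorem summable_gradient_bound (hf : Differentiable ℂ f) (N : ℕ) (R : ℝ) :
    Summable fun m : ℕ => 2 / (N : ℝ) *
      (((m : ℝ) + 1) * ‖entireCoeff f (m + 1)‖ * (R ^ 2 / N) ^ m) * R :=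
  (((hasSum_entireF₁ hf (by positivity)).summable.mul_left _).mul_right _)

theorem gradient_bound_of_mem_ball (f : ℂ → ℂ) {x : EuclideanSpace ℝ (Fin n × Fin N)} {R : ℝ}
    (hx : x ∈ Metric.ball 0 R) (m : ℕ) :
    ‖gradientCoeff f N m • ofMat (wishartPow m (toMat x))‖ ≤
      2 / (N : ℝ) * (((m : ℝ) + 1) * ‖entireCoeff f (m + 1)‖ * (R ^ 2 / N) ^ m) * R := by
  refine (norm_gradientCoeff_smul_le f m x).trans ?_
  have h1 := ratio_le_of_mem_ball hx
  have h2 : ‖x‖ ≤ R := (mem_ball_zero_iff.1 hx).le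
  gcongr

theorem hessian_bound_of_mem_ball (f : ℂ → ℂ) {x : EuclideanSpace ℝ (Fin n × Fin N)} {R : ℝ}
    (hx : x ∈ Metric.ball 0 R) (m : ℕ) :
    ‖gradientCoeff f N m • wishartPowDeriv m x‖ ≤
      2 / N * ((m : ℝ) + 1) * ‖entireCoeff f (m + 1)‖ * ((2 * m + 1) * (R ^ 2 / N) ^ m) := by
  refine (norm_gradientCoeff_smul_deriv_le f m x).trans ?_
  have h1 := ratio_le_of_mem_ball hx
  gcongr

theorem mem_ball_norm_add_one {E : Type*} [NormedAddCommGroup E] (x : E) :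
    x ∈ Metric.ball (0 : E) (‖x‖ + 1) := by
  rw [mem_ball_zero_iff]; linarith

/-- Termwise differentiation on a ball containing `x`, where the gradients are uniformly summable.
The constant term of the series is split off, since the gradients are indexed from the first power
on. -/
theorem hasGradientAt_spectralFun (hf : Differentiable ℂ f)
    (x : EuclideanSpace ℝ (Fin n × Fin N)) :
    HasGradientAt (spectralFun f) (spectralGradient f x) x := by
  set R := ‖x‖ + 1
  have hs := fun y : EuclideanSpace ℝ (Fin n × Fin N) =>
    (hasSum_nat_add_iff' 1).2 (hasSum_spectralFun hf y)
  let D := InnerProductSpace.toDual ℝ (EuclideanSpace ℝ (Fin n × Fin N))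
  have key := hasFDerivAt_tsum_of_isPreconnected (summable_gradient_bound hf N R)
    (Metric.isOpen_ball (x := (0 : EuclideanSpace ℝ (Fin n × Fin N))) (ε := R))
    (convex_ball _ _).isPreconnected
    (f := fun m (y : EuclideanSpace ℝ (Fin n × Fin N)) =>
      (entireCoeff f (m + 1)).re * (wishart (toMat y) ^ (m + 1)).trace)
    (f' := fun m y => D (gradientCoeff f N m • ofMat (wishartPow m (toMat y))))
    (fun m y _ => by
      refine ((hasGradientAt_trace_wishart_pow m y).hasFDerivAt.const_mul _).congr_fderiv ?_
      rw [gradientCoeff, ← smul_smul]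
      exact (map_smulₛₗ D _ _).symm)
    (fun m y hy => by
      rw [LinearIsometryEquiv.norm_map]
      exact gradient_bound_of_mem_ball f hy m)
    (mem_ball_norm_add_one x) (hs x).summable (mem_ball_norm_add_one x)
  rw [hasGradientAt_iff_hasFDerivAt]
  have e : spectralFun f = fun y : EuclideanSpace ℝ (Fin n × Fin N) =>
      ∑' m, (entireCoeff f (m + 1)).re * (wishart (toMat y) ^ (m + 1)).trace +
        (entireCoeff f 0).re * n := by
    ext y
    rw [(hs y).tsum_eq]
    simp
  rw [e]
  refine (key.add_const ((entireCoeff f 0).re * n)).congr_fderiv ?_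
  exact (D.toContinuousLinearEquiv.map_tsum).symm

theorem hasFDerivAt_spectralGradient (hf : Differentiable ℂ f)
    (x : EuclideanSpace ℝ (Fin n × Fin N)) :
    HasFDerivAt (spectralGradient f) (spectralHessian f x) x := by
  set R := ‖x‖ + 1
  refine hasFDerivAt_tsum_of_isPreconnected
    (hasSum_hessian_bound hf (by positivity : 0 ≤ R ^ 2 / N) (2 / N)).summable
    (Metric.isOpen_ball (x := (0 : EuclideanSpace ℝ (Fin n × Fin N))) (ε := R))
    (convex_ball _ _).isPreconnected
    (fun m y _ => (hasFDerivAt_wishartPow m y).const_smul (gradientCoeff f N m))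
    (fun m y hy => hessian_bound_of_mem_ball f hy m)
    (mem_ball_norm_add_one x) ?_ (mem_ball_norm_add_one x)
  exact (summable_gradient_bound hf N R).of_norm_bounded
    (gradient_bound_of_mem_ball f (mem_ball_norm_add_one x))

theorem continuous_spectralHessian (hf : Differentiable ℂ f) :
    Continuous (spectralHessian f (n := n) (N := N)) := by
  rw [continuous_iff_continuousAt]
  intro x
  set R := ‖x‖ + 1
  have h : ContinuousOn (spectralHessian f (n := n) (N := N)) (Metric.ball 0 R) :=
    continuousOn_tsum
      (fun m => ((continuous_wishartPowDeriv m).const_smul (gradientCoeff f N m)).continuousOn)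
      (hasSum_hessian_bound hf (by positivity : 0 ≤ R ^ 2 / N) (2 / N)).summable
      (fun m y hy => hessian_bound_of_mem_ball f hy m)
  exact h.continuousAt (Metric.isOpen_ball.mem_nhds (mem_ball_norm_add_one x))

theorem norm_spectralHessian_le (hf : Differentiable ℂ f)
    (x : EuclideanSpace ℝ (Fin n × Fin N)) :
    ‖spectralHessian f x‖ ≤ 2 / N * (entireF₁ f (‖toMat x‖ ^ 2 / N) +
      2 * (‖toMat x‖ ^ 2 / N * entireF₂ f (‖toMat x‖ ^ 2 / N))) :=
  tsum_of_norm_bounded (hasSum_hessian_bound hf (by positivity) _)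
    fun m => norm_gradientCoeff_smul_deriv_le f m x

theorem summable_spectralGradient (hf : Differentiable ℂ f)
    (x : EuclideanSpace ℝ (Fin n × Fin N)) :
    Summable fun m => gradientCoeff f N m • ofMat (wishartPow m (toMat x)) :=
  (summable_gradient_bound hf N (‖x‖ + 1)).of_norm_bounded
    (gradient_bound_of_mem_ball f (mem_ball_norm_add_one x))

/-- The `i`-th row of a matrix. -/
noncomputable def rowL (i : Fin n) :
    EuclideanSpace ℝ (Fin n × Fin N) →L[ℝ] EuclideanSpace ℝ (Fin N) :=
  LinearMap.toContinuousLinearMap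
    { toFun := fun x => WithLp.toLp 2 fun j => x (i, j)
      map_add' := fun _ _ => rfl
      map_smul' := fun _ _ => rfl }

@[simp]
theorem rowL_apply (i : Fin n) (x : EuclideanSpace ℝ (Fin n × Fin N)) (j : Fin N) :
    rowL i x j = x (i, j) := rfl

theorem norm_rowL_ofMat_le (M : Matrix (Fin n) (Fin N) ℝ) (i : Fin n) :
    ‖rowL i (ofMat M)‖ ≤ ‖M‖ := by
  rw [← sq_le_sq₀ (norm_nonneg _) (norm_nonneg _), EuclideanSpace.norm_sq_eq]
  simpa using sum_sq_row_le M i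

/-- Each row of `A^m X` is at most its operator norm, hence at most `λ^m ‖X‖`. -/
theorem norm_row_spectralGradient_le (hf : Differentiable ℂ f)
    (x : EuclideanSpace ℝ (Fin n × Fin N)) (i : Fin n) :
    ‖rowL i (spectralGradient f x)‖ ≤
      2 / N * entireF₁ f (‖toMat x‖ ^ 2 / N) * ‖toMat x‖ := by
  rw [spectralGradient, (rowL i).map_tsum (summable_spectralGradient hf x)]
  refine tsum_of_norm_bounded (((hasSum_entireF₁ hf (by positivity)).mul_left (2 / (N : ℝ))).mul_right
    ‖toMat x‖) fun m => ?_
  rw [map_smul, norm_smul]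
  calc ‖gradientCoeff f N m‖ * ‖rowL i (ofMat (wishartPow m (toMat x)))‖
      ≤ (2 / N * ((m : ℝ) + 1) * ‖entireCoeff f (m + 1)‖) *
        ((‖toMat x‖ ^ 2 / N) ^ m * ‖toMat x‖) :=
        mul_le_mul (abs_gradientCoeff_le f N m)
          ((norm_rowL_ofMat_le _ i).trans (norm_wishartPow_le m _)) (norm_nonneg _) (by positivity)
    _ = _ := by ring

/-- The bound on the rows of the gradient. -/
noncomputable def rowBound (f : ℂ → ℂ) (x : EuclideanSpace ℝ (Fin n × Fin N)) : ℝ :=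
  2 / N * entireF₁ f (‖toMat x‖ ^ 2 / N) * ‖toMat x‖

theorem rowBound_nonneg (f : ℂ → ℂ) (x : EuclideanSpace ℝ (Fin n × Fin N)) :
    0 ≤ rowBound f x := by
  have := entireF₁_nonneg f (by positivity : 0 ≤ ‖toMat x‖ ^ 2 / N)
  unfold rowBound; positivity

theorem sum_sq_row_spectralGradient_le (hf : Differentiable ℂ f)
    (x : EuclideanSpace ℝ (Fin n × Fin N)) (i : Fin n) :
    ∑ j, spectralGradient f x (i, j) ^ 2 ≤ rowBound f x ^ 2 := by
  have h := pow_le_pow_left₀ (norm_nonneg _) (norm_row_spectralGradient_le hf x i) 2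
  rw [EuclideanSpace.norm_sq_eq] at h
  simpa [rowBound] using h

theorem norm_spectralGradient_le (hf : Differentiable ℂ f)
    (x : EuclideanSpace ℝ (Fin n × Fin N)) : ‖spectralGradient f x‖ ≤ √n * rowBound f x := by
  rw [← sq_le_sq₀ (norm_nonneg _) (mul_nonneg (Real.sqrt_nonneg _) (rowBound_nonneg f x)), mul_pow,
    Real.sq_sqrt (Nat.cast_nonneg n), EuclideanSpace.norm_sq_eq, Fintype.sum_prod_type]
  simp only [Real.norm_eq_abs, sq_abs]
  refine (Finset.sum_le_sum fun i _ => sum_sq_row_spectralGradient_le hf x i).trans ?_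
  simp

/-- On each row the `ℓ⁴` norm is at most the `ℓ²` norm, and there are `n` rows. -/
theorem sum_pow_four_spectralGradient_le (hf : Differentiable ℂ f)
    (x : EuclideanSpace ℝ (Fin n × Fin N)) :
    ∑ p, spectralGradient f x p ^ 4 ≤ n * rowBound f x ^ 4 := by
  rw [Fintype.sum_prod_type]
  have h : ∀ i, ∑ j, spectralGradient f x (i, j) ^ 4 ≤ rowBound f x ^ 4 := fun i => by
    have h1 := sum_sq_row_spectralGradient_le hf x i
    have h2 : ∑ j, spectralGradient f x (i, j) ^ 4 ≤
        (∑ j, spectralGradient f x (i, j) ^ 2) ^ 2 := by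
      rw [sq, Finset.sum_mul]
      refine Finset.sum_le_sum fun j _ => ?_
      have : spectralGradient f x (i, j) ^ 2 ≤ ∑ j, spectralGradient f x (i, j) ^ 2 :=
        Finset.single_le_sum (f := fun j => spectralGradient f x (i, j) ^ 2)
          (fun j _ => sq_nonneg _) (Finset.mem_univ j)
      nlinarith [sq_nonneg (spectralGradient f x (i, j))]
    refine h2.trans ((pow_le_pow_left₀ (Finset.sum_nonneg fun j _ => sq_nonneg _) h1 2).trans
      (le_of_eq ?_))
    ring
  refine (Finset.sum_le_sum fun i _ => h i).trans ?_
  simp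

end SpectralFunction


/-! ### Moment bounds for the interpolated pair -/

section LpBounds

theorem eLpNorm_two_sq {α F : Type*} [MeasurableSpace α] [NormedAddCommGroup F] (f : α → F)
    (μ : Measure α) : eLpNorm f 2 μ ^ 2 = ∫⁻ x, ‖f x‖ₑ ^ 2 ∂μ := by
  have h := eLpNorm_nnreal_pow_eq_lintegral (f := f) (μ := μ) (p := 2) (by norm_num)
  simpa using h

theorem eLpNorm_four_pow {α F : Type*} [MeasurableSpace α] [NormedAddCommGroup F] (f : α → F)
    (μ : Measure α) : eLpNorm f 4 μ ^ 4 = ∫⁻ x, ‖f x‖ₑ ^ 4 ∂μ := by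
  have h := eLpNorm_nnreal_pow_eq_lintegral (f := f) (μ := μ) (p := 4) (by norm_num)
  have e : ((4 : ℝ≥0) : ℝ) = ((4 : ℕ) : ℝ) := by norm_num
  simp only [e, ENNReal.rpow_natCast] at h
  simpa using h

theorem holderTriple_four_four_two : ENNReal.HolderTriple 4 4 2 where
  inv_add_inv_eq_inv := by
    have h : (4 : ℝ≥0∞) = 2 * 2 := by norm_num
    rw [h, ENNReal.mul_inv (by simp) (by simp), ← mul_add, ENNReal.inv_two_add_inv_two, mul_one]

theorem eLpNorm_mul_le {α : Type*} [MeasurableSpace α] {μ : Measure α} {φ ψ : α → ℝ}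
    (hφ : AEStronglyMeasurable φ μ) (hψ : AEStronglyMeasurable ψ μ) :
    eLpNorm (fun x => φ x * ψ x) 2 μ ≤ eLpNorm φ 4 μ * eLpNorm ψ 4 μ := by
  have h := eLpNorm_smul_le_mul_eLpNorm (hpqr := holderTriple_four_four_two) hψ hφ
  exact h

variable {E : Type*} [NormedAddCommGroup E] [InnerProductSpace ℝ E] [FiniteDimensional ℝ E]
  [MeasurableSpace E] [BorelSpace E] [SecondCountableTopology E]

theorem integral_norm_sq_le_of_eLpNorm_le {α F : Type*} [MeasurableSpace α] [NormedAddCommGroup F]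
    {f : α → F} {μ : Measure α} (hf : AEStronglyMeasurable f μ) {K : ℝ≥0∞} (hK : K ≠ ⊤)
    (h : eLpNorm f 2 μ ≤ K) : ∫ x, ‖f x‖ ^ 2 ∂μ ≤ K.toReal ^ 2 := by
  rw [integral_eq_lintegral_of_nonneg_ae (ae_of_all _ fun _ => sq_nonneg _) (hf.norm.pow 2),
    ← ENNReal.toReal_pow]
  refine ENNReal.toReal_mono (ENNReal.pow_ne_top hK) ?_
  calc ∫⁻ x, ENNReal.ofReal (‖f x‖ ^ 2) ∂μ = eLpNorm f 2 μ ^ 2 := by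
        rw [eLpNorm_two_sq]
        simp [ENNReal.ofReal_pow]
    _ ≤ K ^ 2 := by gcongr

theorem measurePreserving_rotate (θ : ℝ) :
    MeasurePreserving (rotate θ) ((stdGaussian E).prod (stdGaussian E)) (stdGaussian E) :=
  ⟨by fun_prop, map_rotate_eq_stdGaussian θ⟩

theorem tvDist_map_stdGaussian_le_of_eLpNorm_le {G : E → ℝ} {G' : E → E} {H : E → E →L[ℝ] E}
    {K : ℝ≥0∞}
    (hG : ∀ x, HasGradientAt G (G' x) x) (hG' : ∀ x, HasFDerivAt G' (H x) x) (hH : Continuous H)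
    (hG4 : MemLp G 4 (stdGaussian E)) (hG4' : MemLp G' 4 (stdGaussian E))
    (hH4 : MemLp H 4 (stdGaussian E)) (hK' : K ≠ ⊤)
    (hK : ∀ θ, eLpNorm (fun p : E × E => ContinuousLinearMap.adjoint (H p.1) (G' (rotate θ p))) 2
      ((stdGaussian E).prod (stdGaussian E)) ≤ K)
    (hv : 0 < Var[G; stdGaussian E]) :
    tvDist ((stdGaussian E).map G)
      (gaussianReal (∫ x, G x ∂stdGaussian E) (Var[G; stdGaussian E]).toNNReal) ≤
        4 * K / ENNReal.ofReal Var[G; stdGaussian E] := by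
  have hGc : Continuous G' := continuous_iff_continuousAt.2 fun x => (hG' x).continuousAt
  refine (tvDist_map_stdGaussian_le hG hG' hH hG4 hG4' hH4 ENNReal.toReal_nonneg (K := K.toReal)
    (fun θ => integral_norm_sq_le_of_eLpNorm_le ?_ hK' (hK θ)) hv).trans_eq ?_
  · exact (continuous_adjoint_apply (by fun_prop) (by fun_prop)).aestronglyMeasurable
  · rw [ENNReal.ofReal_div_of_pos hv, ENNReal.ofReal_mul (by norm_num), ENNReal.ofReal_toReal hK']
    norm_num

/-- `x` and `x_θ` have the same law, so the two halves add up to `m` times one fourth moment. The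
estimate is meaningful even when that moment is infinite. -/
theorem eLpNorm_le_of_sq_le_rotate {S : E × E → ℝ} {α : E → ℝ} {m : ℝ≥0} (hα : Measurable α)
    (θ : ℝ) (h : ∀ p, S p ^ 2 ≤ m / 2 * (α p.1 ^ 4 + α (rotate θ p) ^ 4)) :
    eLpNorm S 2 ((stdGaussian E).prod (stdGaussian E)) ≤
      (m : ℝ≥0∞) ^ (1 / 2 : ℝ) * eLpNorm α 4 (stdGaussian E) ^ 2 := by
  rw [← (ENNReal.pow_right_strictMono two_ne_zero).le_iff_le]
  have hm : ((m : ℝ≥0∞) ^ (1 / 2 : ℝ)) ^ 2 = m := by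
    rw [← ENNReal.rpow_natCast, ← ENNReal.rpow_mul]; norm_num
  simp only [mul_pow, hm, ← pow_mul]
  norm_num only
  rw [eLpNorm_two_sq, eLpNorm_four_pow]
  have hmeas : Measurable fun x => ‖α x‖ₑ ^ 4 := by fun_prop
  have h1 : ∫⁻ p : E × E, ‖α p.1‖ₑ ^ 4 ∂((stdGaussian E).prod (stdGaussian E)) =
      ∫⁻ x, ‖α x‖ₑ ^ 4 ∂stdGaussian E :=
    (measurePreserving_fst (μ := stdGaussian E) (ν := stdGaussian E)).lintegral_comp hmeas
  have h2 : ∫⁻ p : E × E, ‖α (rotate θ p)‖ₑ ^ 4 ∂((stdGaussian E).prod (stdGaussian E)) =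
      ∫⁻ x, ‖α x‖ₑ ^ 4 ∂stdGaussian E :=
    (measurePreserving_rotate θ).lintegral_comp hmeas
  have key (p : E × E) : ‖S p‖ₑ ^ 2 ≤
      (m / 2 : ℝ≥0) * (‖α p.1‖ₑ ^ 4 + ‖α (rotate θ p)‖ₑ ^ 4) := by
    simp only [enorm_eq_nnnorm, ← ENNReal.coe_pow, ← ENNReal.coe_add, ← ENNReal.coe_mul,
      ENNReal.coe_le_coe, ← NNReal.coe_le_coe]
    push_cast
    simpa [(show Even 4 by decide).pow_abs] using h p
  refine (lintegral_mono key).trans_eq ?_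
  rw [lintegral_const_mul _ (by fun_prop), lintegral_add_left (by fun_prop), h1, h2, ← two_mul,
    ← mul_assoc]
  congr 1
  rw [← ENNReal.coe_ofNat, ← ENNReal.coe_mul, div_mul_cancel₀ _ two_ne_zero]

theorem eLpNorm_mul_rotate_le {α β : E → ℝ} (hα : Measurable α) (hβ : Measurable β) (θ : ℝ) :
    eLpNorm (fun p : E × E => β p.1 * α (rotate θ p)) 2 ((stdGaussian E).prod (stdGaussian E)) ≤
      eLpNorm β 4 (stdGaussian E) * eLpNorm α 4 (stdGaussian E) := by
  have h1 : eLpNorm (fun p : E × E => β p.1) 4 ((stdGaussian E).prod (stdGaussian E)) =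
      eLpNorm β 4 (stdGaussian E) :=
    eLpNorm_comp_measurePreserving (g := β) hβ.aestronglyMeasurable
      (measurePreserving_fst (μ := stdGaussian E) (ν := stdGaussian E))
  have h2 : eLpNorm (fun p : E × E => α (rotate θ p)) 4 ((stdGaussian E).prod (stdGaussian E)) =
      eLpNorm α 4 (stdGaussian E) :=
    eLpNorm_comp_measurePreserving (g := α) hα.aestronglyMeasurable (measurePreserving_rotate θ)
  rw [← h1, ← h2]
  have hα' : AEStronglyMeasurable (fun p : E × E => α (rotate θ p))
      ((stdGaussian E).prod (stdGaussian E)) :=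
    (hα.comp (by fun_prop : Measurable (rotate θ))).aestronglyMeasurable
  have hβ' : AEStronglyMeasurable (fun p : E × E => β p.1)
      ((stdGaussian E).prod (stdGaussian E)) := (hβ.comp measurable_fst).aestronglyMeasurable
  exact eLpNorm_mul_le hβ' hα'

end LpBounds

theorem isOpenPosMeasure_stdGaussian (ι : Type*) [Fintype ι] :
    (stdGaussian (EuclideanSpace ℝ ι)).IsOpenPosMeasure := by
  have h1 : (gaussianReal 0 1).IsOpenPosMeasure :=
    (gaussianReal_absolutelyContinuous' 0 one_ne_zero).isOpenPosMeasure
  rw [← map_pi_eq_stdGaussian]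
  exact (PiLp.continuous_toLp 2 _).isOpenPosMeasure_map (WithLp.toLp_surjective 2)

/-- The Gaussian law charges every open set, so a continuous gradient that vanishes almost
everywhere vanishes identically. Used to exclude products `0 * ⊤` in the final bound. -/
theorem variance_eq_zero_of_gradient_ae_eq_zero {ι : Type*} [Fintype ι]
    {G : EuclideanSpace ℝ ι → ℝ} {G' : EuclideanSpace ℝ ι → EuclideanSpace ℝ ι}
    (hG : ∀ x, HasGradientAt G (G' x) x) (hG' : Continuous G')
    (h : G' =ᵐ[stdGaussian (EuclideanSpace ℝ ι)] 0) :
    Var[G; stdGaussian (EuclideanSpace ℝ ι)] = 0 := by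
  have := isOpenPosMeasure_stdGaussian ι
  have h0 : G' = 0 := (hG'.ae_eq_iff_eq _ continuous_const).1 h
  have hc (x) : G x = G 0 := by
    refine is_const_of_fderiv_eq_zero (𝕜 := ℝ) (fun y => (hG y).hasFDerivAt.differentiableAt)
      (fun y => ?_) x 0
    rw [(hG y).hasFDerivAt.fderiv, h0]
    simp
  have : G = fun _ => G 0 := funext hc
  rw [this]
  simp [variance, evariance]


/-! ### The statistic after a change of variables -/

section Composition

open scoped Matrix.Norms.L2Operator

variable {n N : ℕ} {f : ℂ → ℂ}

theorem continuous_norm_toMat :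
    Continuous fun x : EuclideanSpace ℝ (Fin n × Fin N) => ‖toMat x‖ := by
  refine (LipschitzWith.of_dist_le_mul (K := 1) fun x y => ?_).continuous
  rw [Real.dist_eq, dist_eq_norm, NNReal.coe_one, one_mul]
  refine (abs_norm_sub_norm_le _ _).trans ?_
  rw [← map_sub]
  exact norm_toMat_le _

/-- The largest eigenvalue of the Wishart matrix, as a function of the entries of the data. -/
noncomputable def topEigenvalue (x : EuclideanSpace ℝ (Fin n × Fin N)) : ℝ := ‖toMat x‖ ^ 2 / N

theorem topEigenvalue_nonneg (x : EuclideanSpace ℝ (Fin n × Fin N)) : 0 ≤ topEigenvalue x := by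
  unfold topEigenvalue; positivity

theorem measurable_topEigenvalue :
    Measurable (topEigenvalue : EuclideanSpace ℝ (Fin n × Fin N) → ℝ) :=
  ((continuous_norm_toMat.pow 2).div_const _).measurable

theorem measurable_entireF₁_topEigenvalue (hf : Differentiable ℂ f) :
    Measurable fun x : EuclideanSpace ℝ (Fin n × Fin N) => entireF₁ f (topEigenvalue x) :=
  measurable_comp_tsum measurable_topEigenvalue
    fun x => hasSum_entireF₁ hf (topEigenvalue_nonneg x)

theorem measurable_entireF₂_topEigenvalue (hf : Differentiable ℂ f) :
    Measurable fun x : EuclideanSpace ℝ (Fin n × Fin N) => entireF₂ f (topEigenvalue x) :=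
  measurable_comp_tsum measurable_topEigenvalue
    fun x => hasSum_entireF₂ hf (topEigenvalue_nonneg x)

theorem measurable_rowBound (hf : Differentiable ℂ f) :
    Measurable (rowBound f : EuclideanSpace ℝ (Fin n × Fin N) → ℝ) :=
  ((measurable_entireF₁_topEigenvalue hf).const_mul _).mul continuous_norm_toMat.measurable

/-- The bound on the operator norm of the Hessian. -/
noncomputable def hessianBound (f : ℂ → ℂ) (x : EuclideanSpace ℝ (Fin n × Fin N)) : ℝ :=
  2 / N * (entireF₁ f (topEigenvalue x) + 2 * (topEigenvalue x * entireF₂ f (topEigenvalue x)))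

theorem hessianBound_nonneg (f : ℂ → ℂ) (x : EuclideanSpace ℝ (Fin n × Fin N)) :
    0 ≤ hessianBound f x := by
  have h1 := entireF₁_nonneg f (topEigenvalue_nonneg x)
  have h2 := entireF₂_nonneg f (topEigenvalue_nonneg x)
  have h3 := topEigenvalue_nonneg x
  unfold hessianBound; positivity

theorem measurable_hessianBound (hf : Differentiable ℂ f) :
    Measurable (hessianBound f : EuclideanSpace ℝ (Fin n × Fin N) → ℝ) :=
  ((measurable_entireF₁_topEigenvalue hf).add ((measurable_topEigenvalue.mul
    (measurable_entireF₂_topEigenvalue hf)).const_mul 2)).const_mul _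

theorem continuous_spectralGradient (hf : Differentiable ℂ f) :
    Continuous (spectralGradient f : EuclideanSpace ℝ (Fin n × Fin N) → _) :=
  continuous_iff_continuousAt.2 fun x => (hasFDerivAt_spectralGradient hf x).continuousAt

theorem enorm_sqrt_natCast (n : ℕ) : ‖√(n : ℝ)‖ₑ = (n : ℝ≥0∞) ^ (1 / 2 : ℝ) := by
  rw [Real.enorm_of_nonneg (Real.sqrt_nonneg _), Real.sqrt_eq_rpow,
    ← ENNReal.ofReal_rpow_of_nonneg (Nat.cast_nonneg n) (by norm_num), ENNReal.ofReal_natCast]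

theorem hasGradientAt_spectralFun_comp (hf : Differentiable ℂ f)
    {U : EuclideanSpace ℝ (Fin n × Fin N) → EuclideanSpace ℝ (Fin n × Fin N)}
    {T : EuclideanSpace ℝ (Fin n × Fin N) →L[ℝ] EuclideanSpace ℝ (Fin n × Fin N)}
    {x : EuclideanSpace ℝ (Fin n × Fin N)} (hU : HasFDerivAt U T x) :
    HasGradientAt (spectralFun f ∘ U)
      (ContinuousLinearMap.adjoint T (spectralGradient f (U x))) x := by
  have h := (hasGradientAt_spectralFun hf (U x)).hasFDerivAt.comp x hU
  rw [hasGradientAt_iff_hasFDerivAt]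
  refine h.congr_fderiv ?_
  ext v
  simp [ContinuousLinearMap.adjoint_inner_left]

theorem sum_sq_mul_sq_le (hf : Differentiable ℂ f) (x y : EuclideanSpace ℝ (Fin n × Fin N)) :
    ∑ p, spectralGradient f x p ^ 2 * spectralGradient f y p ^ 2 ≤
      ((n : ℝ≥0) : ℝ) / 2 * (rowBound f x ^ 4 + rowBound f y ^ 4) := by
  have hx := sum_pow_four_spectralGradient_le hf x
  have hy := sum_pow_four_spectralGradient_le hf y
  calc ∑ p, spectralGradient f x p ^ 2 * spectralGradient f y p ^ 2
      ≤ ∑ p, (spectralGradient f x p ^ 4 + spectralGradient f y p ^ 4) / 2 :=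
        Finset.sum_le_sum fun p _ => by
          nlinarith [sq_nonneg (spectralGradient f x p ^ 2 - spectralGradient f y p ^ 2)]
    _ = ((∑ p, spectralGradient f x p ^ 4) + ∑ p, spectralGradient f y p ^ 4) / 2 := by
        rw [← Finset.sum_div, Finset.sum_add_distrib]
    _ ≤ _ := by
        push_cast
        linarith

/-- The hypotheses on a change of variables `U` with derivative `U'`, and on the derivative `H` of
the gradient of `spectralFun f ∘ U`, under which the second order Poincaré inequality is used. -/
structure IsControlledMap (f : ℂ → ℂ)
    (U : EuclideanSpace ℝ (Fin n × Fin N) → EuclideanSpace ℝ (Fin n × Fin N))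
    (U' H : EuclideanSpace ℝ (Fin n × Fin N) →
      EuclideanSpace ℝ (Fin n × Fin N) →L[ℝ] EuclideanSpace ℝ (Fin n × Fin N))
    (c d : ℝ≥0) : Prop where
  hasFDerivAt : ∀ x, HasFDerivAt U (U' x) x
  norm_deriv_le : ∀ x, ‖U' x‖ ≤ c
  hasFDerivAt_gradient : ∀ x, HasFDerivAt
    (fun y => ContinuousLinearMap.adjoint (U' y) (spectralGradient f (U y))) (H x) x
  continuous_hessian : Continuous H
  norm_hessian_le : ∀ x, ‖H x‖ ≤ c ^ 2 * hessianBound f (U x) + d * ‖spectralGradient f (U x)‖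
  norm_adjoint_le : ∀ x y, ‖ContinuousLinearMap.adjoint (H x)
      (ContinuousLinearMap.adjoint (U' y) (spectralGradient f (U y)))‖ ≤
    c ^ 3 * (hessianBound f (U x) * ‖spectralGradient f (U y)‖) +
      c * d * √(∑ p, spectralGradient f (U x) p ^ 2 * spectralGradient f (U y) p ^ 2)

variable {U : EuclideanSpace ℝ (Fin n × Fin N) → EuclideanSpace ℝ (Fin n × Fin N)}
  {U' H : EuclideanSpace ℝ (Fin n × Fin N) →
    EuclideanSpace ℝ (Fin n × Fin N) →L[ℝ] EuclideanSpace ℝ (Fin n × Fin N)} {c d : ℝ≥0}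

namespace IsControlledMap

theorem continuous (h : IsControlledMap f U U' H c d) : Continuous U :=
  continuous_iff_continuousAt.2 fun x => (h.hasFDerivAt x).continuousAt

theorem continuous_gradient (h : IsControlledMap f U U' H c d) :
    Continuous fun y => ContinuousLinearMap.adjoint (U' y) (spectralGradient f (U y)) :=
  continuous_iff_continuousAt.2 fun x => (h.hasFDerivAt_gradient x).continuousAt

theorem norm_gradient_le (hf : Differentiable ℂ f) (h : IsControlledMap f U U' H c d)
    (x : EuclideanSpace ℝ (Fin n × Fin N)) :
    ‖ContinuousLinearMap.adjoint (U' x) (spectralGradient f (U x))‖ ≤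
      c * (√n * rowBound f (U x)) := by
  refine (ContinuousLinearMap.le_opNorm _ _).trans ?_
  rw [LinearIsometryEquiv.norm_map]
  exact mul_le_mul (h.norm_deriv_le x) (norm_spectralGradient_le hf _) (norm_nonneg _) c.2

/-- The Hessian of `spectralFun f` contributes through Hölder and `‖∇‖ ≤ √n · rowBound`. The second
derivative of `U` contributes through the fourth powers of the gradient entries, whose sum is at
most `n · rowBound⁴`. -/
theorem eLpNorm_adjoint_le (hf : Differentiable ℂ f) (h : IsControlledMap f U U' H c d) (θ : ℝ) :
    eLpNorm (fun p : EuclideanSpace ℝ (Fin n × Fin N) × EuclideanSpace ℝ (Fin n × Fin N) =>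
      ContinuousLinearMap.adjoint (H p.1) (ContinuousLinearMap.adjoint (U' (rotate θ p))
        (spectralGradient f (U (rotate θ p))))) 2 ((stdGaussian _).prod (stdGaussian _)) ≤
    c ^ 3 * (n : ℝ≥0∞) ^ (1 / 2 : ℝ) *
      (eLpNorm (hessianBound f ∘ U) 4 (stdGaussian _) *
        eLpNorm (rowBound f ∘ U) 4 (stdGaussian _)) +
    c * d * ((n : ℝ≥0∞) ^ (1 / 2 : ℝ) * eLpNorm (rowBound f ∘ U) 4 (stdGaussian _) ^ 2) := by
  have hα := (measurable_rowBound hf).comp h.continuous.measurable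
  have hβ := (measurable_hessianBound hf).comp h.continuous.measurable
  have hΓ := (continuous_spectralGradient hf (n := n) (N := N)).comp h.continuous
  let Q₁ : EuclideanSpace ℝ (Fin n × Fin N) × EuclideanSpace ℝ (Fin n × Fin N) → ℝ :=
    fun p => (hessianBound f ∘ U) p.1 * (rowBound f ∘ U) (rotate θ p)
  let Q₂ : EuclideanSpace ℝ (Fin n × Fin N) × EuclideanSpace ℝ (Fin n × Fin N) → ℝ :=
    fun p => √(∑ i, spectralGradient f (U p.1) i ^ 2 * spectralGradient f (U (rotate θ p)) i ^ 2)
  have hQ₁ : Measurable Q₁ := (hβ.comp measurable_fst).mul (hα.comp (by fun_prop))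
  have hQ₂ : Continuous Q₂ := by
    have h1 := hΓ.comp (continuous_fst (X := EuclideanSpace ℝ (Fin n × Fin N))
      (Y := EuclideanSpace ℝ (Fin n × Fin N)))
    have h2 := hΓ.comp (continuous_rotate (E := EuclideanSpace ℝ (Fin n × Fin N)) θ)
    simp only [Function.comp_def] at h1 h2
    fun_prop
  have key : ∀ p : EuclideanSpace ℝ (Fin n × Fin N) × EuclideanSpace ℝ (Fin n × Fin N),
      ‖ContinuousLinearMap.adjoint (H p.1) (ContinuousLinearMap.adjoint (U' (rotate θ p))
        (spectralGradient f (U (rotate θ p))))‖ ≤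
      ((((c : ℝ) ^ 3 * √n) • Q₁) + (((c : ℝ) * d) • Q₂)) p := fun p => by
    refine (h.norm_adjoint_le _ _).trans ?_
    have h1 := mul_le_mul_of_nonneg_left (norm_spectralGradient_le hf (U (rotate θ p)))
      (hessianBound_nonneg f (U p.1))
    have h2 := mul_le_mul_of_nonneg_left h1 (pow_nonneg c.2 3)
    simp only [Pi.add_apply, Pi.smul_apply, smul_eq_mul, Q₁, Q₂, Function.comp_apply]
    refine add_le_add (h2.trans_eq ?_) le_rfl
    simp only [NNReal.val_eq_coe]
    ring
  refine (eLpNorm_mono_real key).trans ((eLpNorm_add_le (hQ₁.const_smul _).aestronglyMeasurable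
    (hQ₂.const_smul _).aestronglyMeasurable (by norm_num)).trans ?_)
  rw [eLpNorm_const_smul, eLpNorm_const_smul, enorm_mul, enorm_mul, enorm_pow, enorm_sqrt_natCast]
  simp only [NNReal.enorm_eq]
  refine add_le_add ?_ ?_
  · gcongr
    exact eLpNorm_mul_rotate_le hα hβ θ
  · gcongr
    refine (eLpNorm_le_of_sq_le_rotate (m := n) hα θ fun p => ?_).trans_eq (by simp)
    rw [Real.sq_sqrt (Finset.sum_nonneg fun _ _ => by positivity)]
    exact sum_sq_mul_sq_le hf _ _

theorem memLp_gradient (hf : Differentiable ℂ f) (h : IsControlledMap f U U' H c d)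
    (hA : eLpNorm (rowBound f ∘ U) 4 (stdGaussian _) ≠ ⊤) :
    MemLp (fun y => ContinuousLinearMap.adjoint (U' y) (spectralGradient f (U y))) 4
      (stdGaussian _) := by
  have hα : MemLp (rowBound f ∘ U) 4 (stdGaussian _) :=
    ⟨((measurable_rowBound hf).comp h.continuous.measurable).aestronglyMeasurable, hA.lt_top⟩
  exact ((hα.const_mul √n).const_mul c).mono' h.continuous_gradient.aestronglyMeasurable
    (ae_of_all _ fun x => h.norm_gradient_le hf x)

theorem memLp_hessian (hf : Differentiable ℂ f) (h : IsControlledMap f U U' H c d)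
    (hA : eLpNorm (rowBound f ∘ U) 4 (stdGaussian _) ≠ ⊤)
    (hB : eLpNorm (hessianBound f ∘ U) 4 (stdGaussian _) ≠ ⊤) :
    MemLp H 4 (stdGaussian _) := by
  have hα : MemLp (rowBound f ∘ U) 4 (stdGaussian _) :=
    ⟨((measurable_rowBound hf).comp h.continuous.measurable).aestronglyMeasurable, hA.lt_top⟩
  have hβ : MemLp (hessianBound f ∘ U) 4 (stdGaussian _) :=
    ⟨((measurable_hessianBound hf).comp h.continuous.measurable).aestronglyMeasurable, hB.lt_top⟩
  refine ((hβ.const_mul ((c : ℝ) ^ 2)).add ((hα.const_mul √n).const_mul (d : ℝ))).mono'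
    h.continuous_hessian.aestronglyMeasurable (ae_of_all _ fun x => (h.norm_hessian_le x).trans ?_)
  exact add_le_add le_rfl (mul_le_mul_of_nonneg_left (norm_spectralGradient_le hf _) d.2)

theorem tvDist_le_of_ne_top (hf : Differentiable ℂ f) (h : IsControlledMap f U U' H c d)
    (hA : eLpNorm (rowBound f ∘ U) 4 (stdGaussian _) ≠ ⊤)
    (hB : eLpNorm (hessianBound f ∘ U) 4 (stdGaussian _) ≠ ⊤)
    (hm : MemLp (spectralFun f ∘ U) 4 (stdGaussian _))
    (hv : 0 < Var[spectralFun f ∘ U; stdGaussian _]) :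
    tvDist ((stdGaussian _).map (spectralFun f ∘ U))
      (gaussianReal (∫ x, (spectralFun f ∘ U) x ∂stdGaussian _)
        (Var[spectralFun f ∘ U; stdGaussian _]).toNNReal) ≤
      4 * (c ^ 3 * (n : ℝ≥0∞) ^ (1 / 2 : ℝ) *
        (eLpNorm (hessianBound f ∘ U) 4 (stdGaussian _) *
          eLpNorm (rowBound f ∘ U) 4 (stdGaussian _)) +
      c * d * ((n : ℝ≥0∞) ^ (1 / 2 : ℝ) * eLpNorm (rowBound f ∘ U) 4 (stdGaussian _) ^ 2)) /
        ENNReal.ofReal Var[spectralFun f ∘ U; stdGaussian _] := by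
  refine tvDist_map_stdGaussian_le_of_eLpNorm_le
    (fun x => hasGradientAt_spectralFun_comp hf (h.hasFDerivAt x)) h.hasFDerivAt_gradient
    h.continuous_hessian hm (h.memLp_gradient hf hA) (h.memLp_hessian hf hA hB) ?_
    (h.eLpNorm_adjoint_le hf) hv
  have hn : (n : ℝ≥0∞) ^ (1 / 2 : ℝ) ≠ ⊤ :=
    ENNReal.rpow_ne_top_of_nonneg (by norm_num) (ENNReal.natCast_ne_top n)
  finiteness

theorem variance_eq_zero (hf : Differentiable ℂ f) (h : IsControlledMap f U U' H c d)
    (h0 : c = 0 ∨ eLpNorm (rowBound f ∘ U) 4 (stdGaussian _) = 0) :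
    Var[spectralFun f ∘ U; stdGaussian _] = 0 := by
  refine variance_eq_zero_of_gradient_ae_eq_zero
    (fun x => hasGradientAt_spectralFun_comp hf (h.hasFDerivAt x)) h.continuous_gradient ?_
  have h1 : ∀ᵐ x ∂stdGaussian (EuclideanSpace ℝ (Fin n × Fin N)),
      (c : ℝ) * (√n * rowBound f (U x)) = 0 := by
    rcases h0 with rfl | h0
    · exact ae_of_all _ fun x => by simp
    · rw [eLpNorm_eq_zero_iff
        ((measurable_rowBound hf).comp h.continuous.measurable).aestronglyMeasurable
        (by norm_num)] at h0
      filter_upwards [h0] with x hx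
      have hx' : rowBound f (U x) = 0 := hx
      rw [hx', mul_zero, mul_zero]
  filter_upwards [h1] with x hx
  exact norm_le_zero_iff.1 ((h.norm_gradient_le hf x).trans_eq hx)

end IsControlledMap

end Composition


/-- Both laws are the same point mass. The case needs its own proof because the bound may then read
`⊤ * 0 = 0`. -/
theorem tvDist_map_gaussianReal_of_variance_eq_zero {Ω : Type*} [MeasurableSpace Ω] {μ : Measure Ω}
    [IsProbabilityMeasure μ] {W : Ω → ℝ} (hW : MemLp W 2 μ) (h : Var[W; μ] = 0) :
    tvDist (μ.map W) (gaussianReal (∫ ω, W ω ∂μ) (Var[W; μ]).toNNReal) = 0 := by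
  have h1 : W =ᵐ[μ] fun _ => ∫ ω, W ω ∂μ := ae_eq_integral_of_variance_eq_zero hW h
  rw [h, Real.toNNReal_zero, gaussianReal_zero_var, Measure.map_congr h1, Measure.map_const,
    measure_univ, one_smul]
  exact tvDist_self _

theorem lintegral_rpow_quarter_pow_four (I : ℝ≥0∞) : (I ^ (1 / 4 : ℝ)) ^ 4 = I := by
  rw [← ENNReal.rpow_natCast, ← ENNReal.rpow_mul]; norm_num

/-! ### The constants `a`, `b` and `8√5` -/

section Constants

variable {n N : ℕ} {f : ℂ → ℂ}

/-- Since `‖X‖ = √(Nλ)`, the row bound is `(2/√N) f₁(λ) √λ`. -/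
theorem eLpNorm_rowBound_comp (hN : 0 < N) {α : Type*} [MeasurableSpace α] {μ : Measure α}
    (U : α → EuclideanSpace ℝ (Fin n × Fin N)) :
    eLpNorm (rowBound f ∘ U) 4 μ = ENNReal.ofReal (2 / √N) *
      (∫⁻ x, ENNReal.ofReal (entireF₁ f (topEigenvalue (U x)) ^ 4 * topEigenvalue (U x) ^ 2) ∂μ)
        ^ (1 / 4 : ℝ) := by
  rw [← (ENNReal.pow_right_strictMono (n := 4) (by norm_num)).injective.eq_iff, mul_pow,
    lintegral_rpow_quarter_pow_four, eLpNorm_four_pow, ← ENNReal.ofReal_pow (by positivity),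
    ← lintegral_const_mul' _ _ ENNReal.ofReal_ne_top]
  refine lintegral_congr fun x => ?_
  rw [← ENNReal.ofReal_mul (by positivity), Function.comp_apply,
    Real.enorm_of_nonneg (rowBound_nonneg _ _), ← ENNReal.ofReal_pow (rowBound_nonneg _ _)]
  congr 1
  have h1 : √(N : ℝ) ^ 4 = N ^ 2 := by
    rw [show (4 : ℕ) = 2 * 2 from rfl, pow_mul, Real.sq_sqrt (Nat.cast_nonneg N)]
  have hN' : (N : ℝ) ≠ 0 := by positivity
  simp only [rowBound, topEigenvalue, div_pow, mul_pow, h1]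
  field_simp

/-- A factor `√n` is extracted: it cancels the `n^(-1/2)` before `f₂` and, being at least 1, only
enlarges the `f₁` term. -/
theorem eLpNorm_hessianBound_comp_le (hn : 0 < n) {α : Type*} [MeasurableSpace α] {μ : Measure α}
    (U : α → EuclideanSpace ℝ (Fin n × Fin N)) :
    eLpNorm (hessianBound f ∘ U) 4 μ ≤ ENNReal.ofReal (2 * √n / N) *
      (∫⁻ x, ENNReal.ofReal ((entireF₁ f (topEigenvalue (U x)) + 2 * (n : ℝ) ^ (-1 / 2 : ℝ) *
        entireF₂ f (topEigenvalue (U x)) * topEigenvalue (U x)) ^ 4) ∂μ) ^ (1 / 4 : ℝ) := by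
  rw [← (ENNReal.pow_right_strictMono (n := 4) (by norm_num)).le_iff_le, mul_pow,
    lintegral_rpow_quarter_pow_four, eLpNorm_four_pow, ← ENNReal.ofReal_pow (by positivity),
    ← lintegral_const_mul' _ _ ENNReal.ofReal_ne_top]
  refine lintegral_mono fun x => ?_
  have h1 := entireF₁_nonneg f (topEigenvalue_nonneg (U x))
  have h2 := entireF₂_nonneg f (topEigenvalue_nonneg (U x))
  have h3 := topEigenvalue_nonneg (U x)
  rw [← ENNReal.ofReal_mul (by positivity), Function.comp_apply,
    Real.enorm_of_nonneg (hessianBound_nonneg _ _), ← ENNReal.ofReal_pow (hessianBound_nonneg _ _),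
    ← mul_pow]
  refine ENNReal.ofReal_le_ofReal (pow_le_pow_left₀ (hessianBound_nonneg _ _) ?_ 4)
  have hs : 1 ≤ √(n : ℝ) := Real.one_le_sqrt.2 (by exact_mod_cast hn)
  have hr : √(n : ℝ) * (n : ℝ) ^ (-1 / 2 : ℝ) = 1 := by
    rw [Real.sqrt_eq_rpow, ← Real.rpow_add (by exact_mod_cast hn)]
    norm_num
  calc hessianBound f (U x) = 2 / N * (1 * entireF₁ f (topEigenvalue (U x)) +
        2 * (topEigenvalue (U x) * entireF₂ f (topEigenvalue (U x)))) := by rw [one_mul]; rfl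
    _ ≤ 2 / N * (√n * entireF₁ f (topEigenvalue (U x)) +
        2 * (topEigenvalue (U x) * entireF₂ f (topEigenvalue (U x)))) := by gcongr
    _ = 2 / N * (√n * entireF₁ f (topEigenvalue (U x)) + (√n * (n : ℝ) ^ (-1 / 2 : ℝ)) *
        (2 * (topEigenvalue (U x) * entireF₂ f (topEigenvalue (U x))))) := by rw [hr, one_mul]
    _ = _ := by ring

theorem sixteen_le : (16 : ℝ≥0∞) ≤ ENNReal.ofReal (8 * √5) := by
  rw [← ENNReal.ofReal_ofNat]
  refine ENNReal.ofReal_le_ofReal ?_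
  have : (2 : ℝ) ≤ √5 := Real.le_sqrt_of_sq_le (by norm_num)
  linarith

theorem ofReal_sqrt_natCast (n : ℕ) : ENNReal.ofReal √(n : ℝ) = (n : ℝ≥0∞) ^ (1 / 2 : ℝ) := by
  rw [← enorm_sqrt_natCast, Real.enorm_of_nonneg (Real.sqrt_nonneg _)]

theorem rpow_half_sq (x : ℝ≥0∞) : (x ^ (1 / 2 : ℝ)) ^ 2 = x := by
  rw [← ENNReal.rpow_natCast, ← ENNReal.rpow_mul]; norm_num

/-- The factor 4 of the second order inequality and one factor 2 from each of two norms make 16 in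
both summands. -/
theorem bound_arith (hN : 0 < N) (c d a b v : ℝ≥0∞) {A B : ℝ≥0∞}
    (hA : A = ENNReal.ofReal (2 / √N) * a) (hB : B ≤ ENNReal.ofReal (2 * √n / N) * b) :
    4 * (c ^ 3 * (n : ℝ≥0∞) ^ (1 / 2 : ℝ) * (B * A) +
      c * d * ((n : ℝ≥0∞) ^ (1 / 2 : ℝ) * A ^ 2)) / v ≤
    ENNReal.ofReal (8 * √5) / v * (c * d * a ^ 2 * (n : ℝ≥0∞) ^ (1 / 2 : ℝ) / N +
      c ^ 3 * a * b * n / (N : ℝ≥0∞) ^ (3 / 2 : ℝ)) := by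
  have hN' : (0 : ℝ) < N := by exact_mod_cast hN
  have hN0 : (N : ℝ≥0∞) ≠ 0 := by exact_mod_cast hN.ne'
  have e1 : ENNReal.ofReal (2 / √N) = 2 / (N : ℝ≥0∞) ^ (1 / 2 : ℝ) := by
    rw [ENNReal.ofReal_div_of_pos (by positivity), ofReal_sqrt_natCast, ENNReal.ofReal_ofNat]
  have e2 : ENNReal.ofReal (2 * √n / N) = 2 * (n : ℝ≥0∞) ^ (1 / 2 : ℝ) / N := by
    rw [ENNReal.ofReal_div_of_pos hN', ENNReal.ofReal_mul (by norm_num), ofReal_sqrt_natCast,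
      ENNReal.ofReal_ofNat, ENNReal.ofReal_natCast]
  have e3 : (N : ℝ≥0∞) ^ (3 / 2 : ℝ) = N * (N : ℝ≥0∞) ^ (1 / 2 : ℝ) := by
    rw [show (3 / 2 : ℝ) = 1 + 1 / 2 by norm_num,
      ENNReal.rpow_add _ _ hN0 (ENNReal.natCast_ne_top N), ENNReal.rpow_one]
  rw [e2] at hB
  rw [e1] at hA
  subst hA
  set r := (n : ℝ≥0∞) ^ (1 / 2 : ℝ) with hr
  set s := (N : ℝ≥0∞) ^ (1 / 2 : ℝ) with hs
  have hrr : r ^ 2 = n := rpow_half_sq _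
  have hss : s ^ 2 = N := rpow_half_sq _
  have hs0 : s ≠ 0 := by
    rw [hs]; exact (ENNReal.rpow_pos (pos_iff_ne_zero.2 hN0) (ENNReal.natCast_ne_top N)).ne'
  have hst : s ≠ ⊤ := ENNReal.rpow_ne_top_of_nonneg (by norm_num) (ENNReal.natCast_ne_top N)
  calc 4 * (c ^ 3 * r * (B * (2 / s * a)) + c * d * (r * (2 / s * a) ^ 2)) / v
      ≤ 4 * (c ^ 3 * r * (2 * r / N * b * (2 / s * a)) + c * d * (r * (2 / s * a) ^ 2)) / v := by
        gcongr
    _ = 16 / v * (c * d * a ^ 2 * r / N + c ^ 3 * a * b * n / (N : ℝ≥0∞) ^ (3 / 2 : ℝ)) := by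
        rw [e3, ← hrr, ← hss]
        simp only [div_eq_mul_inv, ENNReal.mul_inv (Or.inl (pow_ne_zero 2 hs0))
          (Or.inl (ENNReal.pow_ne_top hst)), ENNReal.inv_pow]
        ring
    _ ≤ _ := by gcongr; exact sixteen_le

end Constants

/-! ### The bound with possibly infinite constants -/

section Composition

variable {n N : ℕ} {f : ℂ → ℂ}
  {U : EuclideanSpace ℝ (Fin n × Fin N) → EuclideanSpace ℝ (Fin n × Fin N)}
  {U' H : EuclideanSpace ℝ (Fin n × Fin N) →
    EuclideanSpace ℝ (Fin n × Fin N) →L[ℝ] EuclideanSpace ℝ (Fin n × Fin N)} {c d : ℝ≥0}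

theorem lintegral_entireF₁_eq_zero (hf : Differentiable ℂ f) {α : Type*} [MeasurableSpace α]
    {μ : Measure α} {U : α → EuclideanSpace ℝ (Fin n × Fin N)} (hU : Measurable U)
    (h : ∫⁻ x, ENNReal.ofReal ((entireF₁ f (topEigenvalue (U x)) + 2 * (n : ℝ) ^ (-1 / 2 : ℝ) *
        entireF₂ f (topEigenvalue (U x)) * topEigenvalue (U x)) ^ 4) ∂μ = 0) :
    ∫⁻ x, ENNReal.ofReal
      (entireF₁ f (topEigenvalue (U x)) ^ 4 * topEigenvalue (U x) ^ 2) ∂μ = 0 := by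
  have m1 := (measurable_entireF₁_topEigenvalue hf (n := n) (N := N)).comp hU
  have m2 := (measurable_entireF₂_topEigenvalue hf (n := n) (N := N)).comp hU
  have m3 := (measurable_topEigenvalue (n := n) (N := N)).comp hU
  simp only [Function.comp_def] at m1 m2 m3
  rw [lintegral_eq_zero_iff (by fun_prop)] at h ⊢
  filter_upwards [h] with x hx
  have h1 := entireF₁_nonneg f (topEigenvalue_nonneg (U x))
  have h2 := entireF₂_nonneg f (topEigenvalue_nonneg (U x))
  have h3 := topEigenvalue_nonneg (U x)
  have h4 : 0 ≤ 2 * (n : ℝ) ^ (-1 / 2 : ℝ) * entireF₂ f (topEigenvalue (U x)) *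
    topEigenvalue (U x) := by positivity
  simp only [Pi.zero_apply, ENNReal.ofReal_eq_zero] at hx ⊢
  have h5 := pow_eq_zero_iff (n := 4) (by norm_num) |>.1 (hx.antisymm (by positivity))
  have h6 : entireF₁ f (topEigenvalue (U x)) = 0 := by linarith
  simp [h6]

/-- For positive variance, `c`, `a` and `b` are nonzero: `c = 0` or `a = 0` kills the gradient, and
`b = 0` forces `a = 0`. So if `a` or `b` is infinite, the right side is infinite too. -/
theorem IsControlledMap.tvDist_le (hf : Differentiable ℂ f) (hn : 0 < n) (hN : 0 < N)
    (h : IsControlledMap f U U' H c d) {a b : ℝ≥0∞}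
    (ha : a = (∫⁻ x, ENNReal.ofReal (entireF₁ f (topEigenvalue (U x)) ^ 4 *
      topEigenvalue (U x) ^ 2) ∂stdGaussian _) ^ (1 / 4 : ℝ))
    (hb : b = (∫⁻ x, ENNReal.ofReal ((entireF₁ f (topEigenvalue (U x)) +
      2 * (n : ℝ) ^ (-1 / 2 : ℝ) * entireF₂ f (topEigenvalue (U x)) * topEigenvalue (U x)) ^ 4)
        ∂stdGaussian _) ^ (1 / 4 : ℝ))
    (hm : MemLp (spectralFun f ∘ U) 4 (stdGaussian _)) :
    tvDist ((stdGaussian _).map (spectralFun f ∘ U))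
      (gaussianReal (∫ x, (spectralFun f ∘ U) x ∂stdGaussian _)
        (Var[spectralFun f ∘ U; stdGaussian _]).toNNReal) ≤
      ENNReal.ofReal (8 * √5) / ENNReal.ofReal Var[spectralFun f ∘ U; stdGaussian _] *
        (c * d * a ^ 2 * (n : ℝ≥0∞) ^ (1 / 2 : ℝ) / N +
          c ^ 3 * a * b * n / (N : ℝ≥0∞) ^ (3 / 2 : ℝ)) := by
  rcases (variance_nonneg (spectralFun f ∘ U) (stdGaussian _)).eq_or_lt with hv | hv
  · rw [tvDist_map_gaussianReal_of_variance_eq_zero (hm.mono_exponent (by norm_num)) hv.symm]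
    exact zero_le
  have hA := eLpNorm_rowBound_comp (f := f) hN (μ := stdGaussian _) U
  have hB := eLpNorm_hessianBound_comp_le (f := f) hn (μ := stdGaussian _) U
  rw [← ha] at hA
  rw [← hb] at hB
  have hc0 : c ≠ 0 := fun h0 => hv.ne' (h.variance_eq_zero hf (Or.inl h0))
  have ha0 : a ≠ 0 := fun h0 => hv.ne' (h.variance_eq_zero hf (Or.inr (by rw [hA, h0, mul_zero])))
  have hb0 : b ≠ 0 := fun h0 => ha0 <| by
    rw [hb, ENNReal.rpow_eq_zero_iff_of_pos (by norm_num)] at h0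
    rw [ha, lintegral_entireF₁_eq_zero hf h.continuous.measurable h0,
      ENNReal.zero_rpow_of_pos (by norm_num)]
  by_cases hab : a = ⊤ ∨ b = ⊤
  · have hc0' : (c : ℝ≥0∞) ^ 3 ≠ 0 := by simpa using hc0
    have hn0 : (n : ℝ≥0∞) ≠ 0 := by exact_mod_cast hn.ne'
    have h1 : (c : ℝ≥0∞) ^ 3 * a * b * n = ⊤ := by
      rcases hab with rfl | rfl
      · rw [ENNReal.mul_top hc0', ENNReal.top_mul hb0, ENNReal.top_mul hn0]
      · rw [ENNReal.mul_top (mul_ne_zero hc0' ha0), ENNReal.top_mul hn0]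
    have h2 : ENNReal.ofReal (8 * √5) / ENNReal.ofReal Var[spectralFun f ∘ U; stdGaussian _] ≠ 0 :=
      ENNReal.div_ne_zero.2 ⟨by simp, ENNReal.ofReal_ne_top⟩
    rw [h1, ENNReal.top_div_of_ne_top (ENNReal.rpow_ne_top_of_nonneg (by norm_num)
      (ENNReal.natCast_ne_top N)), add_top, ENNReal.mul_top h2]
    exact le_top
  push Not at hab
  refine (h.tvDist_le_of_ne_top hf ?_ ?_ hm hv).trans (bound_arith hN _ _ a b _ hA hB)
  · rw [hA]
    exact ENNReal.mul_ne_top ENNReal.ofReal_ne_top hab.1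
  · exact ne_top_of_le_ne_top (ENNReal.mul_ne_top ENNReal.ofReal_ne_top hab.2) hB

/-- The bound for a random matrix whose law is the image of the standard Gaussian law. -/
theorem IsControlledMap.tvDist_map_le {Ω : Type*} [MeasurableSpace Ω] {P : Measure Ω}
    (hf : Differentiable ℂ f) (hn : 0 < n) (hN : 0 < N)
    (h : IsControlledMap f U U' H c d) {X : Ω → Matrix (Fin n) (Fin N) ℝ}
    (hX : Measurable fun ω => ofMat (X ω))
    (hlaw : P.map (fun ω => ofMat (X ω)) = (stdGaussian _).map U)
    {lam : Ω → ℝ} (hlam : ∀ ω, lam ω = largestEigenvalue (wishart (X ω))) {a b : ℝ≥0∞}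
    (ha : a = (∫⁻ ω, ENNReal.ofReal (entireF₁ f (lam ω) ^ 4 * lam ω ^ 2) ∂P) ^ (1 / 4 : ℝ))
    (hb : b = (∫⁻ ω, ENNReal.ofReal
      ((entireF₁ f (lam ω) + 2 * (n : ℝ) ^ (-1 / 2 : ℝ) * entireF₂ f (lam ω) * lam ω) ^ 4) ∂P)
        ^ (1 / 4 : ℝ))
    {W : Ω → ℝ}
    (hW : ∀ ω, W ω = (entireMatrix f ((wishart (X ω)).map Complex.ofReal)).trace.re)
    (hW4 : MemLp W 4 P) :
    tvDist (P.map W) (gaussianReal (∫ ω, W ω ∂P) (Var[W; P]).toNNReal) ≤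
      ENNReal.ofReal (8 * √5) / ENNReal.ofReal Var[W; P] *
        (c * d * a ^ 2 * (n : ℝ≥0∞) ^ (1 / 2 : ℝ) / N +
          c ^ 3 * a * b * n / (N : ℝ≥0∞) ^ (3 / 2 : ℝ)) := by
  have hlam' : lam = fun ω => topEigenvalue (ofMat (X ω)) := funext fun ω => by
    rw [hlam, largestEigenvalue_wishart hn, topEigenvalue, toMat_ofMat]
  have hWg : W = spectralFun f ∘ fun ω => ofMat (X ω) := funext fun ω => by
    simp [hW, spectralFun]
  have m1 := measurable_entireF₁_topEigenvalue hf (n := n) (N := N)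
  have m2 := measurable_entireF₂_topEigenvalue hf (n := n) (N := N)
  have m3 := measurable_topEigenvalue (n := n) (N := N)
  have hU := h.continuous.measurable
  have hg : Measurable (spectralFun f : EuclideanSpace ℝ (Fin n × Fin N) → ℝ) :=
    (continuous_iff_continuousAt.2 fun x =>
      (hasGradientAt_spectralFun hf x).hasFDerivAt.continuousAt).measurable
  have transfer (F : EuclideanSpace ℝ (Fin n × Fin N) → ℝ≥0∞) (hF : Measurable F) :
      ∫⁻ ω, F (ofMat (X ω)) ∂P = ∫⁻ x, F (U x) ∂stdGaussian _ := by
    rw [← lintegral_map hF hX, hlaw, lintegral_map hF hU]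
  have ha' : a = _ := ha.trans (by
    rw [hlam', transfer (fun y => ENNReal.ofReal (entireF₁ f (topEigenvalue y) ^ 4 *
      topEigenvalue y ^ 2)) (by fun_prop)])
  have hb' : b = _ := hb.trans (by
    rw [hlam', transfer (fun y => ENNReal.ofReal ((entireF₁ f (topEigenvalue y) +
      2 * (n : ℝ) ^ (-1 / 2 : ℝ) * entireF₂ f (topEigenvalue y) * topEigenvalue y) ^ 4))
      (by fun_prop)])
  have hmap : P.map W = (stdGaussian _).map (spectralFun f ∘ U) := by
    rw [hWg, ← Measure.map_map hg hX, hlaw, Measure.map_map hg hU]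
  have hmean : ∫ ω, W ω ∂P = ∫ x, (spectralFun f ∘ U) x ∂stdGaussian _ := by
    have e := integral_map (μ := P) (f := fun t : ℝ => t) hW4.1.aemeasurable (by fun_prop)
    rw [← e, hmap, integral_map (hg.comp hU).aemeasurable (by fun_prop)]
  have hvar : Var[W; P] = Var[spectralFun f ∘ U; stdGaussian _] := by
    rw [← variance_id_map hW4.1.aemeasurable, hmap, variance_id_map (hg.comp hU).aemeasurable]
  have hm : MemLp (spectralFun f ∘ U) 4 (stdGaussian _) := by
    rw [← Function.id_comp (spectralFun f ∘ U), ← memLp_map_measure_iff (by fun_prop)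
      (hg.comp hU).aemeasurable, ← hmap, memLp_map_measure_iff (by fun_prop) hW4.1.aemeasurable]
    exact hW4
  rw [hmap, hmean, hvar]
  exact h.tvDist_le hf hn hN ha' hb' hm

end Composition


/-! ### Coordinatewise products and maps -/

section Hadamard

variable {ι : Type*} [Fintype ι]

/-- The coordinatewise product of two vectors. -/
noncomputable def hadamardL :
    EuclideanSpace ℝ ι →L[ℝ] EuclideanSpace ℝ ι →L[ℝ] EuclideanSpace ℝ ι :=
  LinearMap.toContinuousLinearMap ((LinearMap.toContinuousLinearMap :
    (EuclideanSpace ℝ ι →ₗ[ℝ] EuclideanSpace ℝ ι) ≃ₗ[ℝ] _).toLinearMap ∘ₗ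
    LinearMap.mk₂ ℝ (fun v w => WithLp.toLp 2 fun i => v i * w i)
      (fun _ _ _ => by ext; simp [add_mul]) (fun _ _ _ => by ext; simp [mul_assoc])
      (fun _ _ _ => by ext; simp [mul_add]) (fun _ _ _ => by ext; simp [mul_left_comm]))

@[simp]
theorem hadamardL_apply (v w : EuclideanSpace ℝ ι) (i : ι) : hadamardL v w i = v i * w i := rfl

theorem adjoint_hadamardL (v : EuclideanSpace ℝ ι) :
    ContinuousLinearMap.adjoint (hadamardL v) = hadamardL v := by
  refine ((ContinuousLinearMap.eq_adjoint_iff _ _).2 fun x y => ?_).symm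
  simp only [PiLp.inner_apply, hadamardL_apply]
  exact Finset.sum_congr rfl fun i _ => by simp; ring

theorem norm_hadamardL_apply_le {v : EuclideanSpace ℝ ι} {c : ℝ} (hc : 0 ≤ c)
    (h : ∀ i, |v i| ≤ c) (w : EuclideanSpace ℝ ι) : ‖hadamardL v w‖ ≤ c * ‖w‖ := by
  rw [← sq_le_sq₀ (norm_nonneg _) (by positivity), mul_pow, EuclideanSpace.norm_sq_eq,
    EuclideanSpace.norm_sq_eq, Finset.mul_sum]
  refine Finset.sum_le_sum fun i _ => ?_
  rw [hadamardL_apply, norm_mul, mul_pow, Real.norm_eq_abs (v i)]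
  exact mul_le_mul_of_nonneg_right (pow_le_pow_left₀ (abs_nonneg _) (h i) 2) (sq_nonneg _)

theorem norm_hadamardL_le {v : EuclideanSpace ℝ ι} {c : ℝ} (hc : 0 ≤ c) (h : ∀ i, |v i| ≤ c) :
    ‖hadamardL v‖ ≤ c :=
  ContinuousLinearMap.opNorm_le_bound _ hc (norm_hadamardL_apply_le hc h)

/-- The map that applies a function of one variable to each coordinate. -/
noncomputable def coordMap (u : ι → ℝ → ℝ) (x : EuclideanSpace ℝ ι) : EuclideanSpace ℝ ι :=
  WithLp.toLp 2 fun i => u i (x i)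

@[simp]
theorem coordMap_apply (u : ι → ℝ → ℝ) (x : EuclideanSpace ℝ ι) (i : ι) :
    coordMap u x i = u i (x i) := rfl

theorem continuous_coordMap {u : ι → ℝ → ℝ} (hu : ∀ i, Continuous (u i)) :
    Continuous (coordMap u) := by
  unfold coordMap
  fun_prop

theorem hasFDerivAt_coordMap {u : ι → ℝ → ℝ} (hu : ∀ i, Differentiable ℝ (u i))
    (x : EuclideanSpace ℝ ι) :
    HasFDerivAt (coordMap u) (hadamardL (coordMap (fun i => deriv (u i)) x)) x := by
  rw [← hasFDerivWithinAt_univ, hasFDerivWithinAt_euclidean]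
  intro i
  have h := (hu i (x i)).hasDerivAt.hasFDerivAt.comp x
    (EuclideanSpace.proj i : EuclideanSpace ℝ ι →L[ℝ] ℝ).hasFDerivAt
  refine (h.congr_fderiv ?_).hasFDerivWithinAt
  ext v
  simp [mul_comm]

end Hadamard

/-! ### The two changes of variables -/

section ControlledMaps

variable {n N : ℕ} {f : ℂ → ℂ}

theorem norm_spectralHessian_le_hessianBound (hf : Differentiable ℂ f)
    (x : EuclideanSpace ℝ (Fin n × Fin N)) : ‖spectralHessian f x‖ ≤ hessianBound f x :=
  norm_spectralHessian_le hf x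

theorem norm_adjoint_spectralHessian_apply_le (hf : Differentiable ℂ f)
    (x v : EuclideanSpace ℝ (Fin n × Fin N)) :
    ‖ContinuousLinearMap.adjoint (spectralHessian f x) v‖ ≤ hessianBound f x * ‖v‖ := by
  refine (ContinuousLinearMap.le_opNorm _ _).trans ?_
  rw [LinearIsometryEquiv.norm_map]
  gcongr
  exact norm_spectralHessian_le_hessianBound hf x

/-- The derivative of `U` is diagonal with entries `u'`. By the product rule the Hessian is the
conjugated Hessian of `spectralFun f` plus a diagonal part with entries `u''` times those of the
gradient. -/
theorem isControlledMap_coordMap (hf : Differentiable ℂ f) {u : Fin n × Fin N → ℝ → ℝ}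
    {c₁ c₂ : ℝ≥0} (hu : ∀ p, ContDiff ℝ 2 (u p)) (h1 : ∀ p x, |deriv (u p) x| ≤ c₁)
    (h2 : ∀ p x, |deriv (deriv (u p)) x| ≤ c₂) :
    IsControlledMap f (coordMap u) (fun x => hadamardL (coordMap (fun p => deriv (u p)) x))
      (fun x => hadamardL (coordMap (fun p => deriv (u p)) x) ∘L
          spectralHessian f (coordMap u x) ∘L hadamardL (coordMap (fun p => deriv (u p)) x) +
        hadamardL (hadamardL (coordMap (fun p => deriv (deriv (u p))) x)
          (spectralGradient f (coordMap u x)))) c₁ c₂ := by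
  have hd (p) : Differentiable ℝ (u p) := (hu p).differentiable (by norm_num)
  have hu1 (p) : ContDiff ℝ 1 (deriv (u p)) := ((contDiff_succ_iff_deriv (n := 1)).1 (hu p)).2.2
  have hd1 (p) : Differentiable ℝ (deriv (u p)) := (hu1 p).differentiable (by norm_num)
  have hc2 (p) : Continuous (deriv (deriv (u p))) := (hu1 p).continuous_deriv le_rfl
  have hUc := continuous_coordMap fun p => (hd p).continuous
  have hD1c := continuous_coordMap fun p => (hd1 p).continuous
  have hD2c := continuous_coordMap hc2
  have hΓc := (continuous_spectralGradient hf (n := n) (N := N)).comp hUc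
  have hHc := (continuous_spectralHessian hf (n := n) (N := N)).comp hUc
  simp only [Function.comp_def] at hΓc hHc
  have b1 (x v) := norm_hadamardL_apply_le (v := coordMap (fun p => deriv (u p)) x) c₁.2
    (fun p => h1 p (x p)) v
  have b1' (x) := norm_hadamardL_le (v := coordMap (fun p => deriv (u p)) x) c₁.2
    (fun p => h1 p (x p))
  have b2 (x v) := norm_hadamardL_apply_le (v := coordMap (fun p => deriv (deriv (u p))) x) c₂.2
    (fun p => h2 p (x p)) v
  simp only [NNReal.val_eq_coe] at b1 b1' b2
  refine ⟨hasFDerivAt_coordMap hd, b1', fun x => ?_, ?_, fun x => ?_, fun x y => ?_⟩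
  · simp only [adjoint_hadamardL]
    refine (hadamardL.hasFDerivAt_of_bilinear (hasFDerivAt_coordMap hd1 x)
      ((hasFDerivAt_spectralGradient hf _).comp x (hasFDerivAt_coordMap hd x))).congr_fderiv ?_
    ext v i
    simp
    ring
  · refine ((hadamardL.continuous.comp hD1c).clm_comp
      (hHc.clm_comp (hadamardL.continuous.comp hD1c))).add (hadamardL.continuous.comp ?_)
    exact (hadamardL.continuous.comp hD2c).clm_apply hΓc
  · refine (norm_add_le _ _).trans (add_le_add ?_ ?_)
    · calc _ ≤ ‖hadamardL (coordMap (fun p => deriv (u p)) x)‖ *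
            (‖spectralHessian f (coordMap u x)‖ *
              ‖hadamardL (coordMap (fun p => deriv (u p)) x)‖) :=
            (ContinuousLinearMap.opNorm_comp_le _ _).trans
              (mul_le_mul_of_nonneg_left (ContinuousLinearMap.opNorm_comp_le _ _) (norm_nonneg _))
        _ ≤ c₁ * (hessianBound f (coordMap u x) * c₁) := by
            have := hessianBound_nonneg f (coordMap u x)
            gcongr
            exacts [b1' x, norm_spectralHessian_le_hessianBound hf _, b1' x]
        _ = _ := by ring
    · refine (norm_hadamardL_le (norm_nonneg _) fun i => ?_).trans (b2 x _)
      exact PiLp.norm_apply_le (p := 2) (β := fun _ => ℝ) _ i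
  · simp only [adjoint_hadamardL, map_add, ContinuousLinearMap.adjoint_comp,
      _root_.add_apply, ContinuousLinearMap.comp_apply]
    refine (norm_add_le _ _).trans (add_le_add ?_ ?_)
    · refine (b1 x _).trans ?_
      have := hessianBound_nonneg f (coordMap u x)
      calc _ ≤ c₁ * (hessianBound f (coordMap u x) *
            (c₁ * (c₁ * ‖spectralGradient f (coordMap u y)‖))) := by
            gcongr
            refine (norm_adjoint_spectralHessian_apply_le hf _ _).trans ?_
            gcongr
            refine (b1 x _).trans ?_
            gcongr
            exact b1 y _
        _ = _ := by ring
    -- Diagonal maps commute: `u'` and `u''` are pulled out with their sup bounds, leaving the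
    -- coordinatewise product of the two gradients.
    · have e : hadamardL (hadamardL (coordMap (fun p => deriv (deriv (u p))) x)
            (spectralGradient f (coordMap u x)))
            (hadamardL (coordMap (fun p => deriv (u p)) y) (spectralGradient f (coordMap u y))) =
          hadamardL (coordMap (fun p => deriv (u p)) y)
            (hadamardL (coordMap (fun p => deriv (deriv (u p))) x)
              (hadamardL (spectralGradient f (coordMap u x))
                (spectralGradient f (coordMap u y)))) := by
        ext i
        simp only [hadamardL_apply]
        ring
      have e' : √(∑ p, spectralGradient f (coordMap u x) p ^ 2 *
          spectralGradient f (coordMap u y) p ^ 2) =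
          ‖hadamardL (spectralGradient f (coordMap u x)) (spectralGradient f (coordMap u y))‖ := by
        simp [EuclideanSpace.norm_eq, mul_pow]
      rw [e, e', mul_assoc]
      exact (b1 y _).trans (mul_le_mul_of_nonneg_left (b2 x _) c₁.2)

/-- A linear map has no second derivative, hence the constant `d = 0`. -/
theorem isControlledMap_clm (hf : Differentiable ℂ f)
    (T : EuclideanSpace ℝ (Fin n × Fin N) →L[ℝ] EuclideanSpace ℝ (Fin n × Fin N)) :
    IsControlledMap f T (fun _ => T)
      (fun x => ContinuousLinearMap.adjoint T ∘L spectralHessian f (T x) ∘L T) ‖T‖₊ 0 := by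
  have bT (v) : ‖T v‖ ≤ ‖T‖ * ‖v‖ := T.le_opNorm v
  have bT' (v) : ‖ContinuousLinearMap.adjoint T v‖ ≤ ‖T‖ * ‖v‖ := by
    simpa using (ContinuousLinearMap.adjoint T).le_opNorm v
  have hH := (continuous_spectralHessian hf (n := n) (N := N)).comp T.continuous
  refine ⟨fun _ => T.hasFDerivAt, fun _ => le_rfl, fun x => ?_, ?_, fun x => ?_, fun x y => ?_⟩
  · exact (ContinuousLinearMap.adjoint T).hasFDerivAt.comp x
      ((hasFDerivAt_spectralGradient hf _).comp x T.hasFDerivAt)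
  · exact continuous_const.clm_comp (hH.clm_comp continuous_const)
  · have := hessianBound_nonneg f (T x)
    calc _ ≤ ‖ContinuousLinearMap.adjoint T‖ * (‖spectralHessian f (T x)‖ * ‖T‖) :=
          (ContinuousLinearMap.opNorm_comp_le _ _).trans
            (mul_le_mul_of_nonneg_left (ContinuousLinearMap.opNorm_comp_le _ _) (norm_nonneg _))
      _ ≤ ‖T‖ * (hessianBound f (T x) * ‖T‖) := by
          rw [LinearIsometryEquiv.norm_map]
          gcongr
          exact norm_spectralHessian_le_hessianBound hf _
      _ = _ := by simp; ring
  · have := hessianBound_nonneg f (T x)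
    simp only [ContinuousLinearMap.adjoint_comp, ContinuousLinearMap.comp_apply,
      ContinuousLinearMap.adjoint_adjoint]
    refine (bT' _).trans ?_
    calc _ ≤ ‖T‖ * (hessianBound f (T x) * (‖T‖ * (‖T‖ * ‖spectralGradient f (T y)‖))) := by
          gcongr
          refine (norm_adjoint_spectralHessian_apply_le hf _ _).trans ?_
          gcongr
          refine (bT _).trans ?_
          gcongr
          exact bT' _
      _ = _ := by simp; ring

end ControlledMaps


/-! ### Data laws as images of the standard Gaussian law -/

section Laws

open scoped MatrixOrder

variable {Ω : Type*} [MeasurableSpace Ω] {P : Measure Ω} [IsProbabilityMeasure P]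
  {ι : Type*} [Fintype ι]

theorem map_toLp_eq_map_coordMap {Y : ι → Ω → ℝ} (hY : ∀ i, Measurable (Y i)) (hi : iIndepFun Y P)
    {u : ι → ℝ → ℝ} (hu : ∀ i, Continuous (u i))
    (hl : ∀ i, P.map (Y i) = (gaussianReal 0 1).map (u i)) :
    P.map (fun ω => WithLp.toLp 2 fun i => Y i ω) =
      (stdGaussian (EuclideanSpace ℝ ι)).map (coordMap u) := by
  have h1 := (iIndepFun_iff_map_fun_eq_pi_map fun i => (hY i).aemeasurable).1 hi
  have (i : ι) : IsProbabilityMeasure ((gaussianReal 0 1).map (u i)) :=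
    Measure.isProbabilityMeasure_map (hu i).measurable.aemeasurable
  have h2 := Measure.pi_map_pi (μ := fun _ : ι => gaussianReal 0 1) (f := u)
    fun i => (hu i).measurable.aemeasurable
  simp only [hl] at h1
  rw [← h2] at h1
  have hm : Measurable fun (x : ι → ℝ) i => u i (x i) :=
    measurable_pi_lambda _ fun i => (hu i).measurable.comp (measurable_pi_apply i)
  have hlp : Measurable (WithLp.toLp 2 : (ι → ℝ) → EuclideanSpace ℝ ι) := by fun_prop
  rw [← map_pi_eq_stdGaussian, Measure.map_map (continuous_coordMap hu).measurable hlp]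
  have h3 := congrArg (Measure.map (WithLp.toLp 2 : (ι → ℝ) → EuclideanSpace ℝ ι)) h1
  rw [Measure.map_map hlp (measurable_pi_lambda _ hY), Measure.map_map hlp hm] at h3
  exact h3

variable [DecidableEq ι] {Y : ι → Ω → ℝ} {S : Matrix ι ι ℝ}

/-- The quadratic form at `x` is the variance of the linear combination of the `Y i` with
coefficients `x i`. -/
theorem posSemidef_of_eq_covariance (hY : ∀ i, MemLp (Y i) 2 P)
    (hS : ∀ i j, S i j = cov[Y i, Y j; P]) : S.PosSemidef := by
  refine Matrix.PosSemidef.of_dotProduct_mulVec_nonneg ?_ fun x => ?_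
  · exact Matrix.IsHermitian.ext fun i j => by rw [star_trivial, hS, hS, covariance_comm]
  · have h := covarianceBilin_apply_pi hY (WithLp.toLp 2 x) (WithLp.toLp 2 x)
    have h0 := covarianceBilin_self_nonneg (μ := P.map fun ω => WithLp.toLp 2 (Y · ω))
      (WithLp.toLp 2 x)
    rw [h] at h0
    refine h0.trans_eq ?_
    simp only [dotProduct, mulVec, star_trivial, Finset.mul_sum, hS]
    exact Finset.sum_congr rfl fun i _ => Finset.sum_congr rfl fun j _ => by ring

theorem map_toLp_eq_multivariateGaussian (hY : HasGaussianLaw (fun ω => (Y · ω)) P)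
    (h0 : ∀ i, ∫ ω, Y i ω ∂P = 0) (hY2 : ∀ i, MemLp (Y i) 2 P)
    (hS : ∀ i j, S i j = cov[Y i, Y j; P]) :
    P.map (fun ω => WithLp.toLp 2 (Y · ω)) = multivariateGaussian 0 S := by
  have hpos := posSemidef_of_eq_covariance hY2 hS
  have hg : HasGaussianLaw (fun ω => WithLp.toLp 2 (Y · ω)) P := hY.toLp_pi 2
  have := hg.isGaussian_map
  refine IsGaussian.ext ?_ ?_
  · rw [integral_id_multivariateGaussian', integral_map hg.aemeasurable (by fun_prop)]
    ext i
    have := (EuclideanSpace.proj i : EuclideanSpace ℝ ι →L[ℝ] ℝ).integral_comp_comm hg.integrable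
    simpa [h0] using this.symm
  · ext x y
    rw [covarianceBilin_apply_pi hY2, covarianceBilin_multivariateGaussian hpos]
    simp only [dotProduct, mulVec, Finset.mul_sum, hS]
    exact Finset.sum_congr rfl fun i _ => Finset.sum_congr rfl fun j _ => by ring

/-- A centred Gaussian law is the image of the standard one under a linear map whose operator norm
is the square root of that of the covariance matrix. -/
theorem exists_multivariateGaussian_zero_eq_map (hS : S.PosSemidef) :
    ∃ T : EuclideanSpace ℝ ι →L[ℝ] EuclideanSpace ℝ ι,
      multivariateGaussian 0 S = (stdGaussian (EuclideanSpace ℝ ι)).map T ∧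
      matrixOpNorm S ^ (3 / 2 : ℝ) = (‖T‖₊ : ℝ≥0∞) ^ 3 := by
  refine ⟨toEuclideanCLM (𝕜 := ℝ) (CFC.sqrt S), by simp [multivariateGaussian], ?_⟩
  set T := toEuclideanCLM (𝕜 := ℝ) (CFC.sqrt S) with hT
  have hsa : star (CFC.sqrt S) = CFC.sqrt S := (CFC.sqrt_nonneg S).isSelfAdjoint
  -- `T` is the self-adjoint square root of `S`, so `‖S‖ = ‖T‖²`. The square root exists for
  -- singular `S` as well.
  have h1 : toEuclideanCLM (𝕜 := ℝ) S = star T * T := by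
    rw [hT, ← map_star, hsa, ← map_mul, CFC.sqrt_mul_sqrt_self S hS.nonneg]
  have h2 : ‖toEuclideanCLM (𝕜 := ℝ) S‖₊ = ‖T‖₊ * ‖T‖₊ :=
    NNReal.eq ((congrArg norm h1).trans (ContinuousLinearMap.norm_adjoint_comp_self T))
  rw [matrixOpNorm, enorm_eq_nnnorm, h2, ENNReal.coe_mul, ← sq, ← ENNReal.rpow_natCast,
    ← ENNReal.rpow_mul, ← ENNReal.rpow_natCast]
  norm_num

end Laws

/-! ### The main theorem -/

theorem mainTheorem8 {Ω : Type*} [MeasurableSpace Ω] (P : Measure Ω) [IsProbabilityMeasure P]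
    (n N : ℕ) (hn : 0 < n) (hnN : n ≤ N)
    (X : Ω → Matrix (Fin n) (Fin N) ℝ) (hX : ∀ i j, Measurable fun ω => X ω i j)
    (f : ℂ → ℂ) (hf : Differentiable ℂ f)
    (lam : Ω → ℝ) (hlam : ∀ ω, lam ω = largestEigenvalue (wishart (X ω)))
    (a b : ℝ≥0∞)
    (ha : a = (∫⁻ ω, ENNReal.ofReal (entireF₁ f (lam ω) ^ 4 * lam ω ^ 2) ∂P) ^ (1 / 4 : ℝ))
    (hb : b = (∫⁻ ω, ENNReal.ofReal
      ((entireF₁ f (lam ω) + 2 * (n : ℝ) ^ (-1 / 2 : ℝ) * entireF₂ f (lam ω) * lam ω) ^ 4) ∂P)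
        ^ (1 / 4 : ℝ))
    (W : Ω → ℝ)
    (hW : ∀ ω, W ω = (entireMatrix f ((wishart (X ω)).map Complex.ofReal)).trace.re)
    (hW4 : MemLp W 4 P) :
    (∀ c₁ c₂ : ℝ≥0,
      iIndepFun (fun (p : Fin n × Fin N) ω => X ω p.1 p.2) P →
      (∀ i j, P.map (fun ω => X ω i j) ∈ LawClass c₁ c₂) →
      tvDist (P.map W) (gaussianReal (∫ ω, W ω ∂P) (Var[W; P]).toNNReal) ≤
        ENNReal.ofReal (8 * √5) / ENNReal.ofReal Var[W; P] *
          (c₁ * c₂ * a ^ 2 * (n : ℝ≥0∞) ^ (1 / 2 : ℝ) / N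
            + c₁ ^ 3 * a * b * n / (N : ℝ≥0∞) ^ (3 / 2 : ℝ))) ∧
    (∀ S : Matrix (Fin n × Fin N) (Fin n × Fin N) ℝ,
      HasGaussianLaw (fun ω (p : Fin n × Fin N) => X ω p.1 p.2) P →
      (∀ i j, ∫ ω, X ω i j ∂P = 0) →
      (∀ p q, S p q = cov[fun ω => X ω p.1 p.2, fun ω => X ω q.1 q.2; P]) →
      tvDist (P.map W) (gaussianReal (∫ ω, W ω ∂P) (Var[W; P]).toNNReal) ≤
        ENNReal.ofReal (8 * √5) * matrixOpNorm S ^ (3 / 2 : ℝ) * a * b * n /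
          (ENNReal.ofReal Var[W; P] * (N : ℝ≥0∞) ^ (3 / 2 : ℝ))) := by
  have hN : 0 < N := hn.trans_le hnN
  have hXm : Measurable fun ω => ofMat (X ω) := by
    have : Measurable fun ω => fun p : Fin n × Fin N => X ω p.1 p.2 :=
      measurable_pi_lambda _ fun p => hX p.1 p.2
    exact (by fun_prop : Measurable (WithLp.toLp 2 : (Fin n × Fin N → ℝ) → _)).comp this
  refine ⟨fun c₁ c₂ hi hlaw => ?_, fun S hg h0 hS => ?_⟩
  · choose u hu h1 h2 hu' using hlaw
    have hlaw : P.map (fun ω => ofMat (X ω)) = _ :=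
      map_toLp_eq_map_coordMap (Y := fun (p : Fin n × Fin N) ω => X ω p.1 p.2)
        (fun p => hX p.1 p.2) hi (fun p => (hu p.1 p.2).continuous) fun p => hu' p.1 p.2
    exact (isControlledMap_coordMap hf (fun p => hu p.1 p.2) (fun p => h1 p.1 p.2)
      (fun p => h2 p.1 p.2)).tvDist_map_le hf hn hN hXm hlaw hlam ha hb hW hW4
  · have hY2 (p : Fin n × Fin N) : MemLp (fun ω => X ω p.1 p.2) 2 P := (hg.eval p).memLp_two
    obtain ⟨T, hT, hTS⟩ :=
      exists_multivariateGaussian_zero_eq_map (posSemidef_of_eq_covariance hY2 hS)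
    have hlaw : P.map (fun ω => ofMat (X ω)) = _ :=
      (map_toLp_eq_multivariateGaussian (Y := fun (p : Fin n × Fin N) ω => X ω p.1 p.2) hg
        (fun p => h0 p.1 p.2) hY2 hS).trans hT
    refine ((isControlledMap_clm hf T).tvDist_map_le hf hn hN
      hXm hlaw hlam ha hb hW hW4).trans_eq ?_
    have hN0 : (N : ℝ≥0∞) ≠ 0 := by exact_mod_cast hN.ne'
    have hp0 : (N : ℝ≥0∞) ^ (3 / 2 : ℝ) ≠ 0 :=
      (ENNReal.rpow_pos (pos_iff_ne_zero.2 hN0) (ENNReal.natCast_ne_top N)).ne'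
    have hpt : (N : ℝ≥0∞) ^ (3 / 2 : ℝ) ≠ ⊤ :=
      ENNReal.rpow_ne_top_of_nonneg (by norm_num) (ENNReal.natCast_ne_top N)
    -- What remains is the general bound with `c = ‖T‖` and `d = 0`, in which the first summand
    -- vanishes.
    rw [hTS]
    generalize (N : ℝ≥0∞) ^ (3 / 2 : ℝ) = q at hp0 hpt ⊢
    simp only [ENNReal.coe_zero, mul_zero, zero_mul, zero_add, div_eq_mul_inv]
    rw [ENNReal.mul_inv (Or.inr hpt) (Or.inr hp0)]
    ring
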